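/- **Setting.** Let $d\in\mathbb N$, $\lambda>0$, $\Box=(-\frac12,\frac12)^d$, and let $\Omega$ be the set of measurable fields $a:\mathbb R^d\to\mathbb R^{d\times d}_{\rm sym}$ such that for a.e. $x$ and all $\xi\in\mathbb R^d$: $\xi\cdot a(x)\xi\ge\lambda|\xi|^2$ and $|a(x)\xi|\le|\xi|$. Let $\Omega$ carry a $\sigma$-algebra and a probability measure $\mathbb P$ (expectation $\mathbb E$) such that $(a,x)\mapsto a(x)$ is measurable (up to a $\mathbb P\otimes dx$-null set) and the shift $(z,a)\mapsto\tau_za:=a(\cdot+z)$ is measurable. Assume that for all $g\in L^1(\Omega,\mathbb P)$: $\mathbb E[g\circ\tau_z]=\mathbb E[g]$ for all $z\in\mathbb R^d$ (stationarity), and $\lim_{R\to\infty}R^{-d}\int_{R\Box}g(\tau_za)\,dz=\mathbb E[g]$ for $\mathbb P$-a.e. $a$ (ergodicity). **Extended corrector.** A measurable $v:\Omega\times\mathbb R^d\to\mathbb R$ is a stationary field if $\mathbb E\int_Q|v|<\infty$ for all cubes $Q=z+\ell\Box$ ($z\in\mathbb R^d$, $\ell>0$), and for $\mathbb P$-a.e.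 $a$, $\int_{x+Q}v(a,y)\,dy=\int_Qv(\tau_xa,y)\,dy$ for all such $Q$ and all $x\in\mathbb R^d$. Let $\mathcal H$ be the space of measurable $u:\Omega\times\mathbb R^d\to\mathbb R$ with $u(a,\cdot)\in H^1_{\rm loc}(\mathbb R^d)$ almost surely, $\mathbb E\int_\Box(|u|^2+|\nabla u|^2)<\infty$, $\int_\Box u=0$ almost surely, and $\nabla u$ stationary. The extended corrector $(\phi,\sigma)$ consists of $\phi_i,\sigma_{ijk}\in\mathcal H$ ($1\le i,j,k\le d$) which grow sublinearly almost surely, i.e. $R^{-2-d}\int_{R\Box}|\phi_i|^2\to0$ and $R^{-2-d}\int_{R\Box}|\sigma_{ijk}|^2\to0$ as $R\to\infty$, and which satisfy almost surely $$-\nabla\cdot a(\nabla\phi_i+e_i)=0,\qquad -\Delta\sigma_{ijk}=\partial_jq_{ik}-\partial_kq_{ij},\qquad \sigma_{ijk}=-\sigma_{ikj},\qquad \sum_{k}\partial_k\sigma_{ijk}=q_{ij}$$ in the sense of distributions on $\mathbb R^d$, where $q_i:=a(\nabla\phi_i+e_i)-a_{\rm hom}e_i$ and $a_{\rm hom}e_i:=\mathbb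 E\int_\Box a(\nabla\phi_i+e_i)$. **Theorem (two-scale expansion error).** There is a constant $C=C(d,\lambda)$ such that the following holds in the above setting. Let $\alpha>0$ and $f\in L^2(\mathbb R^d)$, and let $u_0\in H^1(\mathbb R^d)$ be the weak solution to $\alpha u_0-\nabla\cdot a_{\rm hom}\nabla u_0=f$ on $\mathbb R^d$. Then $\nabla u_0\in H^1(\mathbb R^d)$, and for $\mathbb P$-a.e. $a\in\Omega$ and all $\varepsilon>0$: if $u_\varepsilon(a,\cdot)\in H^1(\mathbb R^d)$ is the weak solution to $\alpha u_\varepsilon-\nabla\cdot a(\tfrac{x}{\varepsilon})\nabla u_\varepsilon=f$ on $\mathbb R^d$, then $$Z_\varepsilon(a,\cdot)=u_\varepsilon(a,\cdot)-\Big(u_0+\varepsilon\sum_{i=1}^d\phi_i(a,\tfrac{\cdot}{\varepsilon})\,\partial_iu_0\Big)$$ is weakly differentiable and $$\alpha\int|Z_\varepsilon|^2+\lambda\int|\nabla Z_\varepsilon|^2\le C\,\varepsilon^2\Big(\alpha\int|\phi(\tfrac{\cdot}{\varepsilon})|^2|\nabla u_0|^2+\int\big(|\sigma(\tfrac{\cdot}{\varepsilon})|^2+|a(\tfrac{\cdot}{\varepsilon})|^2|\phi(\tfrac{\cdot}{\varepsilon})|^2\big)|\nabla\nabla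 u_0|^2\Big).$$ Here all integrals are over $\mathbb R^d$ with values in $[0,\infty]$, and $|\phi|$, $|\sigma|$, $|a|$, $|\nabla\nabla u_0|$ are Euclidean norms of the collections of all components. -/

import Mathlib

open MeasureTheory Filter Topology
open scoped ENNReal

noncomputable section

namespace TwoScale

/-- The Euclidean space `ℝ^d`. -/
abbrev E (d : ℕ) : Type := EuclideanSpace ℝ (Fin d)

/-- The standard basis vector `e_i`. -/
def basisVec {d : ℕ} (i : Fin d) : E d := EuclideanSpace.single i (1 : ℝ)

/-- Action of a matrix on a vector of the Euclidean space. -/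
def matVec {d : ℕ} (A : Matrix (Fin d) (Fin d) ℝ) (ξ : E d) : E d :=
  WithLp.toLp 2 (A.mulVec ξ.ofLp)

/-- The open cube `x + ℓ □`, where `□ = (-1/2, 1/2)^d`. -/
def cube {d : ℕ} (x : E d) (ℓ : ℝ) : Set (E d) := {y | ∀ i, |y i - x i| < ℓ / 2}

/-- The unit box `□ = (-1/2, 1/2)^d`. -/
def unitBox (d : ℕ) : Set (E d) := cube 0 1

/-- Test functions: smooth functions with compact support. -/
def IsTest {d : ℕ} (η : E d → ℝ) : Prop :=
  ContDiff ℝ (⊤ : ℕ∞) η ∧ HasCompactSupport η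

/-- The partial derivative `∂_i η` of a smooth function. -/
def pderiv {d : ℕ} (i : Fin d) (η : E d → ℝ) (x : E d) : ℝ := fderiv ℝ η x (basisVec i)

/-- `G` is the weak (distributional) gradient of `u` on `ℝ^d`. -/
structure HasWeakGradient {d : ℕ} (u : E d → ℝ) (G : E d → E d) : Prop where
  locallyIntegrable : LocallyIntegrable u volume
  locallyIntegrable_grad : LocallyIntegrable G volume
  integral_eq : ∀ η : E d → ℝ, IsTest η → ∀ i : Fin d,
    ∫ x, u x * pderiv i η x = - ∫ x, G x i * η x

/-- `u ∈ H¹(ℝ^d)` with weak gradient `G`. -/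
structure IsH1 {d : ℕ} (u : E d → ℝ) (G : E d → E d) : Prop where
  weakGradient : HasWeakGradient u G
  memLp : MemLp u 2 volume
  memLp_grad : MemLp G 2 volume

/-- `u ∈ H¹_loc(ℝ^d)` with weak gradient `G`. -/
structure IsH1loc {d : ℕ} (u : E d → ℝ) (G : E d → E d) : Prop where
  weakGradient : HasWeakGradient u G
  memLp : ∀ K : Set (E d), IsCompact K → MemLp u 2 (volume.restrict K)
  memLp_grad : ∀ K : Set (E d), IsCompact K → MemLp G 2 (volume.restrict K)

/-- `u ∈ H¹(ℝ^d)`, with weak gradient `Du`, is a weak solution of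
`α u - ∇ · (A ∇u) = f` on `ℝ^d`. -/
structure IsWeakSolution {d : ℕ} (A : E d → Matrix (Fin d) (Fin d) ℝ) (α : ℝ) (f : E d → ℝ)
    (u : E d → ℝ) (Du : E d → E d) : Prop where
  isH1 : IsH1 u Du
  integral_eq : ∀ η : E d → ℝ, IsTest η →
    α * (∫ x, u x * η x) + ∫ x, ∑ j, matVec (A x) (Du x) j * pderiv j η x = ∫ x, f x * η x

/-- The configuration space `Ω` of symmetric, measurable coefficient fields that are uniformly
elliptic with ellipticity constant `lam` (and upper bound `1`). -/
structure CoeffField (d : ℕ) (lam : ℝ) where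
  toFun : E d → Matrix (Fin d) (Fin d) ℝ
  measurable : ∀ i j, Measurable fun x => toFun x i j
  symm : ∀ x, (toFun x).IsSymm
  elliptic : ∀ᵐ x ∂(volume : Measure (E d)), ∀ ξ : E d,
    lam * ‖ξ‖ ^ 2 ≤ inner ℝ ξ (matVec (toFun x) ξ) ∧ ‖matVec (toFun x) ξ‖ ≤ ‖ξ‖

/-- The shift `τ_z a = a(· + z)`. -/
def CoeffField.shift {d : ℕ} {lam : ℝ} (z : E d) (a : CoeffField d lam) : CoeffField d lam where
  toFun x := a.toFun (x + z)
  measurable i j := (a.measurable i j).comp (measurable_id.add_const z)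
  symm x := a.symm (x + z)
  elliptic := (measurePreserving_add_right (volume : Measure (E d)) z).quasiMeasurePreserving.ae
    a.elliptic

/-- Stationarity and ergodicity of the law `P` on the configuration space. The first field is the
compatibility of the sigma-algebra on `Ω` with the random field `(a, x) ↦ a(x)`, the second one
the measurability of the shift. -/
structure StationaryErgodic {d : ℕ} {lam : ℝ} [MeasurableSpace (CoeffField d lam)]
    (P : Measure (CoeffField d lam)) : Prop where
  aestronglyMeasurable_eval : ∀ i j, AEStronglyMeasurable
    (fun p : CoeffField d lam × E d => p.1.toFun p.2 i j) (P.prod volume)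
  measurable_shift : Measurable fun p : E d × CoeffField d lam => p.2.shift p.1
  stationary : ∀ (z : E d) (g : CoeffField d lam → ℝ), Integrable g P →
    ∫ a, g (a.shift z) ∂P = ∫ a, g a ∂P
  ergodic : ∀ g : CoeffField d lam → ℝ, Integrable g P → ∀ᵐ a ∂P,
    Tendsto (fun R : ℝ => ⨍ z in cube (0 : E d) R, g (a.shift z)) atTop (𝓝 (∫ a, g a ∂P))

/-- Stationary `L¹` random fields. -/
structure IsStationaryField {d : ℕ} {lam : ℝ} [MeasurableSpace (CoeffField d lam)]
    (P : Measure (CoeffField d lam)) (u : CoeffField d lam → E d → ℝ) : Prop where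
  aestronglyMeasurable : AEStronglyMeasurable
    (fun p : CoeffField d lam × E d => u p.1 p.2) (P.prod volume)
  lintegral_lt_top : ∀ (z : E d) (ℓ : ℝ), 0 < ℓ →
    ∫⁻ a, (∫⁻ y in cube z ℓ, ‖u a y‖ₑ) ∂P < ∞
  stationary : ∀ᵐ a ∂P, ∀ (z : E d) (ℓ : ℝ), 0 < ℓ → ∀ x : E d,
    ∫ y in cube (x + z) ℓ, u a y = ∫ y in cube z ℓ, u (a.shift x) y

/-- The space `𝓗` of random `H¹_loc`-fields `u`, with gradient `Du`, that are square integrable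
together with their gradient over `Ω × □`, have zero average over `□`, and whose gradient is
stationary. -/
structure InH {d : ℕ} {lam : ℝ} [MeasurableSpace (CoeffField d lam)]
    (P : Measure (CoeffField d lam)) (u : CoeffField d lam → E d → ℝ)
    (Du : CoeffField d lam → E d → E d) : Prop where
  aestronglyMeasurable : AEStronglyMeasurable
    (fun p : CoeffField d lam × E d => u p.1 p.2) (P.prod volume)
  isH1loc : ∀ᵐ a ∂P, IsH1loc (u a) (Du a)
  lintegral_lt_top : ∫⁻ a, (∫⁻ y in unitBox d, (‖u a y‖ₑ ^ 2 + ‖Du a y‖ₑ ^ 2)) ∂P < ∞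
  average_eq_zero : ∫⁻ a, ‖⨍ y in unitBox d, u a y‖ₑ ∂P = 0
  stationary_grad : ∀ j, IsStationaryField P fun a y => Du a y j

/-- Sublinear growth: `R⁻² ⨍_{R□} |u|² → 0` as `R → ∞`. -/
def Sublinear {d : ℕ} (u : E d → ℝ) : Prop :=
  Tendsto (fun R : ℝ => (R ^ 2)⁻¹ * ⨍ y in cube (0 : E d) R, u y ^ 2) atTop (𝓝 0)

/-- The flux `a (∇φ_i + e_i)` for a single coefficient field. -/
def flux {d : ℕ} {lam : ℝ} (Dφ : Fin d → CoeffField d lam → E d → E d) (i : Fin d)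
    (a : CoeffField d lam) (y : E d) : E d :=
  matVec (a.toFun y) (Dφ i a y + basisVec i)

/-- The homogenized matrix: its `i`-th column is the expectation of `⨍_□ a (∇φ_i + e_i)`. -/
def ahom {d : ℕ} {lam : ℝ} [MeasurableSpace (CoeffField d lam)] (P : Measure (CoeffField d lam))
    (Dφ : Fin d → CoeffField d lam → E d → E d) : Matrix (Fin d) (Fin d) ℝ :=
  Matrix.of fun j i => ∫ a, (⨍ y in unitBox d, flux Dφ i a y j) ∂P

/-- The centered flux `q_i = a (∇φ_i + e_i) - a_hom e_i`. -/
def qField {d : ℕ} {lam : ℝ} [MeasurableSpace (CoeffField d lam)] (P : Measure (CoeffField d lam))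
    (Dφ : Fin d → CoeffField d lam → E d → E d) (i : Fin d)
    (a : CoeffField d lam) (y : E d) : E d :=
  flux Dφ i a y - matVec (ahom P Dφ) (basisVec i)

/-- `(φ, σ)`, with gradients `(Dφ, Dσ)`, is the extended corrector of `P`. The convention for the
divergence is `(∇ · σ_i)_j = ∑_k ∂_k σ_{ijk}`. -/
structure IsExtendedCorrector {d : ℕ} {lam : ℝ} [MeasurableSpace (CoeffField d lam)]
    (P : Measure (CoeffField d lam))
    (φ : Fin d → CoeffField d lam → E d → ℝ)
    (Dφ : Fin d → CoeffField d lam → E d → E d)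
    (σ : Fin d → Fin d → Fin d → CoeffField d lam → E d → ℝ)
    (Dσ : Fin d → Fin d → Fin d → CoeffField d lam → E d → E d) : Prop where
  inH_phi : ∀ i, InH P (φ i) (Dφ i)
  inH_sigma : ∀ i j k, InH P (σ i j k) (Dσ i j k)
  sublinear_phi : ∀ i, ∀ᵐ a ∂P, Sublinear (φ i a)
  sublinear_sigma : ∀ i j k, ∀ᵐ a ∂P, Sublinear (σ i j k a)
  /-- `-∇ · a (∇φ_i + e_i) = 0`. -/
  corrector_eq : ∀ i, ∀ᵐ a ∂P, ∀ η : E d → ℝ, IsTest η →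
    ∫ x, ∑ j, flux Dφ i a x j * pderiv j η x = 0
  /-- `-Δ σ_{ijk} = ∂_j q_{ik} - ∂_k q_{ij}`. -/
  sigma_eq : ∀ i j k, ∀ᵐ a ∂P, ∀ η : E d → ℝ, IsTest η →
    ∫ x, ∑ l, Dσ i j k a x l * pderiv l η x
      = ∫ x, (qField P Dφ i a x j * pderiv k η x - qField P Dφ i a x k * pderiv j η x)
  /-- `σ_i` is skew symmetric. -/
  skew : ∀ i j k, ∀ᵐ a ∂P, ∀ᵐ x ∂(volume : Measure (E d)), σ i k j a x = - σ i j k a x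
  /-- `∇ · σ_i = q_i`. -/
  div_sigma : ∀ i j, ∀ᵐ a ∂P, ∀ η : E d → ℝ, IsTest η →
    - ∫ x, ∑ k, σ i j k a x * pderiv k η x = ∫ x, qField P Dφ i a x j * η x

/-- The remainder `Z_ε = u_ε - (u_0 + ε ∑_i φ_i(·/ε) ∂_i u_0)` of the two-scale expansion, for one
realization `φ` of the corrector and with `Du0 = ∇u_0`. -/
def remainder {d : ℕ} (φ : Fin d → E d → ℝ) (ε : ℝ) (uε u0 : E d → ℝ) (Du0 : E d → E d)
    (x : E d) : ℝ :=
  uε x - (u0 x + ε * ∑ i, φ i (ε⁻¹ • x) * Du0 x i)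

end TwoScale

end

noncomputable section

namespace TwoScale

/-! Write φ, σ for the correctors rescaled to size ε and p = Σ φ_i ∂_i u0. The flux a(∇φ_i + e_i)
equals a_hom e_i plus the divergence of the skew field σ_i. Subtracting the equations of u_ε and u0
therefore gives, for Z = u_ε - u0 - p, α(Z + p) - ∇·(a∇Z - H) = 0, with H = Σ σ_{i··} ∇∂_i u0 - Σ
φ_i a∇∂_i u0, a right-hand side that contains no gradient of a corrector
(`CorrectorData.integral_flux_corrector`, `CorrectorData.remainder_eq`). Testing with Z yields the
bound: |p|² and |H|² are controlled by Cauchy-Schwarz through the two integrands of the right-hand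
side (`remainderFlux_norm_sq_le`, `lintegral_energy_le`).

Three points make this rigorous.

First, u0 must have square integrable second derivatives, which needs ellipticity of a_hom. On a
large ball the energy of Σ ξ_i(φ_i + x_i) is bounded below by |ξ|² up to a boundary term in φ, and
its mean flux in direction ξ is ξ·a_hom ξ up to a boundary term in σ. Sublinear growth removes both
terms (`CorrectorData.energy_le`, `CorrectorData.flux_le`, `CorrectorData.hom_elliptic`). Difference
quotients then give the regularity (`diffQuotient_energy`, `exists_second_derivatives`).

Second, Z is an admissible test function only if ∇Z is locally square integrable, whereas the term
∂_i u0 ∇φ_i in ∇Z is a priori a product of two L² functions. If the right-hand side is infinite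
nothing is to be shown. If it is finite, φ_i ∂_i u0 and φ_i ∇∂_i u0 are square integrable, and a
Caccioppoli inequality for the a-harmonic function φ_i + x_i with weight ∂_i u0 gives the missing
integrability (`l2loc_mul_grad`).

Third, ∇Z is then only locally square integrable, so the test function is χ²Z with a cut-off χ. Its
error is controlled by |∇χ|² Z², which vanishes as χ expands because Z itself is in L².

All of this concerns one realization (`CorrectorData`). Replacing (φ, σ) by ε(φ, σ)(·/ε) gives a
corrector of a(·/ε) with the same a_hom (`CorrectorData.comp_smul`), so the estimate at unit scale
suffices. -/

/-! ### Mollification in L². -/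

/-- Translations act continuously on L², here through the additive domain action on `Lp`. -/
theorem tendsto_eLpNorm_translate_sub {d : ℕ} {g : E d → ℝ} (hg : MemLp g 2 volume) :
    Tendsto (fun y : E d => eLpNorm (fun x => g (y + x) - g x) 2 volume) (𝓝 0) (𝓝 0) := by
  have h1 : Continuous fun y : E d =>
      (DomAddAct.mk y +ᵥ hg.toLp g : Lp ℝ 2 (volume : Measure (E d))) := by
    have : Fact ((2 : ℝ≥0∞) ≠ ∞) := ⟨by norm_num⟩
    have : Continuous fun y : E d => (DomAddAct.mk y : (E d)ᵈᵃᵃ) := DomAddAct.continuous_mk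
    exact Continuous.vadd this continuous_const
  have h2 : Tendsto (fun y : E d => edist (DomAddAct.mk y +ᵥ hg.toLp g) (hg.toLp g))
      (𝓝 0) (𝓝 0) := by
    have h3 : Continuous fun y : E d => edist (DomAddAct.mk y +ᵥ hg.toLp g) (hg.toLp g) :=
      h1.edist continuous_const
    have h4 := h3.tendsto 0
    have h5 : (DomAddAct.mk (0 : E d) +ᵥ hg.toLp g) = hg.toLp g := by
      rw [DomAddAct.mk_vadd_toLp]
      simp
    rwa [h5, edist_self] at h4
  refine h2.congr fun y => ?_
  rw [DomAddAct.mk_vadd_toLp, Lp.edist_toLp_toLp]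
  rfl

/-- Jensen's inequality: ρ dx is a probability measure, for which the L¹ norm is at most the L²
norm. -/
theorem enorm_integral_mul_sq_le {d : ℕ} {ρ F : E d → ℝ} (hρ : Continuous ρ) (hρ0 : ∀ x, 0 ≤ ρ x)
    (hρi : Integrable ρ) (hρ1 : ∫ x, ρ x = 1) (hF : AEStronglyMeasurable F volume) :
    ‖∫ x, ρ x * F x‖ₑ ^ 2 ≤ ∫⁻ x, ENNReal.ofReal (ρ x) * ‖F x‖ₑ ^ 2 := by
  have hm : Measurable fun x => ENNReal.ofReal (ρ x) := hρ.measurable.ennreal_ofReal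
  set ν : Measure (E d) := volume.withDensity fun x => ENNReal.ofReal (ρ x) with hν
  have hprob : IsProbabilityMeasure ν := by
    constructor
    rw [hν, withDensity_apply _ MeasurableSet.univ, Measure.restrict_univ,
      ← ofReal_integral_eq_lintegral_ofReal hρi (ae_of_all _ hρ0), hρ1, ENNReal.ofReal_one]
  have hFν : AEStronglyMeasurable F ν := hF.mono_ac (withDensity_absolutelyContinuous _ _)
  have h1 : ‖∫ x, ρ x * F x‖ₑ ≤ eLpNorm F 1 ν := by
    refine (enorm_integral_le_lintegral_enorm _).trans ?_
    rw [eLpNorm_one_eq_lintegral_enorm, lintegral_withDensity_eq_lintegral_mul₀ hm.aemeasurable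
      hF.enorm]
    refine lintegral_mono fun x => ?_
    simp [enorm_mul, Real.enorm_of_nonneg (hρ0 x)]
  have h2 : eLpNorm F 1 ν ≤ eLpNorm F 2 ν :=
    eLpNorm_le_eLpNorm_of_exponent_le (by norm_num) hFν
  have h3 : eLpNorm F 2 ν ^ 2 = ∫⁻ x, ENNReal.ofReal (ρ x) * ‖F x‖ₑ ^ 2 := by
    have := eLpNorm_nnreal_pow_eq_lintegral (f := F) (μ := ν) (p := 2) (by norm_num)
    simp only [NNReal.coe_ofNat, ENNReal.coe_ofNat, ENNReal.rpow_ofNat] at this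
    rw [this, lintegral_withDensity_eq_lintegral_mul₀ hm.aemeasurable (hF.enorm.pow_const _)]
    rfl
  rw [← h3]
  gcongr
  exact h1.trans h2

theorem eLpNorm_two_sq {d : ℕ} {V : Type*} [NormedAddCommGroup V] (f : E d → V)
    (μ : Measure (E d)) : eLpNorm f 2 μ ^ 2 = ∫⁻ x, ‖f x‖ₑ ^ 2 ∂μ := by
  have := eLpNorm_nnreal_pow_eq_lintegral (f := f) (μ := μ) (p := 2) (by norm_num)
  simpa only [NNReal.coe_ofNat, ENNReal.coe_ofNat, ENNReal.rpow_ofNat] using this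

/-- Mollification with the kernel `ρ`. -/
def mollify {d : ℕ} (ρ g : E d → ℝ) (x : E d) : ℝ := ∫ y, ρ y * g (x - y)

/-- As ρ has mass one, the error at x is the ρ-average of g(x - y) - g(x). Jensen's inequality at
fixed x and Tonelli's theorem reduce it to the L² moduli of continuity of g. -/
theorem eLpNorm_mollify_sub_sq_le {d : ℕ} {ρ g : E d → ℝ} (hρ : Continuous ρ) (hρ0 : ∀ x, 0 ≤ ρ x)
    (hρc : HasCompactSupport ρ) (hρ1 : ∫ x, ρ x = 1) (hg : MemLp g 2 volume) :
    eLpNorm (fun x => mollify ρ g x - g x) 2 volume ^ 2 ≤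
      ∫⁻ y, ENNReal.ofReal (ρ y) * eLpNorm (fun x => g (-y + x) - g x) 2 volume ^ 2 := by
  have hρi : Integrable ρ := hρ.integrable_of_hasCompactSupport hρc
  have hloc : LocallyIntegrable g volume := hg.locallyIntegrable (by norm_num)
  have hint : ∀ x, Integrable fun y => ρ y * g (x - y) := by
    intro x
    have h := (hρc.convolutionExists_left (ContinuousLinearMap.mul ℝ ℝ) hρ hloc) x
    simpa [ConvolutionExistsAt] using h
  have hsub : ∀ x, AEStronglyMeasurable (fun y => g (x - y)) volume := fun x =>
    hg.1.comp_quasiMeasurePreserving (quasiMeasurePreserving_sub_left volume x)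
  have hmeas : AEStronglyMeasurable (fun p : E d × E d => g (p.1 - p.2) - g p.1)
      ((volume : Measure (E d)).prod volume) := by
    refine AEStronglyMeasurable.sub ?_ hg.1.comp_fst
    exact hg.1.comp_quasiMeasurePreserving (quasiMeasurePreserving_sub volume volume)
  have hptw : ∀ x, ‖mollify ρ g x - g x‖ₑ ^ 2 ≤
      ∫⁻ y, ENNReal.ofReal (ρ y) * ‖g (x - y) - g x‖ₑ ^ 2 := by
    intro x
    have h1 : mollify ρ g x - g x = ∫ y, ρ y * (g (x - y) - g x) := by
      simp only [mul_sub]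
      rw [integral_sub (hint x) (hρi.mul_const _), integral_mul_const, hρ1, one_mul, mollify]
    rw [h1]
    exact enorm_integral_mul_sq_le hρ hρ0 hρi hρ1 ((hsub x).sub aestronglyMeasurable_const)
  rw [eLpNorm_two_sq]
  refine (lintegral_mono hptw).trans ?_
  rw [lintegral_lintegral_swap]
  · refine lintegral_mono fun y => ?_
    rw [lintegral_const_mul' _ _ ENNReal.ofReal_ne_top, eLpNorm_two_sq]
    simp only [sub_eq_neg_add]
    exact le_rfl
  · exact ((hρ.measurable.ennreal_ofReal.comp measurable_snd).aemeasurable).mul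
      (hmeas.enorm.pow_const _)

/-- The kernel only sees translations by vectors shorter than `rOut`, for which the L² modulus of
continuity is already small. -/
theorem tendsto_mollify {d : ℕ} (b : ℕ → ContDiffBump (0 : E d))
    (hb : Tendsto (fun n => (b n).rOut) atTop (𝓝 0)) {g : E d → ℝ} (hg : MemLp g 2 volume) :
    Tendsto (fun n => eLpNorm (fun x => mollify ((b n).normed volume) g x - g x) 2 volume)
      atTop (𝓝 0) := by
  rw [ENNReal.tendsto_nhds_zero]
  intro ε hε
  have h1 := tendsto_eLpNorm_translate_sub hg
  rw [ENNReal.tendsto_nhds_zero] at h1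
  obtain ⟨δ, hδ, hball⟩ := Metric.eventually_nhds_iff.1 (h1 ε hε)
  filter_upwards [hb.eventually (gt_mem_nhds hδ)] with n hn
  have h2 := eLpNorm_mollify_sub_sq_le (b n).continuous_normed (b n).nonneg_normed
    (b n).hasCompactSupport_normed (b n).integral_normed hg
  have h3 : ∫⁻ y, ENNReal.ofReal ((b n).normed volume y) *
      eLpNorm (fun x => g (-y + x) - g x) 2 volume ^ 2 ≤
      ∫⁻ y, ENNReal.ofReal ((b n).normed volume y) * ε ^ 2 := by
    refine lintegral_mono fun y => ?_
    by_cases hy : (b n).normed volume y = 0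
    · simp [hy]
    · have : y ∈ Function.support ((b n).normed volume) := hy
      rw [(b n).support_normed_eq, Metric.mem_ball] at this
      gcongr
      apply hball
      simpa using (show ‖y‖ < δ by simpa using this.trans hn)
  rw [lintegral_mul_const _ (b n).continuous_normed.measurable.ennreal_ofReal,
    ← ofReal_integral_eq_lintegral_ofReal
      ((b n).continuous_normed.integrable_of_hasCompactSupport (b n).hasCompactSupport_normed)
      (ae_of_all _ (b n).nonneg_normed), (b n).integral_normed, ENNReal.ofReal_one, one_mul] at h3
  exact (ENNReal.pow_right_strictMono two_ne_zero).le_iff_le.1 (h2.trans h3)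

/-! ### Calculus of test functions and of locally square integrable functions. -/

section

/-- Local square integrability. -/
def L2loc {d : ℕ} (f : E d → ℝ) : Prop :=
  ∀ K : Set (E d), IsCompact K → MemLp f 2 (volume.restrict K)

/-- `D` is the family of weak partial derivatives of `u`. -/
def WeakGrad {d : ℕ} (u : E d → ℝ) (D : Fin d → E d → ℝ) : Prop :=
  ∀ η : E d → ℝ, IsTest η → ∀ i, ∫ x, u x * pderiv i η x = - ∫ x, D i x * η x

variable {d : ℕ}

theorem IsTest.continuous {η : E d → ℝ} (h : IsTest η) : Continuous η := h.1.continuous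

theorem IsTest.differentiable {η : E d → ℝ} (h : IsTest η) : Differentiable ℝ η :=
  h.1.differentiable (by simp)

theorem IsTest.pderiv {η : E d → ℝ} (h : IsTest η) (i : Fin d) : IsTest (pderiv i η) := by
  refine ⟨?_, ?_⟩
  · have : ContDiff ℝ (⊤ : ℕ∞) (fderiv ℝ η) := h.1.fderiv_right (by simp)
    exact this.clm_apply contDiff_const
  · exact (h.2.fderiv_apply (𝕜 := ℝ) (basisVec i))

theorem IsTest.mul {η χ : E d → ℝ} (hη : IsTest η) (hχ : IsTest χ) :
    IsTest fun x => η x * χ x := ⟨hη.1.mul hχ.1, hη.2.mul_right⟩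

theorem IsTest.const_mul {η : E d → ℝ} (hη : IsTest η) (c : ℝ) :
    IsTest fun x => c * η x := ⟨contDiff_const.mul hη.1, hη.2.mul_left⟩

theorem IsTest.add {η χ : E d → ℝ} (hη : IsTest η) (hχ : IsTest χ) :
    IsTest fun x => η x + χ x := ⟨hη.1.add hχ.1, hη.2.add hχ.2⟩

theorem pderiv_mul {η χ : E d → ℝ} (hη : Differentiable ℝ η) (hχ : Differentiable ℝ χ)
    (i : Fin d) (x : E d) :
    pderiv i (fun x => η x * χ x) x = η x * pderiv i χ x + χ x * pderiv i η x := by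
  simp only [pderiv]
  rw [fderiv_fun_mul (hη x) (hχ x)]
  simp

theorem IsTest.integrable {η : E d → ℝ} (h : IsTest η) : Integrable η :=
  h.continuous.integrable_of_hasCompactSupport h.2

theorem IsTest.memLp {η : E d → ℝ} (h : IsTest η) (p : ℝ≥0∞) : MemLp η p volume :=
  h.continuous.memLp_of_hasCompactSupport h.2

theorem IsTest.bounded {η : E d → ℝ} (h : IsTest η) : ∃ C, 0 ≤ C ∧ ∀ x, |η x| ≤ C := by
  obtain ⟨C, hC⟩ := h.2.exists_bound_of_continuous h.continuous
  exact ⟨C, (norm_nonneg _).trans (hC 0), hC⟩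

theorem _root_.MeasureTheory.MemLp.l2loc {f : E d → ℝ} (h : MemLp f 2 volume) : L2loc f :=
  fun _ _ => h.mono_measure Measure.restrict_le_self

theorem aestronglyMeasurable_of_forall_restrict {f : E d → ℝ}
    (h : ∀ K : Set (E d), IsCompact K → AEStronglyMeasurable f (volume.restrict K)) :
    AEStronglyMeasurable f volume := by
  have h1 := aestronglyMeasurable_iUnion_iff (μ := (volume : Measure (E d)))
    (s := fun n : ℕ => Metric.closedBall (0 : E d) n) (f := f)
  rw [Metric.iUnion_closedBall_nat, Measure.restrict_univ] at h1
  exact h1.2 fun n => h _ (isCompact_closedBall _ _)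

theorem L2loc.aestronglyMeasurable {f : E d → ℝ} (h : L2loc f) :
    AEStronglyMeasurable f volume :=
  aestronglyMeasurable_of_forall_restrict fun K hK => (h K hK).1

theorem L2loc.add {f g : E d → ℝ} (hf : L2loc f) (hg : L2loc g) : L2loc fun x => f x + g x :=
  fun K hK => (hf K hK).add (hg K hK)

theorem L2loc.sub {f g : E d → ℝ} (hf : L2loc f) (hg : L2loc g) : L2loc fun x => f x - g x :=
  fun K hK => (hf K hK).sub (hg K hK)

theorem L2loc.const_mul {f : E d → ℝ} (hf : L2loc f) (c : ℝ) : L2loc fun x => c * f x :=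
  fun K hK => (hf K hK).const_mul c

theorem L2loc.sum {ι : Type*} (s : Finset ι) {f : ι → E d → ℝ} (hf : ∀ i, L2loc (f i)) :
    L2loc fun x => ∑ i ∈ s, f i x :=
  fun K hK => memLp_finsetSum s fun i _ => hf i K hK

theorem L2loc.mono {f g : E d → ℝ} (hg : L2loc g) (hf : AEStronglyMeasurable f volume)
    (h : ∀ᵐ x, |f x| ≤ |g x|) : L2loc f := fun K hK =>
  (hg K hK).mono hf.restrict (ae_restrict_of_ae (by simpa only [Real.norm_eq_abs] using h))

theorem _root_.Continuous.l2loc {c : E d → ℝ} (hc : Continuous c) : L2loc c := fun K hK => by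
  have : IsFiniteMeasure (volume.restrict K) := ⟨by
    rw [Measure.restrict_apply_univ]; exact hK.measure_lt_top⟩
  obtain ⟨C, hC⟩ := hK.exists_bound_of_continuousOn hc.continuousOn
  exact MemLp.of_bound hc.aestronglyMeasurable C (ae_restrict_of_forall_mem hK.measurableSet hC)

theorem L2loc.continuous_mul {f c : E d → ℝ} (hf : L2loc f) (hc : Continuous c) :
    L2loc fun x => c x * f x := fun K hK => by
  obtain ⟨C, hC⟩ := hK.exists_bound_of_continuousOn hc.continuousOn
  refine MemLp.of_le_mul (c := C) (hf K hK) (hc.aestronglyMeasurable.mul (hf K hK).1) ?_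
  refine ae_restrict_of_forall_mem hK.measurableSet fun x hx => ?_
  rw [norm_mul]
  gcongr
  exact hC x hx

theorem L2loc.memLp_mul {f c : E d → ℝ} (hf : L2loc f) (hc : Continuous c)
    (hs : HasCompactSupport c) : MemLp (fun x => c x * f x) 2 volume := by
  have h := hf.continuous_mul hc (tsupport c) hs
  have h2 := (memLp_indicator_iff_restrict (μ := volume) (isClosed_tsupport c).measurableSet).2 h
  convert h2 using 1
  ext x
  by_cases hx : x ∈ tsupport c
  · simp [hx]
  · simp [hx, image_eq_zero_of_notMem_tsupport hx]

theorem L2loc.locallyIntegrable_mul {f g : E d → ℝ} (hf : L2loc f) (hg : L2loc g) :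
    LocallyIntegrable (fun x => f x * g x) volume := by
  rw [locallyIntegrable_iff]
  exact fun K hK => (hf K hK).integrable_mul (hg K hK)

theorem L2loc.locallyIntegrable {f : E d → ℝ} (hf : L2loc f) : LocallyIntegrable f volume := by
  simpa using hf.locallyIntegrable_mul (continuous_const (y := (1 : ℝ))).l2loc

theorem _root_.MeasureTheory.LocallyIntegrable.integrable_mul_test {f η : E d → ℝ}
    (hf : LocallyIntegrable f volume) (hη : IsTest η) : Integrable fun x => f x * η x := by
  simpa [mul_comm] using hf.integrable_smul_left_of_hasCompactSupport hη.continuous hη.2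

theorem L2loc.integrable_mul_mul {f g η : E d → ℝ} (hf : L2loc f) (hg : L2loc g)
    (hη : IsTest η) : Integrable fun x => f x * g x * η x :=
  (hf.locallyIntegrable_mul hg).integrable_mul_test hη

/-- Dominated convergence applied to the squares, followed by a square root. -/
theorem tendsto_eLpNorm_zero_of_dominated {μ : Measure (E d)} {F : ℕ → E d → ℝ}
    {G : E d → ℝ} (hG : MemLp G 2 μ)
    (hF : ∀ n, AEStronglyMeasurable (F n) μ) (hb : ∀ n, ∀ᵐ x ∂μ, ‖F n x‖ ≤ ‖G x‖)
    (hlim : ∀ᵐ x ∂μ, Tendsto (fun n => F n x) atTop (𝓝 0)) :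
    Tendsto (fun n => eLpNorm (F n) 2 μ) atTop (𝓝 0) := by
  have h1 : Tendsto (fun n => ∫⁻ x, ‖F n x‖ₑ ^ 2 ∂μ) atTop (𝓝 (∫⁻ _, 0 ∂μ)) := by
    refine tendsto_lintegral_of_dominated_convergence' (fun x => ‖G x‖ₑ ^ 2)
      (fun n => (hF n).enorm.pow_const _) (fun n => ?_) ?_ ?_
    · filter_upwards [hb n] with x hx
      have := enorm_le_iff_norm_le.2 hx
      gcongr
    · rw [← eLpNorm_two_sq]
      exact (ENNReal.pow_lt_top hG.2).ne
    · filter_upwards [hlim] with x hx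
      have h2 : Tendsto (fun n => ‖F n x‖ₑ) atTop (𝓝 0) := by simpa using hx.enorm
      simpa using ENNReal.Tendsto.pow (n := 2) h2
  simp only [lintegral_zero, ← eLpNorm_two_sq] at h1
  have h2 := h1.ennrpow_const (((2 : ℕ) : ℝ)⁻¹)
  simp only [ENNReal.pow_rpow_inv_natCast two_ne_zero] at h2
  rwa [ENNReal.zero_rpow_of_pos (by norm_num)] at h2

/-- By Hölder's inequality, strong L² convergence of one factor gives L¹ convergence of the product.
-/
theorem tendsto_integral_mul {μ : Measure (E d)} {F : ℕ → E d → ℝ} {f g : E d → ℝ}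
    (hF : ∀ n, MemLp (F n) 2 μ) (hf : MemLp f 2 μ) (hg : MemLp g 2 μ)
    (h : Tendsto (fun n => eLpNorm (fun x => F n x - f x) 2 μ) atTop (𝓝 0)) :
    Tendsto (fun n => ∫ x, F n x * g x ∂μ) atTop (𝓝 (∫ x, f x * g x ∂μ)) := by
  refine tendsto_integral_of_L1 _ (hf.integrable_mul hg).aestronglyMeasurable
    (Eventually.of_forall fun n => (hF n).integrable_mul hg) ?_
  have h1 : Tendsto (fun n => eLpNorm (fun x => F n x - f x) 2 μ * eLpNorm g 2 μ) atTop (𝓝 0) := by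
    simpa using ENNReal.Tendsto.mul_const h (Or.inr hg.2.ne)
  refine tendsto_of_tendsto_of_tendsto_of_le_of_le tendsto_const_nhds h1 (fun _ => zero_le) ?_
  intro n
  have h2 := eLpNorm_smul_le_mul_eLpNorm (p := 2) (q := 2) (r := 1) hg.1
    ((hF n).sub hf).1 (μ := μ)
  rw [eLpNorm_one_eq_lintegral_enorm] at h2
  refine le_trans (le_of_eq ?_) h2
  refine lintegral_congr fun x => ?_
  congr 1
  simp [sub_mul]

end

/-! ### Cut-offs and density of test functions in H¹. -/

section

variable {d : ℕ}

theorem pderiv_comp_smul {η : E d → ℝ} (hη : Differentiable ℝ η) (c : ℝ) (i : Fin d) (x : E d) :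
    pderiv i (fun y => η (c • y)) x = c * pderiv i η (c • x) := by
  simp only [pderiv]
  have h1 : HasFDerivAt (fun y : E d => c • y) (c • ContinuousLinearMap.id ℝ (E d)) x :=
    (hasFDerivAt_id x).const_smul c
  have h2 := (hη (c • x)).hasFDerivAt.comp x h1
  rw [show (fun y => η (c • y)) = η ∘ fun y => c • y from rfl, h2.fderiv]
  simp

theorem IsTest.comp_smul {η : E d → ℝ} (hη : IsTest η) {c : ℝ} (hc : c ≠ 0) :
    IsTest fun x => η (c • x) :=
  ⟨hη.1.comp (contDiff_const_smul c), hη.2.comp_smul hc⟩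

theorem pderiv_comp_sub {η : E d → ℝ} (hη : Differentiable ℝ η) (i : Fin d) (x y : E d) :
    pderiv i (fun z => η (x - z)) y = - pderiv i η (x - y) := by
  simp only [pderiv]
  have h1 : HasFDerivAt (fun z : E d => x - z) (-ContinuousLinearMap.id ℝ (E d)) y :=
    (hasFDerivAt_id y).const_sub x
  have h2 := (hη (x - y)).hasFDerivAt.comp y h1
  rw [show (fun z => η (x - z)) = η ∘ fun z => x - z from rfl, h2.fderiv]
  simp

theorem IsTest.comp_sub {η : E d → ℝ} (hη : IsTest η) (x : E d) :
    IsTest fun z => η (x - z) :=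
  ⟨hη.1.comp (contDiff_const.sub contDiff_id),
    hη.2.comp_homeomorph (Homeomorph.subLeft x)⟩

theorem isTest_normed (b : ContDiffBump (0 : E d)) : IsTest (b.normed volume) :=
  ⟨b.contDiff_normed, b.hasCompactSupport_normed⟩

theorem mollify_eq_convolution (ρ g : E d → ℝ) :
    mollify ρ g = convolution ρ g (ContinuousLinearMap.mul ℝ ℝ) volume := rfl

theorem mollify_eq_swap (ρ g : E d → ℝ) (x : E d) :
    mollify ρ g x = ∫ y, ρ (x - y) * g y := by
  rw [mollify_eq_convolution, convolution_eq_swap]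
  rfl

theorem isTest_mollify {ρ g : E d → ℝ} (hρ : IsTest ρ) (hg : LocallyIntegrable g volume)
    (hc : HasCompactSupport g) : IsTest (mollify ρ g) := by
  rw [mollify_eq_convolution]
  exact ⟨hρ.2.contDiff_convolution_left _ hρ.1 hg, hρ.2.convolution _ hc⟩

theorem hasFDerivAt_mollify {ρ u : E d → ℝ} (hρ : IsTest ρ) (hu : LocallyIntegrable u volume)
    (x : E d) : HasFDerivAt (mollify ρ u)
      (convolution (fderiv ℝ ρ) u ((ContinuousLinearMap.mul ℝ ℝ).precompL (E d)) volume x) x := by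
  rw [mollify_eq_convolution]
  exact hρ.2.hasFDerivAt_convolution_left (ContinuousLinearMap.mul ℝ ℝ) (hρ.1.of_le (by simp)) hu x

theorem pderiv_mollify_eq {ρ u : E d → ℝ} (hρ : IsTest ρ) (hu : LocallyIntegrable u volume)
    (i : Fin d) (x : E d) : pderiv i (mollify ρ u) x = mollify (pderiv i ρ) u x := by
  have hcont : Continuous (fderiv ℝ ρ) := hρ.1.continuous_fderiv (by simp)
  have hint := (hρ.2.fderiv (𝕜 := ℝ)).convolutionExists_left
    ((ContinuousLinearMap.mul ℝ ℝ).precompL (E d)) hcont hu x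
  rw [pderiv, (hasFDerivAt_mollify hρ hu x).fderiv, convolution_def,
    ContinuousLinearMap.integral_apply hint]
  rfl

/-- For fixed x the reflected kernel y ↦ ρ(x - y) is itself a test function, and the sign from the
reflection cancels the one in the definition of the weak derivative. -/
theorem pderiv_mollify {ρ u : E d → ℝ} {D : Fin d → E d → ℝ} (hρ : IsTest ρ)
    (hu : LocallyIntegrable u volume) (hw : WeakGrad u D) (i : Fin d) (x : E d) :
    pderiv i (mollify ρ u) x = mollify ρ (D i) x := by
  rw [pderiv_mollify_eq hρ hu, mollify_eq_swap, mollify_eq_swap]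
  have h5 := hw _ (hρ.comp_sub x) i
  simp only [pderiv_comp_sub hρ.differentiable, mul_neg, integral_neg, neg_inj] at h5
  simpa only [mul_comm] using h5

/-- The product χη is again a test function, so the weak identity for u can be used with it. -/
theorem WeakGrad.smooth_mul {u χ : E d → ℝ} {D : Fin d → E d → ℝ} (hw : WeakGrad u D)
    (hu : LocallyIntegrable u volume) (hD : ∀ i, LocallyIntegrable (D i) volume)
    (hχ : ContDiff ℝ (⊤ : ℕ∞) χ) :
    WeakGrad (fun x => χ x * u x) (fun i x => χ x * D i x + pderiv i χ x * u x) := by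
  intro η hη i
  have hχd : Differentiable ℝ χ := hχ.differentiable (by simp)
  have ht : IsTest fun x => χ x * η x := ⟨hχ.mul hη.1, hη.2.mul_left⟩
  have ht' : IsTest fun x => χ x * pderiv i η x := ⟨hχ.mul (hη.pderiv i).1, (hη.pderiv i).2.mul_left⟩
  have hχi : ContDiff ℝ (⊤ : ℕ∞) (pderiv i χ) :=
    (show ContDiff ℝ (⊤ : ℕ∞) (fderiv ℝ χ) from hχ.fderiv_right (by simp)).clm_apply contDiff_const
  have ht'' : IsTest fun x => pderiv i χ x * η x := ⟨hχi.mul hη.1, hη.2.mul_left⟩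
  have h1 := hw _ ht i
  simp only [pderiv_mul hχd hη.differentiable] at h1
  have i1 := hu.integrable_mul_test ht'
  have i2 := hu.integrable_mul_test ht''
  have i3 := (hD i).integrable_mul_test ht
  have e1 : ∫ x, u x * (χ x * pderiv i η x + η x * pderiv i χ x) =
      (∫ x, χ x * u x * pderiv i η x) + ∫ x, pderiv i χ x * u x * η x := by
    rw [← integral_add]
    · congr 1; ext x; ring
    · exact i1.congr (ae_of_all _ fun x => by ring)
    · exact i2.congr (ae_of_all _ fun x => by ring)
  have e2 : ∫ x, (χ x * D i x + pderiv i χ x * u x) * η x =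
      (∫ x, D i x * (χ x * η x)) + ∫ x, pderiv i χ x * u x * η x := by
    rw [← integral_add i3]
    · congr 1; ext x; ring
    · exact i2.congr (ae_of_all _ fun x => by ring)
  rw [e1] at h1
  rw [e2]
  linarith

/-- A smooth cut-off function, equal to one on the ball of radius `R`. -/
def cutoff (R : ℝ) (x : E d) : ℝ :=
  (⟨1, 2, one_pos, one_lt_two⟩ : ContDiffBump (0 : E d)) (R⁻¹ • x)

theorem isTest_bump (b : ContDiffBump (0 : E d)) : IsTest b := ⟨b.contDiff, b.hasCompactSupport⟩

theorem isTest_cutoff {R : ℝ} (hR : 0 < R) : IsTest (cutoff (d := d) R) :=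
  (isTest_bump _).comp_smul (inv_ne_zero hR.ne')

theorem cutoff_nonneg (R : ℝ) (x : E d) : 0 ≤ cutoff R x := ContDiffBump.nonneg _

theorem cutoff_le_one (R : ℝ) (x : E d) : cutoff R x ≤ 1 := ContDiffBump.le_one _

theorem cutoff_eq_one {R : ℝ} (hR : 0 < R) {x : E d} (hx : ‖x‖ ≤ R) : cutoff R x = 1 := by
  apply ContDiffBump.one_of_mem_closedBall
  simp only [mem_closedBall_zero_iff, norm_smul, norm_inv, Real.norm_eq_abs, abs_of_pos hR]
  rw [inv_mul_le_iff₀ hR]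
  simpa using hx

/-- All cut-offs are rescalings of one fixed bump, hence the single constant and the decay 1/R. -/
theorem exists_pderiv_cutoff_le (d : ℕ) :
    ∃ C : ℝ, 0 ≤ C ∧ ∀ (R : ℝ), 0 < R → ∀ (i : Fin d) (x : E d), |pderiv i (cutoff R) x| ≤ C / R := by
  have h := fun i => ((isTest_bump (⟨1, 2, one_pos, one_lt_two⟩ : ContDiffBump (0 : E d))).pderiv
    i).bounded
  choose C hC0 hC using h
  refine ⟨∑ i, C i, Finset.sum_nonneg fun i _ => hC0 i, fun R hR i x => ?_⟩
  have : pderiv i (cutoff R) x = R⁻¹ * pderiv i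
      (⟨1, 2, one_pos, one_lt_two⟩ : ContDiffBump (0 : E d)) (R⁻¹ • x) :=
    pderiv_comp_smul (isTest_bump _).differentiable _ _ _
  rw [this, abs_mul, abs_of_pos (inv_pos.2 hR), div_eq_inv_mul]
  gcongr
  exact (hC i _).trans (Finset.single_le_sum (fun i _ => hC0 i) (Finset.mem_univ i))

theorem exists_test_approx_of_hasCompactSupport {u : E d → ℝ} {D : Fin d → E d → ℝ}
    (hc : HasCompactSupport u) (hu : MemLp u 2 volume) (hD : ∀ i, MemLp (D i) 2 volume)
    (hw : WeakGrad u D) {ε : ℝ≥0∞} (hε : 0 < ε) :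
    ∃ η : E d → ℝ, IsTest η ∧ eLpNorm (fun x => η x - u x) 2 volume ≤ ε ∧
      ∀ i, eLpNorm (fun x => pderiv i η x - D i x) 2 volume ≤ ε := by
  have hpos : ∀ n : ℕ, (0 : ℝ) < 1 / ((n : ℝ) + 1) := fun n => by positivity
  let b : ℕ → ContDiffBump (0 : E d) := fun n =>
    ⟨1 / ((n : ℝ) + 1) / 2, 1 / ((n : ℝ) + 1), half_pos (hpos n), half_lt_self (hpos n)⟩
  have hb : Tendsto (fun n => (b n).rOut) atTop (𝓝 0) := tendsto_one_div_add_atTop_nhds_zero_nat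
  have hloc := hu.locallyIntegrable (by norm_num)
  have h1 := ENNReal.tendsto_nhds_zero.1 (tendsto_mollify b hb hu) ε hε
  have h2 : ∀ᶠ n in atTop, ∀ i,
      eLpNorm (fun x => mollify ((b n).normed volume) (D i) x - D i x) 2 volume ≤ ε :=
    eventually_all.2 fun i => ENNReal.tendsto_nhds_zero.1 (tendsto_mollify b hb (hD i)) ε hε
  obtain ⟨n, hn1, hn2⟩ := (h1.and h2).exists
  refine ⟨mollify ((b n).normed volume) u, isTest_mollify (isTest_normed _) hloc hc, hn1, ?_⟩
  intro i
  simp only [pderiv_mollify (isTest_normed (b n)) hloc hw]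
  exact hn2 i

theorem tendsto_cutoff_mul {f : E d → ℝ} (hf : MemLp f 2 volume) :
    Tendsto (fun n : ℕ => eLpNorm (fun x => cutoff ((n : ℝ) + 1) x * f x - f x) 2 volume)
      atTop (𝓝 0) := by
  refine tendsto_eLpNorm_zero_of_dominated hf (fun n => ?_) (fun n => ae_of_all _ fun x => ?_)
    (ae_of_all _ fun x => ?_)
  · exact ((isTest_cutoff (by positivity)).continuous.aestronglyMeasurable.mul hf.1).sub hf.1
  · rw [show cutoff ((n : ℝ) + 1) x * f x - f x = (cutoff ((n : ℝ) + 1) x - 1) * f x by ring,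
      norm_mul]
    refine mul_le_of_le_one_left (norm_nonneg _) ?_
    rw [Real.norm_eq_abs, abs_le]
    constructor <;> linarith [cutoff_nonneg ((n : ℝ) + 1) x, cutoff_le_one ((n : ℝ) + 1) x]
  · obtain ⟨N, hN⟩ := exists_nat_ge ‖x‖
    refine tendsto_const_nhds.congr' ?_
    filter_upwards [eventually_ge_atTop N] with n hn
    have : (N : ℝ) ≤ n := by exact_mod_cast hn
    rw [cutoff_eq_one (by positivity) (by linarith)]
    ring

theorem tendsto_pderiv_cutoff_mul {f : E d → ℝ} (hf : MemLp f 2 volume) (i : Fin d) :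
    Tendsto (fun n : ℕ => eLpNorm (fun x => pderiv i (cutoff ((n : ℝ) + 1)) x * f x) 2 volume)
      atTop (𝓝 0) := by
  obtain ⟨C, hC0, hC⟩ := exists_pderiv_cutoff_le d
  refine tendsto_eLpNorm_zero_of_dominated (hf.const_mul C) (fun n => ?_)
    (fun n => ae_of_all _ fun x => ?_) (ae_of_all _ fun x => ?_)
  · exact (((isTest_cutoff (by positivity)).pderiv i).continuous.aestronglyMeasurable.mul hf.1)
  · have hn : (0 : ℝ) < n + 1 := by positivity
    rw [norm_mul, norm_mul]
    gcongr
    rw [Real.norm_eq_abs, Real.norm_of_nonneg hC0]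
    refine (hC _ hn i x).trans (div_le_self hC0 (by linarith [n.cast_nonneg (α := ℝ)]))
  · have h1 : Tendsto (fun n : ℕ => pderiv i (cutoff ((n : ℝ) + 1)) x) atTop (𝓝 0) := by
      have h2 : Tendsto (fun n : ℕ => C * (1 / ((n : ℝ) + 1))) atTop (𝓝 0) := by
        simpa using tendsto_one_div_add_atTop_nhds_zero_nat.const_mul C
      refine squeeze_zero_norm (fun n => ?_) h2
      rw [mul_one_div]
      exact hC _ (by positivity) i x
    simpa using h1.mul_const (f x)

/-- Truncation by a wide cut-off costs half of the error and mollification of the truncated function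
the other half. The extra gradient term u∇χ vanishes because |∇χ| is of order 1/R while u is in L².
-/
theorem exists_test_approx {u : E d → ℝ} {D : Fin d → E d → ℝ}
    (hu : MemLp u 2 volume) (hD : ∀ i, MemLp (D i) 2 volume)
    (hw : WeakGrad u D) {ε : ℝ≥0∞} (hε : 0 < ε) :
    ∃ η : E d → ℝ, IsTest η ∧ eLpNorm (fun x => η x - u x) 2 volume ≤ ε ∧
      ∀ i, eLpNorm (fun x => pderiv i η x - D i x) 2 volume ≤ ε := by
  have hε2 : 0 < ε / 2 := ENNReal.half_pos hε.ne'
  have h1 := ENNReal.tendsto_nhds_zero.1 (tendsto_cutoff_mul hu) _ hε2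
  have h2 : ∀ i, Tendsto (fun n : ℕ => eLpNorm (fun x => cutoff ((n : ℝ) + 1) x * D i x +
      pderiv i (cutoff ((n : ℝ) + 1)) x * u x - D i x) 2 volume) atTop (𝓝 0) := by
    intro i
    have h3 := (tendsto_cutoff_mul (hD i)).add (tendsto_pderiv_cutoff_mul hu i)
    rw [add_zero] at h3
    refine tendsto_of_tendsto_of_tendsto_of_le_of_le tendsto_const_nhds h3 (fun _ => zero_le) ?_
    intro n
    have ht := isTest_cutoff (d := d) (R := (n : ℝ) + 1) (by positivity)
    have m1 : AEStronglyMeasurable (fun x => cutoff ((n : ℝ) + 1) x * D i x - D i x) volume :=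
      (ht.continuous.aestronglyMeasurable.mul (hD i).1).sub (hD i).1
    have m2 : AEStronglyMeasurable (fun x => pderiv i (cutoff ((n : ℝ) + 1)) x * u x) volume :=
      (ht.pderiv i).continuous.aestronglyMeasurable.mul hu.1
    have h5 := eLpNorm_add_le m1 m2 (p := 2) (by norm_num)
    have h6 : (fun x => cutoff ((n : ℝ) + 1) x * D i x +
        pderiv i (cutoff ((n : ℝ) + 1)) x * u x - D i x) =
        (fun x => cutoff ((n : ℝ) + 1) x * D i x - D i x) +
          fun x => pderiv i (cutoff ((n : ℝ) + 1)) x * u x := by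
      ext x
      simp only [Pi.add_apply]
      ring
    simp only [h6]
    exact h5
  have h4 := eventually_all.2 fun i => ENNReal.tendsto_nhds_zero.1 (h2 i) _ hε2
  obtain ⟨n, hn1, hn2⟩ := (h1.and h4).exists
  have hR : (0 : ℝ) < n + 1 := by positivity
  have ht := isTest_cutoff (d := d) hR
  have hum : MemLp (fun x => cutoff ((n : ℝ) + 1) x * u x) 2 volume :=
    hu.l2loc.memLp_mul ht.continuous ht.2
  have hDm : ∀ i, MemLp (fun x => cutoff ((n : ℝ) + 1) x * D i x +
      pderiv i (cutoff ((n : ℝ) + 1)) x * u x) 2 volume := fun i =>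
    ((hD i).l2loc.memLp_mul ht.continuous ht.2).add
      (hu.l2loc.memLp_mul (ht.pderiv i).continuous (ht.pderiv i).2)
  obtain ⟨η, hη, e1, e2⟩ := exists_test_approx_of_hasCompactSupport (ht.2.mul_right) hum hDm
    (hw.smooth_mul (hu.locallyIntegrable (by norm_num))
      (fun i => (hD i).locallyIntegrable (by norm_num)) ht.1) hε2
  have key : ∀ {f g h : E d → ℝ}, MemLp f 2 volume → MemLp g 2 volume → MemLp h 2 volume →
      eLpNorm (fun x => f x - g x) 2 volume ≤ ε / 2 → eLpNorm (fun x => g x - h x) 2 volume ≤ ε / 2 →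
      eLpNorm (fun x => f x - h x) 2 volume ≤ ε := by
    intro f g h hf hg hh a b
    calc eLpNorm (fun x => f x - h x) 2 volume
        = eLpNorm ((fun x => f x - g x) + fun x => g x - h x) 2 volume := by
          congr 1; ext x; simp
      _ ≤ _ := eLpNorm_add_le (hf.sub hg).1 (hg.sub hh).1 (by norm_num)
      _ ≤ ε / 2 + ε / 2 := add_le_add a b
      _ = ε := ENNReal.add_halves ε
  exact ⟨η, hη, key (hη.memLp 2) hum hu e1 hn1,
    fun i => key ((hη.pderiv i).memLp 2) (hDm i) (hD i) (e2 i) (hn2 i)⟩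

theorem exists_test_seq {u : E d → ℝ} {D : Fin d → E d → ℝ}
    (hu : MemLp u 2 volume) (hD : ∀ i, MemLp (D i) 2 volume) (hw : WeakGrad u D) :
    ∃ η : ℕ → E d → ℝ, (∀ n, IsTest (η n)) ∧
      Tendsto (fun n => eLpNorm (fun x => η n x - u x) 2 volume) atTop (𝓝 0) ∧
      ∀ i, Tendsto (fun n => eLpNorm (fun x => pderiv i (η n) x - D i x) 2 volume)
        atTop (𝓝 0) := by
  -- For n = 0 the tolerance is 0⁻¹ = ∞, so the first approximant is unconstrained and no shift of
  -- the index is needed.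
  have hpos : ∀ n : ℕ, (0 : ℝ≥0∞) < (n : ℝ≥0∞)⁻¹ := fun n => by simp
  choose η hη h1 h2 using fun n : ℕ => exists_test_approx hu hD hw (hpos n)
  have h0 := ENNReal.tendsto_inv_nat_nhds_zero
  exact ⟨η, hη, tendsto_of_tendsto_of_tendsto_of_le_of_le tendsto_const_nhds h0
    (fun _ => zero_le) h1, fun i => tendsto_of_tendsto_of_tendsto_of_le_of_le tendsto_const_nhds h0
    (fun _ => zero_le) fun n => h2 n i⟩

end

/-! ### Product and chain rules in H¹_loc. -/

section

variable {d : ℕ}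

/-- `u ∈ H¹_loc` with weak partial derivatives `D`. -/
structure H1L (u : E d → ℝ) (D : Fin d → E d → ℝ) : Prop where
  l2 : L2loc u
  grad : ∀ i, L2loc (D i)
  weak : WeakGrad u D

theorem weakGrad_of_differentiable {u : E d → ℝ} (hu : Differentiable ℝ u)
    (hc : Continuous u) (hc' : ∀ i, Continuous (pderiv i u)) :
    WeakGrad u (fun i => pderiv i u) := by
  intro η hη i
  refine integral_mul_fderiv_eq_neg_fderiv_mul_of_integrable ?_ ?_ ?_
    (fun x _ => hu x) (fun x _ => hη.differentiable x)
  · exact ((hc' i).mul hη.continuous).integrable_of_hasCompactSupport hη.2.mul_left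
  · exact (hc.mul (hη.pderiv i).continuous).integrable_of_hasCompactSupport (hη.pderiv i).2.mul_left
  · exact (hc.mul hη.continuous).integrable_of_hasCompactSupport hη.2.mul_left

theorem H1L.add {u v : E d → ℝ} {D D' : Fin d → E d → ℝ} (hu : H1L u D) (hv : H1L v D') :
    H1L (fun x => u x + v x) (fun i x => D i x + D' i x) := by
  refine ⟨hu.l2.add hv.l2, fun i => (hu.grad i).add (hv.grad i), fun η hη i => ?_⟩
  simp only [add_mul]
  rw [integral_add (hu.l2.locallyIntegrable.integrable_mul_test (hη.pderiv i))
    (hv.l2.locallyIntegrable.integrable_mul_test (hη.pderiv i)),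
    integral_add ((hu.grad i).locallyIntegrable.integrable_mul_test hη)
    ((hv.grad i).locallyIntegrable.integrable_mul_test hη), hu.weak η hη i, hv.weak η hη i]
  ring

theorem H1L.const_mul {u : E d → ℝ} {D : Fin d → E d → ℝ} (hu : H1L u D) (c : ℝ) :
    H1L (fun x => c * u x) (fun i x => c * D i x) := by
  refine ⟨hu.l2.const_mul c, fun i => (hu.grad i).const_mul c, fun η hη i => ?_⟩
  simp only [mul_assoc, integral_const_mul, hu.weak η hη i]
  ring

theorem exists_tsupport_subset_ball {η : E d → ℝ} (hη : IsTest η) :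
    ∃ R : ℝ, 0 < R ∧ tsupport η ⊆ Metric.ball 0 R := by
  obtain ⟨R, hR⟩ := hη.2.isBounded.subset_ball 0
  exact ⟨max R 1, by positivity, hR.trans (Metric.ball_subset_ball (le_max_left _ _))⟩

theorem pderiv_eq_zero_of_notMem {η : E d → ℝ} {x : E d} (hx : x ∉ tsupport η) (i : Fin d) :
    pderiv i η x = 0 := by
  have : x ∉ tsupport (fderiv ℝ η) := fun h => hx (tsupport_fderiv_subset ℝ h)
  simp [pderiv, image_eq_zero_of_notMem_tsupport this]

theorem pderiv_cutoff_eq_zero {R : ℝ} (hR : 0 < R) {x : E d} (hx : x ∈ Metric.ball 0 R)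
    (i : Fin d) : pderiv i (cutoff R) x = 0 := by
  have : cutoff R =ᶠ[𝓝 x] fun _ : E d => (1 : ℝ) := by
    filter_upwards [Metric.isOpen_ball.mem_nhds hx] with y hy
    exact cutoff_eq_one hR (by simpa using (mem_ball_zero_iff.1 hy).le)
  simp [pderiv, this.fderiv_eq]

/-- The cut-off product χu lies in H¹ and agrees with u, gradient included, on the ball where χ = 1.
Global density then restricts to that ball. -/
theorem H1L.exists_test_seq {u : E d → ℝ} {D : Fin d → E d → ℝ} (hu : H1L u D) {R : ℝ}
    (hR : 0 < R) : ∃ η : ℕ → E d → ℝ, (∀ n, IsTest (η n)) ∧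
      Tendsto (fun n => eLpNorm (fun x => η n x - u x) 2 (volume.restrict (Metric.ball 0 R)))
        atTop (𝓝 0) ∧
      ∀ i, Tendsto (fun n => eLpNorm (fun x => pderiv i (η n) x - D i x) 2
        (volume.restrict (Metric.ball 0 R))) atTop (𝓝 0) := by
  have ht := isTest_cutoff (d := d) hR
  obtain ⟨η, hη, h1, h2⟩ := TwoScale.exists_test_seq (hu.l2.memLp_mul ht.continuous ht.2)
    (fun i => ((hu.grad i).memLp_mul ht.continuous ht.2).add
      (hu.l2.memLp_mul (ht.pderiv i).continuous (ht.pderiv i).2))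
    (hu.weak.smooth_mul hu.l2.locallyIntegrable (fun i => (hu.grad i).locallyIntegrable) ht.1)
  refine ⟨η, hη, ?_, fun i => ?_⟩
  · refine tendsto_of_tendsto_of_tendsto_of_le_of_le tendsto_const_nhds h1 (fun _ => zero_le) ?_
    intro n
    refine le_trans (le_of_eq ?_) (eLpNorm_mono_measure _
      (Measure.restrict_le_self (s := Metric.ball 0 R)))
    refine eLpNorm_congr_ae (ae_restrict_of_forall_mem measurableSet_ball fun x hx => ?_)
    simp only [cutoff_eq_one hR (mem_ball_zero_iff.1 hx).le, one_mul]
  · refine tendsto_of_tendsto_of_tendsto_of_le_of_le tendsto_const_nhds (h2 i) (fun _ => zero_le) ?_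
    intro n
    refine le_trans (le_of_eq ?_) (eLpNorm_mono_measure _
      (Measure.restrict_le_self (s := Metric.ball 0 R)))
    refine eLpNorm_congr_ae (ae_restrict_of_forall_mem measurableSet_ball fun x hx => ?_)
    simp [cutoff_eq_one hR (mem_ball_zero_iff.1 hx).le, pderiv_cutoff_eq_zero hR hx]

theorem L2loc.memLp_ball {f : E d → ℝ} (hf : L2loc f) (R : ℝ) :
    MemLp f 2 (volume.restrict (Metric.ball 0 R)) :=
  (hf _ (isCompact_closedBall 0 R)).mono_measure
    (Measure.restrict_mono Metric.ball_subset_closedBall le_rfl)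

theorem setIntegral_ball_mul_eq {R : ℝ} {η : E d → ℝ} (hs : tsupport η ⊆ Metric.ball 0 R)
    (f : E d → ℝ) : ∫ x in Metric.ball 0 R, f x * η x = ∫ x, f x * η x := by
  refine setIntegral_eq_integral_of_forall_compl_eq_zero fun x hx => ?_
  rw [image_eq_zero_of_notMem_tsupport fun h => hx (hs h), mul_zero]

theorem tendsto_integral_mul_test {R : ℝ} {η : E d → ℝ} (hη : IsTest η)
    (hs : tsupport η ⊆ Metric.ball 0 R) {F : ℕ → E d → ℝ} {f g : E d → ℝ}
    (hF : ∀ n, L2loc (F n)) (hf : L2loc f) (hg : L2loc g)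
    (h : Tendsto (fun n => eLpNorm (fun x => F n x - f x) 2 (volume.restrict (Metric.ball 0 R)))
      atTop (𝓝 0)) :
    Tendsto (fun n => ∫ x, F n x * g x * η x) atTop (𝓝 (∫ x, f x * g x * η x)) := by
  have h1 := tendsto_integral_mul (fun n => (hF n).memLp_ball R) (hf.memLp_ball R)
    ((hg.continuous_mul hη.continuous).memLp_ball R) h
  have e : ∀ k : E d → ℝ, ∫ x in Metric.ball 0 R, k x * (η x * g x) = ∫ x, k x * g x * η x := by
    intro k
    rw [← setIntegral_ball_mul_eq hs fun x => k x * g x]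
    congr 1; ext x; ring
  simpa only [e] using h1

theorem tsupport_pderiv_subset (η : E d → ℝ) (i : Fin d) :
    tsupport (pderiv i η) ⊆ tsupport η :=
  (tsupport_fderiv_apply_subset ℝ (basisVec i)).trans le_rfl

theorem integrable_test_extension {h : E d → ℝ} {F : Fin d → E d → ℝ} (hh : L2loc h)
    (hF : ∀ j, L2loc (F j)) {χ v : E d → ℝ} {D : Fin d → E d → ℝ} (hχ : IsTest χ) (hv : L2loc v)
    (hD : ∀ j, L2loc (D j)) :
    Integrable fun x =>
      h x * (χ x * v x) + ∑ j, F j x * (χ x * D j x + v x * pderiv j χ x) := by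
  have i1 := hv.integrable_mul_mul hh hχ
  have i4 : ∀ j, Integrable fun x => D j x * F j x * χ x + v x * F j x * pderiv j χ x :=
    fun j => ((hD j).integrable_mul_mul (hF j) hχ).add (hv.integrable_mul_mul (hF j) (hχ.pderiv j))
  refine (i1.add (integrable_finsetSum Finset.univ fun j _ => i4 j)).congr (ae_of_all _ fun x => ?_)
  simp only [Pi.add_apply]
  congr 1
  · ring
  · exact Finset.sum_congr rfl fun j _ => by ring

/-- A weak identity extends from smooth test functions to products `χ v` of a test function and
a function in `H¹_loc`. -/
theorem test_extension {h : E d → ℝ} {F : Fin d → E d → ℝ} (hh : L2loc h) (hF : ∀ j, L2loc (F j))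
    (H : ∀ η, IsTest η → ∫ x, h x * η x + ∑ j, F j x * pderiv j η x = 0)
    {χ v : E d → ℝ} {D : Fin d → E d → ℝ} (hχ : IsTest χ) (hv : H1L v D) :
    ∫ x, h x * (χ x * v x) + ∑ j, F j x * (χ x * D j x + v x * pderiv j χ x) = 0 := by
  -- Approximating v on a ball that contains the support of χ is enough, since χ confines every
  -- integral to it. For a smooth approximant η n the product χ η n is a test function, so the
  -- approximating integrals are all zero.
  obtain ⟨R, hR, hs⟩ := exists_tsupport_subset_ball hχ
  obtain ⟨η, hη, h1, h2⟩ := hv.exists_test_seq hR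
  have hsj := fun j => (tsupport_pderiv_subset χ j).trans hs
  have split : ∀ (w : E d → ℝ) (W : Fin d → E d → ℝ), L2loc w → (∀ j, L2loc (W j)) →
      ∫ x, h x * (χ x * w x) + ∑ j, F j x * (χ x * W j x + w x * pderiv j χ x) =
      (∫ x, w x * h x * χ x) + ∑ j, ((∫ x, W j x * F j x * χ x) +
        ∫ x, w x * F j x * pderiv j χ x) := by
    intro w W hw hW
    have i1 := hw.integrable_mul_mul hh hχ
    have i2 := fun j => (hW j).integrable_mul_mul (hF j) hχ
    have i3 := fun j => hw.integrable_mul_mul (hF j) (hχ.pderiv j)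
    have i4 : ∀ j, Integrable fun x => W j x * F j x * χ x + w x * F j x * pderiv j χ x :=
      fun j => (i2 j).add (i3 j)
    simp only [← integral_add (i2 _) (i3 _)]
    rw [← integral_finsetSum _ fun j _ => i4 j, ← integral_add i1
      (integrable_finsetSum _ fun j _ => i4 j)]
    refine integral_congr_ae (ae_of_all _ fun x => ?_)
    dsimp only
    congr 1
    · ring
    · exact Finset.sum_congr rfl fun j _ => by ring
  have l2η := fun n => (hη n).continuous.l2loc
  have l2η' := fun n j => ((hη n).pderiv j).continuous.l2loc
  have lim : Tendsto (fun n => (∫ x, η n x * h x * χ x) +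
      ∑ j, ((∫ x, pderiv j (η n) x * F j x * χ x) + ∫ x, η n x * F j x * pderiv j χ x)) atTop
      (𝓝 ((∫ x, v x * h x * χ x) + ∑ j, ((∫ x, D j x * F j x * χ x) +
        ∫ x, v x * F j x * pderiv j χ x))) := by
    refine (tendsto_integral_mul_test hχ hs l2η hv.l2 hh h1).add ?_
    refine tendsto_finsetSum _ fun j _ => ?_
    exact (tendsto_integral_mul_test hχ hs (fun n => l2η' n j) (hv.grad j) (hF j) (h2 j)).add
      (tendsto_integral_mul_test (hχ.pderiv j) (hsj j) l2η hv.l2 (hF j) h1)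
  rw [split v D hv.l2 hv.grad]
  refine tendsto_nhds_unique lim (tendsto_const_nhds.congr fun n => ?_)
  rw [← split _ _ (l2η n) (l2η' n), ← H _ (hχ.mul (hη n))]
  simp only [pderiv_mul hχ.differentiable (hη n).differentiable]

/-- No truncation is needed: all products are locally integrable, and the weak formula for v may be
tested with η times the H¹_loc function u. -/
theorem H1L.weakGrad_mul {u v : E d → ℝ} {D D' : Fin d → E d → ℝ} (hu : H1L u D) (hv : H1L v D') :
    WeakGrad (fun x => u x * v x) (fun i x => u x * D' i x + v x * D i x) := by
  intro η hη i
  have h0 : L2loc fun _ : E d => (0 : ℝ) := continuous_const.l2loc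
  have hF : ∀ j, L2loc (fun x => if j = i then v x else 0) := by
    intro j
    split_ifs
    · exact hv.l2
    · exact h0
  -- The definition of ∂_i v is read as a weak identity with zeroth-order part ∂_i v and flux v e_i.
  -- The Kronecker symbol in `hF` encodes this flux.
  have key := test_extension (hv.grad i) hF (fun ζ hζ => ?_) hη hu
  · simp only [ite_mul, zero_mul, Finset.sum_ite_eq', Finset.mem_univ, if_true] at key
    have i1 := (hu.l2.integrable_mul_mul (hv.grad i) hη)
    have i2 := (hv.l2.integrable_mul_mul (hu.grad i) hη)
    have i3 := (hu.l2.integrable_mul_mul hv.l2 (hη.pderiv i))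
    rw [eq_neg_iff_add_eq_zero, ← integral_add i3, ← key]
    · congr 1; ext x; ring
    · exact (i1.add i2).congr (ae_of_all _ fun x => by simp only [Pi.add_apply]; ring)
  · simp only [ite_mul, zero_mul, Finset.sum_ite_eq', Finset.mem_univ, if_true]
    rw [integral_add ((hv.grad i).locallyIntegrable.integrable_mul_test hζ)
      (hv.l2.locallyIntegrable.integrable_mul_test (hζ.pderiv i)), hv.weak ζ hζ i]
    ring

theorem L2loc.comp_lipschitz {u : E d → ℝ} (hu : L2loc u) {T : ℝ → ℝ} (hT : Continuous T) {L : ℝ}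
    (hL : ∀ s, |T s| ≤ |T 0| + L * |s|) : L2loc fun x => T (u x) := by
  have h1 : L2loc fun x => |T 0| + L * |u x| :=
    (continuous_const.l2loc).add (L2loc.const_mul (f := fun x => |u x|)
      (fun K hK => (hu K hK).abs) L)
  refine h1.mono (hT.comp_aestronglyMeasurable hu.aestronglyMeasurable) (ae_of_all _ fun x => ?_)
  exact (hL _).trans (le_abs_self _)

theorem L2loc.bounded_mul {f c : E d → ℝ} (hf : L2loc f) (hc : AEStronglyMeasurable c volume)
    {L : ℝ} (hL : ∀ x, |c x| ≤ L) : L2loc fun x => c x * f x := by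
  refine (hf.const_mul L).mono (hc.mul hf.aestronglyMeasurable) (ae_of_all _ fun x => ?_)
  rw [abs_mul, abs_mul]
  exact mul_le_mul_of_nonneg_right ((hL x).trans (le_abs_self _)) (abs_nonneg _)

/-- The classical chain rule holds for smooth approximants w n. A bounded T' makes T(w n) converge
in L², and continuity of T' takes care of the gradients. -/
theorem H1L.comp {u : E d → ℝ} {D : Fin d → E d → ℝ} (hu : H1L u D) {T T' : ℝ → ℝ}
    (hT : ∀ s, HasDerivAt T (T' s) s) (hT' : Continuous T') {L : ℝ} (hL : ∀ s, |T' s| ≤ L) :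
    H1L (fun x => T (u x)) (fun i x => T' (u x) * D i x) := by
  have hTc : Continuous T := continuous_iff_continuousAt.2 fun s => (hT s).continuousAt
  have hL0 : 0 ≤ L := (abs_nonneg _).trans (hL 0)
  have hlip : ∀ s t, |T s - T t| ≤ L * |s - t| := fun s t => by
    have := convex_univ.norm_image_sub_le_of_norm_hasDerivWithin_le
      (f := T) (f' := T') (fun x _ => (hT x).hasDerivWithinAt) (fun x _ => hL x)
      (Set.mem_univ t) (Set.mem_univ s)
    simpa using this
  have hT0 : ∀ s, |T s| ≤ |T 0| + L * |s| := fun s => by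
    have h1 := hlip s 0
    rw [sub_zero] at h1
    have h2 : |T s| ≤ |T s - T 0| + |T 0| := by
      simpa using abs_add_le (T s - T 0) (T 0)
    linarith
  have hTu := hu.l2.comp_lipschitz hTc hT0
  have hmT' : AEStronglyMeasurable (fun x => T' (u x)) volume :=
    hT'.comp_aestronglyMeasurable hu.l2.aestronglyMeasurable
  have hD := fun i => (hu.grad i).bounded_mul hmT' fun x => hL (u x)
  refine ⟨hTu, hD, fun η hη i => ?_⟩
  obtain ⟨R, hR, hs⟩ := exists_tsupport_subset_ball hη
  obtain ⟨w, hw, h1, h2⟩ := hu.exists_test_seq hR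
  set μ : Measure (E d) := volume.restrict (Metric.ball 0 R) with hμ
  have hmeas : ∀ n, AEStronglyMeasurable (w n) μ := fun n =>
    (hw n).continuous.aestronglyMeasurable
  -- T' is merely continuous, so T'(w n) → T'(u) needs pointwise convergence, available along a
  -- subsequence.
  obtain ⟨ns, hns, hae⟩ := (tendstoInMeasure_of_tendsto_eLpNorm (p := 2) (by norm_num) hmeas
    (hu.l2.memLp_ball R).1 h1).exists_seq_tendsto_ae
  have hwd : ∀ n x, HasFDerivAt (fun y => T (w n y)) (T' (w n x) • fderiv ℝ (w n) x) x :=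
    fun n x => (hT (w n x)).comp_hasFDerivAt x ((hw n).differentiable x).hasFDerivAt
  have hpd : ∀ n x, pderiv i (fun y => T (w n y)) x = T' (w n x) * pderiv i (w n) x := by
    intro n x
    rw [pderiv, (hwd n x).fderiv]
    rfl
  have ibp : ∀ n, ∫ x, T (w n x) * pderiv i η x = - ∫ x, T' (w n x) * pderiv i (w n) x * η x := by
    intro n
    have hcT' : Continuous fun x => T' (w n x) := hT'.comp (hw n).continuous
    have hwg := integral_mul_fderiv_eq_neg_fderiv_mul_of_integrable (μ := (volume : Measure (E d)))
      (f := fun y => T (w n y)) (g := η) (v := basisVec i) ?_ ?_ ?_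
      (fun x _ => (hwd n x).differentiableAt) (fun x _ => hη.differentiable x)
    · simp only [← hpd]
      exact hwg
    · have : (fun x => fderiv ℝ (fun y => T (w n y)) x (basisVec i) * η x) =
          fun x => T' (w n x) * pderiv i (w n) x * η x := by
        ext x
        rw [← hpd]
        rfl
      rw [this]
      exact ((hcT'.mul ((hw n).pderiv i).continuous).mul
        hη.continuous).integrable_of_hasCompactSupport hη.2.mul_left
    · exact ((hTc.comp (hw n).continuous).mul
        (hη.pderiv i).continuous).integrable_of_hasCompactSupport (hη.pderiv i).2.mul_left
    · exact ((hTc.comp (hw n).continuous).mul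
        hη.continuous).integrable_of_hasCompactSupport hη.2.mul_left
  have l2T : ∀ n, L2loc fun x => T (w n x) := fun n => (hTc.comp (hw n).continuous).l2loc
  have l2D : ∀ n, L2loc fun x => T' (w n x) * pderiv i (w n) x := fun n =>
    ((hT'.comp (hw n).continuous).mul ((hw n).pderiv i).continuous).l2loc
  have one : L2loc fun _ : E d => (1 : ℝ) := continuous_const.l2loc
  have c1 : Tendsto (fun n => eLpNorm (fun x => T (w (ns n) x) - T (u x)) 2 μ) atTop (𝓝 0) := by
    have h3 : Tendsto (fun n => ENNReal.ofReal L *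
        eLpNorm (fun x => w (ns n) x - u x) 2 μ) atTop (𝓝 0) := by
      simpa using ENNReal.Tendsto.const_mul (h1.comp hns.tendsto_atTop)
        (Or.inr ENNReal.ofReal_ne_top)
    refine tendsto_of_tendsto_of_tendsto_of_le_of_le tendsto_const_nhds h3 (fun _ => zero_le) ?_
    exact fun n => eLpNorm_le_mul_eLpNorm_of_ae_le_mul (ae_of_all _ fun x => hlip _ _) 2
  -- The error splits into T'(w)(∂_i w - ∂_i u), bounded by L times an L²-null sequence, and (T'(w)
  -- - T'(u)) ∂_i u, which tends to zero by domination with 2L|∂_i u|.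
  have c2 : Tendsto (fun n => eLpNorm (fun x => T' (w (ns n) x) * pderiv i (w (ns n)) x -
      T' (u x) * D i x) 2 μ) atTop (𝓝 0) := by
    have h3 : Tendsto (fun n => ENNReal.ofReal L *
        eLpNorm (fun x => pderiv i (w (ns n)) x - D i x) 2 μ) atTop (𝓝 0) := by
      simpa using ENNReal.Tendsto.const_mul ((h2 i).comp hns.tendsto_atTop)
        (Or.inr ENNReal.ofReal_ne_top)
    have m1 : ∀ n, AEStronglyMeasurable (fun x => T' (w (ns n) x)) μ := fun n =>
      (hT'.comp (hw _).continuous).aestronglyMeasurable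
    have mD : AEStronglyMeasurable (D i) μ := ((hu.grad i).memLp_ball R).1
    have h4 : Tendsto (fun n => eLpNorm (fun x => (T' (w (ns n) x) - T' (u x)) * D i x) 2 μ) atTop
        (𝓝 0) := by
      refine tendsto_eLpNorm_zero_of_dominated (((hu.grad i).memLp_ball R).const_mul (2 * L))
        (fun n => ((m1 n).sub hmT'.restrict).mul mD) (fun n => ae_of_all _ fun x => ?_) ?_
      · rw [norm_mul, norm_mul, Real.norm_eq_abs (2 * L), abs_of_nonneg (by positivity)]
        gcongr
        refine (abs_sub _ _).trans ?_
        linarith [hL (w (ns n) x), hL (u x)]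
      · filter_upwards [hae] with x hx
        have h5 := (((hT'.tendsto _).comp hx).sub_const (T' (u x))).mul_const (D i x)
        simpa using h5
    have h5 := h3.add h4
    rw [add_zero] at h5
    refine tendsto_of_tendsto_of_tendsto_of_le_of_le tendsto_const_nhds h5 (fun _ => zero_le) ?_
    intro n
    have m2 : AEStronglyMeasurable (fun x => pderiv i (w (ns n)) x - D i x) μ :=
      ((hw _).pderiv i).continuous.aestronglyMeasurable.sub mD
    have m3 : AEStronglyMeasurable
        (fun x => T' (w (ns n) x) * (pderiv i (w (ns n)) x - D i x)) μ := (m1 n).mul m2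
    have m4 : AEStronglyMeasurable (fun x => (T' (w (ns n) x) - T' (u x)) * D i x) μ :=
      ((m1 n).sub hmT'.restrict).mul mD
    have h6 := eLpNorm_add_le m3 m4 (p := 2) (by norm_num)
    have h7 : eLpNorm (fun x => T' (w (ns n) x) * (pderiv i (w (ns n)) x - D i x)) 2 μ ≤
        ENNReal.ofReal L * eLpNorm (fun x => pderiv i (w (ns n)) x - D i x) 2 μ := by
      refine eLpNorm_le_mul_eLpNorm_of_ae_le_mul (ae_of_all _ fun x => ?_) 2
      rw [norm_mul]
      gcongr
      exact hL _
    have h8 : (fun x => T' (w (ns n) x) * pderiv i (w (ns n)) x - T' (u x) * D i x) =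
        (fun x => T' (w (ns n) x) * (pderiv i (w (ns n)) x - D i x)) +
          fun x => (T' (w (ns n) x) - T' (u x)) * D i x := by
      ext x
      simp only [Pi.add_apply]
      ring
    dsimp only
    rw [h8]
    exact h6.trans (by gcongr)
  have t1 := tendsto_integral_mul_test (hη.pderiv i) ((tsupport_pderiv_subset η i).trans hs)
    (fun n => l2T (ns n)) hTu one c1
  have t2 := (tendsto_integral_mul_test hη hs (fun n => l2D (ns n)) (hD i) one c2).neg
  simp only [mul_one] at t1 t2
  exact tendsto_nhds_unique t1 (t2.congr fun n => (ibp _).symm)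

end

/-! ### Elliptic fields, soft truncation and the pointwise Caccioppoli inequality. -/

section

variable {d : ℕ}

/-- Uniform ellipticity with lower bound `lam` and upper bound `1`. -/
structure Elliptic (lam : ℝ) (A : E d → Matrix (Fin d) (Fin d) ℝ) : Prop where
  measurable : ∀ i j, Measurable fun x => A x i j
  bounds : ∀ᵐ x ∂(volume : Measure (E d)), ∀ ξ : E d,
    lam * ‖ξ‖ ^ 2 ≤ inner ℝ ξ (matVec (A x) ξ) ∧ ‖matVec (A x) ξ‖ ≤ ‖ξ‖

theorem matVec_apply (A : Matrix (Fin d) (Fin d) ℝ) (ξ : E d) (j : Fin d) :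
    matVec A ξ j = ∑ k, A j k * ξ k := rfl

theorem matVec_add (A : Matrix (Fin d) (Fin d) ℝ) (ξ ζ : E d) :
    matVec A (ξ + ζ) = matVec A ξ + matVec A ζ := by
  ext j
  simp [matVec_apply, mul_add, Finset.sum_add_distrib]

theorem matVec_smul (A : Matrix (Fin d) (Fin d) ℝ) (c : ℝ) (ξ : E d) :
    matVec A (c • ξ) = c • matVec A ξ := by
  ext j
  simp only [matVec_apply, PiLp.smul_apply, smul_eq_mul, Finset.mul_sum]
  exact Finset.sum_congr rfl fun k _ => by ring

theorem matVec_sum {ι : Type*} (A : Matrix (Fin d) (Fin d) ℝ) (s : Finset ι) (ξ : ι → E d) :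
    matVec A (∑ i ∈ s, ξ i) = ∑ i ∈ s, matVec A (ξ i) := by
  classical
  induction s using Finset.induction_on with
  | empty => ext j; simp [matVec_apply]
  | insert a s ha ih => rw [Finset.sum_insert ha, matVec_add, ih, Finset.sum_insert ha]

theorem matVec_sub (A : Matrix (Fin d) (Fin d) ℝ) (ξ ζ : E d) :
    matVec A (ξ - ζ) = matVec A ξ - matVec A ζ := by
  ext j
  simp [matVec_apply, mul_sub, Finset.sum_sub_distrib]

theorem abs_apply_le_norm (v : E d) (i : Fin d) : |v i| ≤ ‖v‖ := by
  simpa using PiLp.norm_apply_le v i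

theorem norm_le_sum_abs (v : E d) : ‖v‖ ≤ ∑ i, |v i| := by
  have h : v = ∑ i, v i • basisVec i := by
    ext j
    simp [basisVec, Pi.single_apply]
  calc ‖v‖ = ‖∑ i, v i • basisVec i‖ := by rw [← h]
    _ ≤ ∑ i, ‖v i • basisVec i‖ := norm_sum_le _ _
    _ = ∑ i, |v i| := by simp [norm_smul, basisVec]

theorem inner_eq_sum (v w : E d) : inner ℝ v w = ∑ i, v i * w i := by
  simp [PiLp.inner_apply, mul_comm]

theorem norm_sq_eq_sum (v : E d) : ‖v‖ ^ 2 = ∑ i, v i ^ 2 := by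
  rw [EuclideanSpace.norm_sq_eq]
  simp

theorem abs_sum_mul_le_norm (v w : E d) : |∑ i, v i * w i| ≤ ‖v‖ * ‖w‖ := by
  rw [← inner_eq_sum]
  exact abs_real_inner_le_norm v w

theorem L2loc.abs {f : E d → ℝ} (hf : L2loc f) : L2loc fun x => |f x| :=
  fun K hK => (hf K hK).abs

theorem L2loc.norm_vec {G : E d → E d} (hG : ∀ i, L2loc fun x => G x i) :
    L2loc fun x => ‖G x‖ := by
  have h1 : L2loc fun x => ∑ i, |G x i| := L2loc.sum _ fun i => (hG i).abs
  have hm : AEStronglyMeasurable (fun x => ‖G x‖) volume := by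
    have : (fun x => ‖G x‖) = fun x => Real.sqrt (∑ i, G x i ^ 2) := by
      ext x
      rw [← norm_sq_eq_sum, Real.sqrt_sq (norm_nonneg _)]
    rw [this]
    refine Real.continuous_sqrt.comp_aestronglyMeasurable ?_
    exact Finset.aestronglyMeasurable_fun_sum _ fun i _ => (hG i).aestronglyMeasurable.pow 2
  refine h1.mono hm (ae_of_all _ fun x => ?_)
  rw [abs_of_nonneg (norm_nonneg _)]
  exact (norm_le_sum_abs _).trans (le_abs_self _)

theorem Elliptic.aestronglyMeasurable_flux {lam : ℝ} {A : E d → Matrix (Fin d) (Fin d) ℝ}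
    (hA : Elliptic lam A) {G : E d → E d} (hG : ∀ i, AEStronglyMeasurable (fun x => G x i) volume)
    (j : Fin d) : AEStronglyMeasurable (fun x => matVec (A x) (G x) j) volume := by
  simp only [matVec_apply]
  exact Finset.aestronglyMeasurable_fun_sum _ fun k _ =>
    (hA.measurable j k).aestronglyMeasurable.mul (hG k)

theorem Elliptic.l2loc_flux {lam : ℝ} {A : E d → Matrix (Fin d) (Fin d) ℝ} (hA : Elliptic lam A)
    {G : E d → E d} (hG : ∀ i, L2loc fun x => G x i) (j : Fin d) :
    L2loc fun x => matVec (A x) (G x) j := by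
  refine (L2loc.norm_vec hG).mono
    (hA.aestronglyMeasurable_flux (fun i => (hG i).aestronglyMeasurable) j) ?_
  filter_upwards [hA.bounds] with x hx
  rw [abs_of_nonneg (norm_nonneg (G x))]
  exact (abs_apply_le_norm _ _).trans (hx _).2

/-- A smooth bounded approximation of the identity. -/
def softTrunc (δ s : ℝ) : ℝ := δ⁻¹ * Real.arctan (δ * s)

/-- The derivative of `softTrunc δ`. -/
def softTruncDeriv (δ s : ℝ) : ℝ := 1 / (1 + (δ * s) ^ 2)

theorem hasDerivAt_softTrunc {δ : ℝ} (hδ : δ ≠ 0) (s : ℝ) :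
    HasDerivAt (softTrunc δ) (softTruncDeriv δ s) s := by
  have h1 := ((hasDerivAt_id s).const_mul δ).arctan.const_mul δ⁻¹
  refine h1.congr_deriv ?_
  simp only [softTruncDeriv, id]
  field_simp

theorem softTruncDeriv_pos (δ s : ℝ) : 0 < softTruncDeriv δ s := by
  unfold softTruncDeriv; positivity

theorem softTruncDeriv_le_one (δ s : ℝ) : softTruncDeriv δ s ≤ 1 := by
  unfold softTruncDeriv
  rw [div_le_one (by positivity)]
  nlinarith [sq_nonneg (δ * s)]

theorem continuous_softTruncDeriv (δ : ℝ) : Continuous (softTruncDeriv δ) := by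
  unfold softTruncDeriv
  exact continuous_const.div (by fun_prop) fun s => by positivity

theorem abs_arctan_le (x : ℝ) : |Real.arctan x| ≤ |x| := by
  have := convex_univ.norm_image_sub_le_of_norm_hasDerivWithin_le (C := 1)
    (f := Real.arctan) (f' := fun x => 1 / (1 + x ^ 2))
    (fun x _ => (Real.hasDerivAt_arctan x).hasDerivWithinAt) (fun x _ => ?_)
    (Set.mem_univ 0) (Set.mem_univ x)
  · simpa using this
  · rw [Real.norm_of_nonneg (by positivity), div_le_one (by positivity)]
    nlinarith [sq_nonneg x]

theorem abs_softTrunc_le {δ : ℝ} (hδ : 0 < δ) (s : ℝ) : |softTrunc δ s| ≤ |s| := by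
  rw [softTrunc, abs_mul, abs_of_pos (inv_pos.2 hδ), inv_mul_le_iff₀ hδ]
  refine (abs_arctan_le _).trans ?_
  rw [abs_mul, abs_of_pos hδ]

theorem abs_softTrunc_le_const {δ : ℝ} (hδ : 0 < δ) (s : ℝ) : |softTrunc δ s| ≤ 2 / δ := by
  rw [softTrunc, abs_mul, abs_of_pos (inv_pos.2 hδ), inv_mul_le_iff₀ hδ]
  have : |Real.arctan (δ * s)| ≤ 2 := by
    rw [abs_le]
    constructor <;>
      linarith [Real.neg_pi_div_two_lt_arctan (δ * s), Real.arctan_lt_pi_div_two (δ * s),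
        Real.pi_lt_d2]
  refine this.trans (le_of_eq ?_)
  field_simp

/-- With x = δs this is arctan² x · (1 + x²) ≤ 4x², which follows from arctan² x ≤ x² and arctan² x
≤ 3. It is the reason for an arctangent: a sharp truncation has zero derivative above its level, and
no such bound could hold. -/
theorem softTrunc_sq_le {δ : ℝ} (hδ : 0 < δ) (s : ℝ) :
    softTrunc δ s ^ 2 ≤ 4 * s ^ 2 * softTruncDeriv δ s := by
  have h1 : Real.arctan (δ * s) ^ 2 ≤ (δ * s) ^ 2 := sq_le_sq.2 (abs_arctan_le _)
  have h2 : Real.arctan (δ * s) ^ 2 ≤ 3 := by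
    have ha : |Real.arctan (δ * s)| ≤ 1.6 := by
      rw [abs_le]
      constructor <;>
        linarith [Real.neg_pi_div_two_lt_arctan (δ * s), Real.arctan_lt_pi_div_two (δ * s),
          Real.pi_lt_d2]
    have := sq_le_sq' (by linarith [abs_nonneg (Real.arctan (δ * s))]) ha
    rw [sq_abs] at this
    linarith
  rw [softTruncDeriv, mul_one_div, le_div_iff₀ (by positivity), softTrunc, mul_pow, inv_pow,
    mul_assoc, inv_mul_le_iff₀ (by positivity)]
  nlinarith [sq_nonneg (δ * s)]

theorem tendsto_softTrunc (s : ℝ) :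
    Tendsto (fun n : ℕ => softTrunc (1 / ((n : ℝ) + 1)) s) atTop (𝓝 s) := by
  have h1 : HasDerivAt (fun t : ℝ => Real.arctan (t * s)) s 0 := by
    have := ((hasDerivAt_id (0 : ℝ)).mul_const s).arctan
    simpa using this
  have h2 := h1.tendsto_slope_zero_right
  have h3 : Tendsto (fun n : ℕ => 1 / ((n : ℝ) + 1)) atTop (𝓝[>] 0) :=
    tendsto_nhdsWithin_iff.2 ⟨tendsto_one_div_add_atTop_nhds_zero_nat,
      Eventually.of_forall fun n => by simp only [Set.mem_Ioi]; positivity⟩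
  refine (h2.comp h3).congr fun n => ?_
  simp [softTrunc]

theorem tendsto_softTruncDeriv (s : ℝ) :
    Tendsto (fun n : ℕ => softTruncDeriv (1 / ((n : ℝ) + 1)) s) atTop (𝓝 1) := by
  have h : Continuous fun δ : ℝ => softTruncDeriv δ s := by
    unfold softTruncDeriv
    exact continuous_const.div (by fun_prop) fun s => by positivity
  have := (h.tendsto 0).comp tendsto_one_div_add_atTop_nhds_zero_nat
  simpa [softTruncDeriv, Function.comp_def] using this

theorem H1L.softTrunc {u : E d → ℝ} {D : Fin d → E d → ℝ} (hu : H1L u D) {δ : ℝ} (hδ : 0 < δ) :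
    H1L (fun x => softTrunc δ (u x)) (fun i x => softTruncDeriv δ (u x) * D i x) :=
  hu.comp (hasDerivAt_softTrunc hδ.ne') (continuous_softTruncDeriv δ) (L := 1) fun s => by
    rw [abs_of_pos (softTruncDeriv_pos δ s)]; exact softTruncDeriv_le_one δ s

theorem H1L.mul_of_bounded {u v : E d → ℝ} {D D' : Fin d → E d → ℝ} (hu : H1L u D)
    (hv : H1L v D') {L : ℝ} (hub : ∀ x, |u x| ≤ L) (hvb : ∀ x, |v x| ≤ L) :
    H1L (fun x => u x * v x) (fun i x => u x * D' i x + v x * D i x) :=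
  ⟨hv.l2.bounded_mul hu.l2.aestronglyMeasurable hub, fun i =>
    ((hv.grad i).bounded_mul hu.l2.aestronglyMeasurable hub).add
      ((hu.grad i).bounded_mul hv.l2.aestronglyMeasurable hvb), hu.weakGrad_mul hv⟩

/-- The gradient of a smooth function as a vector field. -/
def pgrad (η : E d → ℝ) (x : E d) : E d := WithLp.toLp 2 fun i => pderiv i η x

@[simp] theorem pgrad_apply (η : E d → ℝ) (x : E d) (i : Fin d) : pgrad η x i = pderiv i η x := rfl

theorem exists_test_eq_one {K : Set (E d)} (hK : IsCompact K) :
    ∃ χ : E d → ℝ, IsTest χ ∧ ∀ x ∈ K, χ x = 1 := by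
  obtain ⟨R, hR⟩ := hK.isBounded.subset_ball 0
  have hR' : (0 : ℝ) < max R 1 := by positivity
  refine ⟨cutoff (max R 1), isTest_cutoff hR', fun x hx => cutoff_eq_one hR' ?_⟩
  exact (mem_ball_zero_iff.1 (hR hx)).le.trans (le_max_left _ _)

/-- Algebra for the test function χ² t s², where t and s truncate ψ and g and P is the size of ∇ψ.
The good term carries the factor t' and the two cross terms carry t instead. The hypothesis t² ≤
4ψ²t' lets Young's inequality absorb each cross term with a quarter of lam. The constant 16 is 4
from Young times 4 from that hypothesis. -/
theorem caccioppoli_pointwise {lam : ℝ} (hlam : 0 < lam) {χ t t' s s' ψ g F P G X : ℝ}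
    (h1 : t ^ 2 ≤ 4 * ψ ^ 2 * t') (ht' : 0 < t') (hs : s ^ 2 ≤ g ^ 2) (hs' : |s'| ≤ 1)
    (hF : 0 ≤ F) (hP : F ≤ P) (hG : 0 ≤ G) (hX : 0 ≤ X) {a b : ℝ} (ha : |a| ≤ F * G)
    (hb : |b| ≤ F * X) :
    lam * (χ ^ 2 * s ^ 2 * t' * P ^ 2) + 2 * (χ ^ 2 * t * s * s' * a) + 2 * (χ * t * s ^ 2 * b) ≥
      lam / 2 * (χ ^ 2 * s ^ 2 * t' * P ^ 2) -
        16 / lam * (χ ^ 2 * (ψ ^ 2 * G ^ 2) + (ψ ^ 2 * g ^ 2) * X ^ 2) := by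
  have hP0 : 0 ≤ P := hF.trans hP
  -- Both sides are kept multiplied by t'; dividing by t' > 0 later turns (p t')² into p² t', the
  -- weight of the good term.
  have young : ∀ p q : ℝ, 2 * |p * q| * t' ≤ lam / 4 * (p * t') ^ 2 + 4 / lam * q ^ 2 := by
    intro p q
    have h := sq_nonneg (lam / 2 * |p * t'| - 2 * |q|)
    have e : |p * q| * t' = |p * t'| * |q| := by
      rw [abs_mul, abs_mul, abs_of_pos ht']; ring
    rw [mul_assoc, e]
    rw [← sq_abs (p * t'), ← sq_abs q]
    have : lam / 4 * |p * t'| ^ 2 + 4 / lam * |q| ^ 2 - 2 * (|p * t'| * |q|) =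
        (lam / 2 * |p * t'| - 2 * |q|) ^ 2 / lam := by
      field_simp; ring
    have h2 : 0 ≤ (lam / 2 * |p * t'| - 2 * |q|) ^ 2 / lam := by positivity
    linarith
  have b1 : 2 * |χ ^ 2 * t * s * s' * a| ≤
      lam / 4 * (χ ^ 2 * s ^ 2 * t' * P ^ 2) + 16 / lam * (χ ^ 2 * (ψ ^ 2 * G ^ 2)) := by
    have y := young (χ * s * P) (χ * t * G)
    have c1 : |χ ^ 2 * t * s * s' * a| ≤ |(χ * s * P) * (χ * t * G)| := by
      have : |s' * a| ≤ |P * G| := by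
        rw [abs_mul, abs_of_nonneg (by positivity : 0 ≤ P * G)]
        calc |s'| * |a| ≤ 1 * (F * G) := by gcongr
          _ ≤ P * G := by rw [one_mul]; gcongr
      calc |χ ^ 2 * t * s * s' * a| = |χ ^ 2 * t * s| * |s' * a| := by rw [← abs_mul]; congr 1; ring
        _ ≤ |χ ^ 2 * t * s| * |P * G| := by gcongr
        _ = _ := by rw [← abs_mul]; congr 1; ring
    have c2 : (χ * t * G) ^ 2 ≤ 4 * (χ ^ 2 * (ψ ^ 2 * G ^ 2)) * t' := by
      calc (χ * t * G) ^ 2 = (χ * G) ^ 2 * t ^ 2 := by ring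
        _ ≤ (χ * G) ^ 2 * (4 * ψ ^ 2 * t') := by gcongr
        _ = _ := by ring
    have c3 : 4 / lam * (χ * t * G) ^ 2 ≤ 16 / lam * (χ ^ 2 * (ψ ^ 2 * G ^ 2)) * t' := by
      calc _ ≤ 4 / lam * (4 * (χ ^ 2 * (ψ ^ 2 * G ^ 2)) * t') := by gcongr
        _ = _ := by ring
    refine le_of_mul_le_mul_right ?_ ht'
    calc 2 * |χ ^ 2 * t * s * s' * a| * t' ≤ 2 * |(χ * s * P) * (χ * t * G)| * t' := by gcongr
      _ ≤ _ := y
      _ ≤ lam / 4 * (χ * s * P * t') ^ 2 + 16 / lam * (χ ^ 2 * (ψ ^ 2 * G ^ 2)) * t' := by gcongr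
      _ = _ := by ring
  have b2 : 2 * |χ * t * s ^ 2 * b| ≤
      lam / 4 * (χ ^ 2 * s ^ 2 * t' * P ^ 2) + 16 / lam * ((ψ ^ 2 * g ^ 2) * X ^ 2) := by
    have y := young (χ * s * P) (t * s * X)
    have c1 : |χ * t * s ^ 2 * b| ≤ |(χ * s * P) * (t * s * X)| := by
      have : |b| ≤ |P * X| := by
        rw [abs_of_nonneg (by positivity : 0 ≤ P * X)]
        exact hb.trans (by gcongr)
      calc |χ * t * s ^ 2 * b| = |χ * t * s ^ 2| * |b| := abs_mul _ _
        _ ≤ |χ * t * s ^ 2| * |P * X| := by gcongr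
        _ = _ := by rw [← abs_mul]; congr 1; ring
    have c2 : (t * s * X) ^ 2 ≤ 4 * ((ψ ^ 2 * g ^ 2) * X ^ 2) * t' := by
      calc (t * s * X) ^ 2 = X ^ 2 * (t ^ 2 * s ^ 2) := by ring
        _ ≤ X ^ 2 * ((4 * ψ ^ 2 * t') * g ^ 2) := by gcongr
        _ = _ := by ring
    have c3 : 4 / lam * (t * s * X) ^ 2 ≤ 16 / lam * ((ψ ^ 2 * g ^ 2) * X ^ 2) * t' := by
      calc _ ≤ 4 / lam * (4 * ((ψ ^ 2 * g ^ 2) * X ^ 2) * t') := by gcongr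
        _ = _ := by ring
    refine le_of_mul_le_mul_right ?_ ht'
    calc 2 * |χ * t * s ^ 2 * b| * t' ≤ 2 * |(χ * s * P) * (t * s * X)| * t' := by gcongr
      _ ≤ _ := y
      _ ≤ lam / 4 * (χ * s * P * t') ^ 2 + 16 / lam * ((ψ ^ 2 * g ^ 2) * X ^ 2) * t' := by gcongr
      _ = _ := by ring
  have n1 := neg_abs_le (χ ^ 2 * t * s * s' * a)
  have n2 := neg_abs_le (χ * t * s ^ 2 * b)
  have e : 16 / lam * (χ ^ 2 * (ψ ^ 2 * G ^ 2) + (ψ ^ 2 * g ^ 2) * X ^ 2) =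
    16 / lam * (χ ^ 2 * (ψ ^ 2 * G ^ 2)) + 16 / lam * ((ψ ^ 2 * g ^ 2) * X ^ 2) := by ring
  rw [e]
  linarith

end

/-! ### Caccioppoli's inequality with a Sobolev weight. -/

section

variable {d : ℕ}

theorem enorm_sq_eq_ofReal (x : ℝ) : ‖x‖ₑ ^ 2 = ENNReal.ofReal (x ^ 2) := by
  rw [← ofReal_norm, ← ENNReal.ofReal_pow (norm_nonneg _), Real.norm_eq_abs, sq_abs]

theorem memLp_two_of_lintegral {f : E d → ℝ} {μ : Measure (E d)} (hf : AEStronglyMeasurable f μ)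
    (h : ∫⁻ x, ENNReal.ofReal (f x ^ 2) ∂μ < ∞) : MemLp f 2 μ := by
  refine ⟨hf, ?_⟩
  simp only [← enorm_sq_eq_ofReal, ← eLpNorm_two_sq] at h
  by_contra hc
  rw [not_lt, top_le_iff] at hc
  simp [hc] at h

theorem isTest_sum_pderiv_sq {χ : E d → ℝ} (hχ : IsTest χ) :
    IsTest fun x => ‖pgrad χ x‖ ^ 2 := by
  have e : (fun x => ‖pgrad χ x‖ ^ 2) = ∑ i, fun x => pderiv i χ x * pderiv i χ x := by
    ext x
    rw [norm_sq_eq_sum, Finset.sum_apply]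
    exact Finset.sum_congr rfl fun i _ => by rw [pgrad_apply]; ring
  rw [e]
  have : ∀ s : Finset (Fin d), IsTest (∑ i ∈ s, fun x => pderiv i χ x * pderiv i χ x) := by
    intro s
    classical
    induction s using Finset.induction_on with
    | empty => exact ⟨contDiff_const, HasCompactSupport.zero⟩
    | insert a s ha ih =>
      rw [Finset.sum_insert ha]
      exact ((hχ.pderiv a).mul (hχ.pderiv a)).add ih
  exact this _

/-- The untruncated test function would be χ²ψg², whose gradient involves the very product g∇ψ to be
controlled. Truncating both ψ and g makes it admissible, and the resulting bound does not depend on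
δ. -/
theorem caccioppoli_softTrunc {lam : ℝ} (hlam : 0 < lam) {A : E d → Matrix (Fin d) (Fin d) ℝ}
    (hA : Elliptic lam A) {ψ g : E d → ℝ} {Ψ G : E d → E d} (hψ : H1L ψ fun i x => Ψ x i)
    (heq : ∀ η, IsTest η → ∫ x, ∑ j, matVec (A x) (Ψ x) j * pderiv j η x = 0)
    (hg : H1L g fun i x => G x i) (h1 : L2loc fun x => ψ x * g x)
    (h2 : ∀ i, L2loc fun x => ψ x * G x i) {χ : E d → ℝ} (hχ : IsTest χ) {δ : ℝ} (hδ : 0 < δ) :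
    Integrable (fun x =>
      χ x ^ 2 * softTrunc δ (g x) ^ 2 * softTruncDeriv δ (ψ x) * ‖Ψ x‖ ^ 2) ∧
    ∫ x, χ x ^ 2 * softTrunc δ (g x) ^ 2 * softTruncDeriv δ (ψ x) * ‖Ψ x‖ ^ 2 ≤
      2 / lam * ∫ x, 16 / lam * (χ x ^ 2 * (ψ x ^ 2 * ‖G x‖ ^ 2) +
        (ψ x ^ 2 * g x ^ 2) * ‖pgrad χ x‖ ^ 2) := by
  set t := fun x => softTrunc δ (ψ x) with ht
  set t' := fun x => softTruncDeriv δ (ψ x) with ht'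
  set s := fun x => softTrunc δ (g x) with hs
  set s' := fun x => softTruncDeriv δ (g x) with hs'
  have tH : H1L t fun i x => t' x * Ψ x i := hψ.softTrunc hδ
  have sH : H1L s fun i x => s' x * G x i := hg.softTrunc hδ
  have tb : ∀ x, |t x| ≤ 2 / δ := fun x => abs_softTrunc_le_const hδ _
  have sb : ∀ x, |s x| ≤ 2 / δ := fun x => abs_softTrunc_le_const hδ _
  have ssb : ∀ x, |s x * s x| ≤ (2 / δ) ^ 2 := fun x => by
    rw [abs_mul, sq]
    exact mul_le_mul (sb x) (sb x) (abs_nonneg _) (by positivity)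
  have ssH := sH.mul_of_bounded sH sb sb
  -- `H1L.mul_of_bounded` asks for one bound on both factors; the sum dominates 2/δ for t and (2/δ)²
  -- for s².
  have vH := tH.mul_of_bounded ssH (L := 2 / δ + (2 / δ) ^ 2)
    (fun x => (tb x).trans (by linarith [sq_nonneg (2 / δ)]))
    (fun x => (ssb x).trans (by linarith [show 0 < 2 / δ by positivity]))
  have l2F : ∀ j, L2loc fun x => matVec (A x) (Ψ x) j := fun j => hA.l2loc_flux hψ.grad j
  have l20 : L2loc fun _ : E d => (0 : ℝ) := continuous_const.l2loc
  have key := test_extension (h := fun _ => 0) l20 l2F (fun η hη => by simpa using heq η hη)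
    (hχ.mul hχ) vH
  have keyi := integrable_test_extension (h := fun _ => 0) l20 l2F (hχ.mul hχ) vH.l2 vH.grad
  set I : E d → ℝ := fun x => χ x ^ 2 * s x ^ 2 * t' x * (inner ℝ (Ψ x) (matVec (A x) (Ψ x))) +
    2 * (χ x ^ 2 * t x * s x * s' x * (∑ j, matVec (A x) (Ψ x) j * G x j)) +
    2 * (χ x * t x * s x ^ 2 * (∑ j, matVec (A x) (Ψ x) j * pgrad χ x j)) with hI
  have eI : (fun x => (fun _ => (0 : ℝ)) x * (χ x * χ x * (t x * (s x * s x))) +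
      ∑ j, matVec (A x) (Ψ x) j * (χ x * χ x * (t x * (s x * (s' x * G x j) + s x * (s' x * G x j))
        + s x * s x * (t' x * Ψ x j)) + t x * (s x * s x) * pderiv j (fun x => χ x * χ x) x)) =
      I := by
    ext x
    rw [hI]
    dsimp only
    rw [inner_eq_sum, zero_mul, zero_add, Finset.mul_sum, Finset.mul_sum, Finset.mul_sum,
      Finset.mul_sum, Finset.mul_sum, ← Finset.sum_add_distrib, ← Finset.sum_add_distrib]
    refine Finset.sum_congr rfl fun j _ => ?_
    rw [pderiv_mul hχ.differentiable hχ.differentiable, pgrad_apply]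
    ring
  rw [eI] at key keyi
  have nΨ := L2loc.norm_vec hψ.grad
  have mt' : AEStronglyMeasurable t' volume :=
    (continuous_softTruncDeriv δ).comp_aestronglyMeasurable hψ.l2.aestronglyMeasurable
  have iX : Integrable fun x => χ x ^ 2 * s x ^ 2 * t' x * ‖Ψ x‖ ^ 2 := by
    have b1 : L2loc fun x => s x * s x * t' x * ‖Ψ x‖ := by
      refine nΨ.bounded_mul ((sH.l2.aestronglyMeasurable.mul sH.l2.aestronglyMeasurable).mul mt')
        (L := (2 / δ) ^ 2) fun x => ?_
      rw [abs_mul]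
      refine (mul_le_of_le_one_right (abs_nonneg _) ?_).trans (ssb x)
      rw [abs_of_pos (softTruncDeriv_pos δ _)]
      exact softTruncDeriv_le_one _ _
    refine (b1.integrable_mul_mul nΨ (hχ.mul hχ)).congr (ae_of_all _ fun x => ?_)
    dsimp only
    ring
  have iY : Integrable fun x => 16 / lam * (χ x ^ 2 * (ψ x ^ 2 * ‖G x‖ ^ 2) +
        (ψ x ^ 2 * g x ^ 2) * ‖pgrad χ x‖ ^ 2) := by
    have b1 : L2loc fun x => ‖ψ x • G x‖ := L2loc.norm_vec fun i => h2 i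
    have c1 := b1.integrable_mul_mul b1 (hχ.mul hχ)
    have c2 := h1.integrable_mul_mul h1 (isTest_sum_pderiv_sq hχ)
    refine ((c1.add c2).const_mul (16 / lam)).congr (ae_of_all _ fun x => ?_)
    simp only [Pi.add_apply, norm_smul, Real.norm_eq_abs]
    congr 2
    · rw [← sq_abs (ψ x)]; ring
    · ring
  refine ⟨iX, ?_⟩
  have hle : ∫ x, lam / 2 * (χ x ^ 2 * s x ^ 2 * t' x * ‖Ψ x‖ ^ 2) -
      16 / lam * (χ x ^ 2 * (ψ x ^ 2 * ‖G x‖ ^ 2) + (ψ x ^ 2 * g x ^ 2) * ‖pgrad χ x‖ ^ 2) ≤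
      ∫ x, I x := by
    refine integral_mono_ae ((iX.const_mul _).sub iY) keyi ?_
    filter_upwards [hA.bounds] with x hx
    have hF := (hx (Ψ x)).2
    have hE := (hx (Ψ x)).1
    have p := caccioppoli_pointwise hlam (χ := χ x) (t := t x) (t' := t' x) (s := s x) (s' := s' x)
      (ψ := ψ x) (g := g x) (F := ‖matVec (A x) (Ψ x)‖) (P := ‖Ψ x‖) (G := ‖G x‖)
      (X := ‖pgrad χ x‖) (softTrunc_sq_le hδ _) (softTruncDeriv_pos δ _)
      (sq_le_sq.2 (abs_softTrunc_le hδ _))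
      (by rw [abs_of_pos (softTruncDeriv_pos δ _)]; exact softTruncDeriv_le_one _ _)
      (norm_nonneg _) hF (norm_nonneg _) (norm_nonneg _)
      (abs_sum_mul_le_norm _ _) (abs_sum_mul_le_norm (matVec (A x) (Ψ x)) (pgrad χ x))
    refine le_trans p ?_
    rw [hI]
    dsimp only
    have q : χ x ^ 2 * s x ^ 2 * t' x * (lam * ‖Ψ x‖ ^ 2) ≤
        χ x ^ 2 * s x ^ 2 * t' x * (inner ℝ (Ψ x) (matVec (A x) (Ψ x))) := by
      have := (softTruncDeriv_pos δ (ψ x)).le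
      exact mul_le_mul_of_nonneg_left hE (by positivity)
    linarith
  rw [key, integral_sub (iX.const_mul _) iY, integral_const_mul] at hle
  rw [div_mul_eq_mul_div, le_div_iff₀ hlam]
  linarith

/-- Caccioppoli's inequality with a Sobolev weight: if `∇ψ` is `A`-divergence free and `ψ g`,
`ψ ∇g` are locally square integrable, then so is `g ∇ψ`. -/
theorem l2loc_mul_grad {lam : ℝ} (hlam : 0 < lam) {A : E d → Matrix (Fin d) (Fin d) ℝ}
    (hA : Elliptic lam A) {ψ g : E d → ℝ} {Ψ G : E d → E d} (hψ : H1L ψ fun i x => Ψ x i)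
    (heq : ∀ η, IsTest η → ∫ x, ∑ j, matVec (A x) (Ψ x) j * pderiv j η x = 0)
    (hg : H1L g fun i x => G x i) (h1 : L2loc fun x => ψ x * g x)
    (h2 : ∀ i, L2loc fun x => ψ x * G x i) (i : Fin d) : L2loc fun x => g x * Ψ x i := by
  intro K hK
  obtain ⟨χ, hχ, hχ1⟩ := exists_test_eq_one hK
  have hδ : ∀ n : ℕ, (0 : ℝ) < 1 / ((n : ℝ) + 1) := fun n => by positivity
  have hc := fun n => caccioppoli_softTrunc hlam hA hψ heq hg h1 h2 hχ (hδ n)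
  set C : ℝ := 2 / lam * ∫ x, 16 / lam * (χ x ^ 2 * (ψ x ^ 2 * ‖G x‖ ^ 2) +
        (ψ x ^ 2 * g x ^ 2) * ‖pgrad χ x‖ ^ 2)
  set X : ℕ → E d → ℝ := fun n x => χ x ^ 2 * softTrunc (1 / ((n : ℝ) + 1)) (g x) ^ 2 *
    softTruncDeriv (1 / ((n : ℝ) + 1)) (ψ x) * ‖Ψ x‖ ^ 2 with hX
  have X0 : ∀ n x, 0 ≤ X n x := fun n x => by
    have := (softTruncDeriv_pos (1 / ((n : ℝ) + 1)) (ψ x)).le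
    simp only [hX]
    positivity
  have hb : ∀ n, ∫⁻ x, ENNReal.ofReal (X n x) ≤ ENNReal.ofReal C := fun n => by
    rw [← ofReal_integral_eq_lintegral_ofReal (hc n).1 (ae_of_all _ (X0 n))]
    exact ENNReal.ofReal_le_ofReal (hc n).2
  have hlim : ∀ x, Tendsto (fun n => ENNReal.ofReal (X n x)) atTop
      (𝓝 (ENNReal.ofReal (χ x ^ 2 * g x ^ 2 * ‖Ψ x‖ ^ 2))) := fun x => by
    refine ENNReal.tendsto_ofReal ?_
    have := (((tendsto_softTrunc (g x)).pow 2).const_mul (χ x ^ 2)).mul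
      (tendsto_softTruncDeriv (ψ x)) |>.mul_const (‖Ψ x‖ ^ 2)
    simpa only [hX, mul_one] using this
  -- Fatou's lemma as δ → 0: the truncations converge pointwise to the identity and their
  -- derivatives to one, while the bound C stays fixed.
  have hfat : ∫⁻ x, ENNReal.ofReal (χ x ^ 2 * g x ^ 2 * ‖Ψ x‖ ^ 2) ≤ ENNReal.ofReal C := by
    calc ∫⁻ x, ENNReal.ofReal (χ x ^ 2 * g x ^ 2 * ‖Ψ x‖ ^ 2)
        = ∫⁻ x, liminf (fun n => ENNReal.ofReal (X n x)) atTop :=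
          lintegral_congr fun x => (hlim x).liminf_eq.symm
      _ ≤ liminf (fun n => ∫⁻ x, ENNReal.ofReal (X n x)) atTop :=
          lintegral_liminf_le' fun n => (hc n).1.aestronglyMeasurable.aemeasurable.ennreal_ofReal
      _ ≤ ENNReal.ofReal C := by
          refine (liminf_le_liminf (Eventually.of_forall hb)).trans ?_
          simp
  refine memLp_two_of_lintegral
    (hg.l2.aestronglyMeasurable.mul (hψ.grad i).aestronglyMeasurable).restrict ?_
  refine lt_of_le_of_lt ?_ (hfat.trans_lt ENNReal.ofReal_lt_top)
  refine le_trans (setLIntegral_mono_ae' hK.measurableSet (ae_of_all _ fun x hx => ?_))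
    (setLIntegral_le_lintegral K _)
  refine ENNReal.ofReal_le_ofReal ?_
  rw [hχ1 x hx, one_pow, one_mul, mul_pow]
  have : Ψ x i ^ 2 ≤ ‖Ψ x‖ ^ 2 := by
    rw [sq_le_sq, abs_of_nonneg (norm_nonneg (Ψ x))]
    exact abs_apply_le_norm _ _
  gcongr

end

/-! ### One realization of the corrector and its localized energy. -/

section

variable {d : ℕ}

/-- One realization of an extended corrector, for the coefficient field `A` and the homogenized
matrix `M`. -/
structure CorrectorData (lam : ℝ) (A : E d → Matrix (Fin d) (Fin d) ℝ)
    (M : Matrix (Fin d) (Fin d) ℝ) (φ : Fin d → E d → ℝ) (Φ : Fin d → E d → E d)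
    (σ : Fin d → Fin d → Fin d → E d → ℝ) : Prop where
  elliptic : Elliptic lam A
  phi : ∀ i, H1L (φ i) fun j x => Φ i x j
  sigma : ∀ i j k, L2loc (σ i j k)
  corrector_eq : ∀ i η, IsTest η →
    ∫ x, ∑ j, matVec (A x) (Φ i x + basisVec i) j * pderiv j η x = 0
  skew : ∀ i j k, ∀ᵐ x, σ i k j x = - σ i j k x
  div_sigma : ∀ i j η, IsTest η → - ∫ x, ∑ k, σ i j k x * pderiv k η x =
    ∫ x, (matVec (A x) (Φ i x + basisVec i) - matVec M (basisVec i)) j * η x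

variable {lam : ℝ} {A : E d → Matrix (Fin d) (Fin d) ℝ} {M : Matrix (Fin d) (Fin d) ℝ}
  {φ : Fin d → E d → ℝ} {Φ : Fin d → E d → E d} {σ : Fin d → Fin d → Fin d → E d → ℝ}

theorem matVec_basisVec (M : Matrix (Fin d) (Fin d) ℝ) (i j : Fin d) :
    matVec M (basisVec i) j = M j i := by
  simp [matVec_apply, basisVec]

theorem sum_smul_basisVec (ξ : E d) : ∑ i, ξ i • basisVec i = ξ := by
  ext j
  simp [basisVec, Pi.single_apply]

theorem CorrectorData.l2loc_grad (h : CorrectorData lam A M φ Φ σ) (i j : Fin d) :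
    L2loc fun x => (Φ i x + basisVec i) j :=
  ((h.phi i).grad j).add (continuous_const (y := basisVec i j)).l2loc

theorem CorrectorData.l2loc_flux (h : CorrectorData lam A M φ Φ σ) (i j : Fin d) :
    L2loc fun x => matVec (A x) (Φ i x + basisVec i) j :=
  h.elliptic.l2loc_flux (h.l2loc_grad i) j

theorem H1L.sum {ι : Type*} (s : Finset ι) {u : ι → E d → ℝ} {D : ι → Fin d → E d → ℝ}
    (hu : ∀ i, H1L (u i) (D i)) :
    H1L (fun x => ∑ i ∈ s, u i x) (fun j x => ∑ i ∈ s, D i j x) := by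
  classical
  induction s using Finset.induction_on with
  | empty =>
    simp only [Finset.sum_empty]
    refine ⟨continuous_const.l2loc, fun _ => continuous_const.l2loc, fun η _ i => by simp⟩
  | insert a s ha ih =>
    simp only [Finset.sum_insert ha]
    exact (hu a).add ih

theorem integrable_sq_mul {f η : E d → ℝ} (hf : L2loc f) (hη : IsTest η) :
    Integrable fun x => f x ^ 2 * η x :=
  (hf.integrable_mul_mul hf hη).congr (ae_of_all _ fun x => by ring)

theorem energy_arith {lam a b c e T P Q S : ℝ} (h1 : lam * Q ^ 2 ≤ T + a) (h2 : -(P * Q) ≤ b)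
    (h3 : 2 * (P * Q) ≤ lam / 2 * Q ^ 2 + 2 / lam * P ^ 2)
    (h4 : lam * 0 ≤ lam * (Q ^ 2 - S ^ 2 - 2 * c))
    (h5 : lam * (2 * e) ≤ lam * (S ^ 2 / 4 + 4 * P ^ 2)) :
    lam / 4 * S ^ 2 - (2 / lam + 4 * lam) * P ^ 2 ≤ T + (a + 2 * b) - lam * (c + 2 * e) := by
  have e1 : (2 / lam + 4 * lam) * P ^ 2 = 2 / lam * P ^ 2 + 4 * (lam * P ^ 2) := by ring
  rw [e1]
  linarith

/-- The homogenized quadratic form controls the localized energy of the corrector. -/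
theorem CorrectorData.energy_le (h : CorrectorData lam A M φ Φ σ) (hlam : 0 < lam) (ξ : E d)
    {η : E d → ℝ} (hη : IsTest η) :
    lam / 4 * ‖ξ‖ ^ 2 * ∫ x, η x ^ 2 ≤
      (∫ x, ∑ j, matVec (A x) (∑ i, ξ i • (Φ i x + basisVec i)) j * ξ j * η x ^ 2) +
        (2 / lam + 4 * lam) * ∫ x, (∑ i, ξ i * φ i x) ^ 2 * ‖pgrad η x‖ ^ 2 := by
  set u : E d → ℝ := fun x => ∑ i, ξ i * φ i x with hu
  set U : E d → E d := fun x => ∑ i, ξ i • Φ i x with hU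
  set Ψ : E d → E d := fun x => ∑ i, ξ i • (Φ i x + basisVec i) with hΨ
  have eΨ : ∀ x, Ψ x = U x + ξ := fun x => by
    simp only [hΨ, hU, smul_add, Finset.sum_add_distrib, sum_smul_basisVec]
  have uH : H1L u fun j x => U x j := by
    have := H1L.sum Finset.univ fun i => (h.phi i).const_mul (ξ i)
    simpa [hU] using this
  have l2Ψ : ∀ j, L2loc fun x => Ψ x j := fun j => by
    simp only [eΨ]
    exact (uH.grad j).add (continuous_const (y := ξ j)).l2loc
  set F : E d → E d := fun x => matVec (A x) (Ψ x) with hF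
  have l2F : ∀ j, L2loc fun x => F x j := h.elliptic.l2loc_flux l2Ψ
  have eF : ∀ x j, F x j = ∑ i, ξ i * matVec (A x) (Φ i x + basisVec i) j := fun x j => by
    simp only [hF, hΨ, matVec_sum, matVec_smul]
    simp [-smul_add]
  have heq : ∀ ζ, IsTest ζ → ∫ x, ∑ j, F x j * pderiv j ζ x = 0 := by
    intro ζ hζ
    have e : ∀ x, ∑ j, F x j * pderiv j ζ x =
        ∑ i, ξ i * ∑ j, matVec (A x) (Φ i x + basisVec i) j * pderiv j ζ x := by
      intro x
      simp only [eF, Finset.sum_mul, Finset.mul_sum]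
      rw [Finset.sum_comm]
      exact Finset.sum_congr rfl fun i _ => Finset.sum_congr rfl fun j _ => by ring
    simp only [e]
    rw [integral_finsetSum]
    · simp [integral_const_mul, h.corrector_eq _ ζ hζ]
    · exact fun i _ => (integrable_finsetSum _ fun j _ =>
        (h.l2loc_flux i j).locallyIntegrable.integrable_mul_test (hζ.pderiv j)).const_mul _
  have l20 : L2loc fun _ : E d => (0 : ℝ) := continuous_const.l2loc
  -- The corrector equation for Ψ = ∇u + ξ is tested with η²u.
  have key := test_extension (h := fun _ => 0) l20 l2F (fun η hη => by simpa using heq η hη)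
    (hη.mul hη) uH
  have keyi := integrable_test_extension (h := fun _ => 0) l20 l2F (hη.mul hη) uH.l2 uH.grad
  have hηη := hη.mul hη
  set I : E d → ℝ := fun x => η x ^ 2 * (∑ j, F x j * U x j) +
    2 * (u x * η x * ∑ j, F x j * pgrad η x j) with hI
  have eI : (fun x => (fun _ => (0 : ℝ)) x * (η x * η x * u x) +
      ∑ j, F x j * (η x * η x * U x j + u x * pderiv j (fun x => η x * η x) x)) = I := by
    ext x
    simp only [hI, zero_mul, zero_add, Finset.mul_sum, ← Finset.sum_add_distrib]
    refine Finset.sum_congr rfl fun j _ => ?_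
    rw [pderiv_mul hη.differentiable hη.differentiable, pgrad_apply]
    ring
  rw [eI] at key keyi
  have iq : Integrable fun x => u x ^ 2 * ‖pgrad η x‖ ^ 2 :=
    integrable_sq_mul uH.l2 (isTest_sum_pderiv_sq hη)
  have iη : Integrable fun x => η x ^ 2 := hηη.integrable.congr (ae_of_all _ fun x => by
    dsimp only; ring)
  have iFξ : Integrable fun x => ∑ j, F x j * ξ j * η x ^ 2 :=
    integrable_finsetSum _ fun j _ => ((((l2F j).locallyIntegrable.integrable_mul_test
      hηη).const_mul (ξ j)).congr (ae_of_all _ fun x => by ring))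
  have iΨξ : Integrable fun x => η x ^ 2 * (∑ j, U x j * ξ j) := by
    refine (integrable_finsetSum Finset.univ fun j _ => ((uH.grad j).locallyIntegrable.integrable_mul_test
      hηη).const_mul (ξ j)).congr (ae_of_all _ fun x => ?_)
    simp only [Finset.mul_sum]
    exact Finset.sum_congr rfl fun j _ => by ring
  have igξ : Integrable fun x => 2 * (u x * η x * ∑ j, pgrad η x j * ξ j) := by
    refine (integrable_finsetSum Finset.univ fun j _ => ((uH.l2.locallyIntegrable.integrable_mul_test
      (hη.mul (hη.pderiv j))).const_mul (2 * ξ j))).congr (ae_of_all _ fun x => ?_)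
    simp only [Finset.mul_sum, pgrad_apply]
    exact Finset.sum_congr rfl fun j _ => by ring
  -- the gradient of `u` has zero mean up to a boundary term
  have hmean : ∫ x, η x ^ 2 * (∑ j, U x j * ξ j) =
      - ∫ x, 2 * (u x * η x * ∑ j, pgrad η x j * ξ j) := by
    have e1 : ∫ x, η x ^ 2 * (∑ j, U x j * ξ j) = ∑ j, ξ j * ∫ x, U x j * (η x * η x) := by
      simp only [← integral_const_mul]
      rw [← integral_finsetSum _ fun j _ =>
        ((uH.grad j).locallyIntegrable.integrable_mul_test hηη).const_mul (ξ j)]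
      refine integral_congr_ae (ae_of_all _ fun x => ?_)
      simp only [Finset.mul_sum]
      exact Finset.sum_congr rfl fun j _ => by ring
    have e2 : ∫ x, 2 * (u x * η x * ∑ j, pgrad η x j * ξ j) =
        ∑ j, ξ j * ∫ x, u x * pderiv j (fun x => η x * η x) x := by
      simp only [← integral_const_mul]
      rw [← integral_finsetSum _ fun j _ =>
        (uH.l2.locallyIntegrable.integrable_mul_test (hηη.pderiv j)).const_mul (ξ j)]
      refine integral_congr_ae (ae_of_all _ fun x => ?_)
      simp only [Finset.mul_sum, pderiv_mul hη.differentiable hη.differentiable, pgrad_apply]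
      exact Finset.sum_congr rfl fun j _ => by ring
    rw [e1, e2, ← Finset.sum_neg_distrib]
    refine Finset.sum_congr rfl fun j _ => ?_
    rw [uH.weak _ hηη j]
    ring
  -- The last bracket has zero integral by `hmean` and is subtracted with weight lam. It trades half
  -- of the energy lam η²|Ψ|² for |ξ|² through |Ψ|² ≥ |ξ|² + 2 U·ξ; the other half absorbs the flux
  -- term with ∇η. Young's inequality for the ξ·∇η term costs a further lam/4 of |ξ|².
  have hpt : ∀ᵐ x, lam / 4 * ‖ξ‖ ^ 2 * η x ^ 2 - (2 / lam + 4 * lam) * (u x ^ 2 * ‖pgrad η x‖ ^ 2)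
      ≤ (∑ j, F x j * ξ j * η x ^ 2) + I x - lam * (η x ^ 2 * (∑ j, U x j * ξ j) +
        2 * (u x * η x * ∑ j, pgrad η x j * ξ j)) := by
    filter_upwards [h.elliptic.bounds] with x hx
    have b1 := (hx (Ψ x)).1
    have b2 := (hx (Ψ x)).2
    have b3 := abs_sum_mul_le_norm (F x) (pgrad η x)
    have b4 := abs_sum_mul_le_norm (pgrad η x) ξ
    have e1 : ∑ j, F x j * ξ j * η x ^ 2 + η x ^ 2 * ∑ j, F x j * U x j =
        η x ^ 2 * inner ℝ (Ψ x) (F x) := by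
      rw [inner_eq_sum, Finset.mul_sum, Finset.mul_sum, ← Finset.sum_add_distrib]
      refine Finset.sum_congr rfl fun j _ => ?_
      rw [eΨ, PiLp.add_apply]
      ring
    have e2 : ‖Ψ x‖ ^ 2 - ‖ξ‖ ^ 2 - 2 * ∑ j, U x j * ξ j = ‖U x‖ ^ 2 := by
      rw [eΨ, norm_add_sq_real, inner_eq_sum]
      ring
    have n1 : |u x * η x * ∑ j, F x j * pgrad η x j| ≤
        |u x| * ‖pgrad η x‖ * (|η x| * ‖Ψ x‖) := by
      rw [abs_mul, abs_mul]
      calc _ ≤ |u x| * |η x| * (‖Ψ x‖ * ‖pgrad η x‖) := by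
            gcongr
            exact b3.trans (by gcongr)
        _ = _ := by ring
    have n2 : |u x * η x * ∑ j, pgrad η x j * ξ j| ≤
        |u x| * ‖pgrad η x‖ * (|η x| * ‖ξ‖) := by
      rw [abs_mul, abs_mul]
      calc _ ≤ |u x| * |η x| * (‖pgrad η x‖ * ‖ξ‖) := by gcongr
        _ = _ := by ring
    have m1 := neg_abs_le (u x * η x * ∑ j, F x j * pgrad η x j)
    have m2 := le_abs_self (u x * η x * ∑ j, pgrad η x j * ξ j)
    set P := |u x| * ‖pgrad η x‖ with hP
    set Q := |η x| * ‖Ψ x‖ with hQ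
    set S := |η x| * ‖ξ‖ with hS
    have y1 : 2 * (P * Q) ≤ lam / 2 * Q ^ 2 + 2 / lam * P ^ 2 := by
      have : lam / 2 * Q ^ 2 + 2 / lam * P ^ 2 - 2 * (P * Q) = (lam * Q - 2 * P) ^ 2 / (2 * lam) := by
        field_simp; ring
      have h2 : 0 ≤ (lam * Q - 2 * P) ^ 2 / (2 * lam) := by positivity
      linarith
    have y2 : 2 * (P * S) ≤ S ^ 2 / 4 + 4 * P ^ 2 := by nlinarith [sq_nonneg (S / 2 - 2 * P)]
    have p2 : P ^ 2 = u x ^ 2 * ‖pgrad η x‖ ^ 2 := by rw [hP, mul_pow, sq_abs]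
    have q2 : Q ^ 2 = η x ^ 2 * ‖Ψ x‖ ^ 2 := by rw [hQ, mul_pow, sq_abs]
    have s2 : S ^ 2 = η x ^ 2 * ‖ξ‖ ^ 2 := by rw [hS, mul_pow, sq_abs]
    have c1 : η x ^ 2 * (lam * ‖Ψ x‖ ^ 2) ≤ η x ^ 2 * inner ℝ (Ψ x) (F x) :=
      mul_le_mul_of_nonneg_left b1 (sq_nonneg _)
    have c2 : Q ^ 2 - S ^ 2 - 2 * (η x ^ 2 * ∑ j, U x j * ξ j) ≥ 0 := by
      rw [q2, s2]
      have := mul_nonneg (sq_nonneg (η x)) (sq_nonneg ‖U x‖)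
      rw [← e2] at this
      linarith
    have c3 : lam * (2 * (u x * η x * ∑ j, pgrad η x j * ξ j)) ≤
        lam * (S ^ 2 / 4 + 4 * P ^ 2) :=
      mul_le_mul_of_nonneg_left (by linarith) hlam.le
    have c4 := mul_le_mul_of_nonneg_left (ge_iff_le.1 c2) hlam.le
    simp only [hI]
    rw [← p2]
    have g1 : lam / 4 * ‖ξ‖ ^ 2 * η x ^ 2 = lam / 4 * S ^ 2 := by rw [s2]; ring
    rw [g1]
    have c5 : lam * Q ^ 2 ≤ η x ^ 2 * inner ℝ (Ψ x) (F x) := by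
      rw [q2]; linarith
    rw [← e1] at c5
    exact energy_arith c5 (by linarith) y1 c4 c3
  have i1 : Integrable fun x => (∑ j, F x j * ξ j * η x ^ 2) + I x := iFξ.add keyi
  have i2 : Integrable fun x => η x ^ 2 * (∑ j, U x j * ξ j) +
      2 * (u x * η x * ∑ j, pgrad η x j * ξ j) := iΨξ.add igξ
  have i3 : Integrable fun x => lam / 4 * ‖ξ‖ ^ 2 * η x ^ 2 -
      (2 / lam + 4 * lam) * (u x ^ 2 * ‖pgrad η x‖ ^ 2) := (iη.const_mul _).sub (iq.const_mul _)
  have i4 : Integrable fun x => (∑ j, F x j * ξ j * η x ^ 2) + I x -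
      lam * (η x ^ 2 * (∑ j, U x j * ξ j) + 2 * (u x * η x * ∑ j, pgrad η x j * ξ j)) :=
    i1.sub (i2.const_mul lam)
  have hint := integral_mono_ae i3 i4 hpt
  rw [integral_sub (iη.const_mul _) (iq.const_mul _), integral_sub i1 (i2.const_mul lam),
    integral_const_mul, integral_const_mul, integral_const_mul,
    integral_add iFξ keyi, integral_add iΨξ igξ, key, hmean] at hint
  linarith

end

/-! ### Large-scale limit and ellipticity of the homogenized matrix. -/

section

variable {d : ℕ} {lam : ℝ} {A : E d → Matrix (Fin d) (Fin d) ℝ} {M : Matrix (Fin d) (Fin d) ℝ}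
  {φ : Fin d → E d → ℝ} {Φ : Fin d → E d → E d} {σ : Fin d → Fin d → Fin d → E d → ℝ}

theorem CorrectorData.integral_flux_mul (h : CorrectorData lam A M φ Φ σ) (i j : Fin d)
    {η : E d → ℝ} (hη : IsTest η) :
    ∫ x, matVec (A x) (Φ i x + basisVec i) j * η x =
      M j i * (∫ x, η x) - ∑ k, ∫ x, σ i j k x * pderiv k η x := by
  have h1 := h.div_sigma i j η hη
  have i1 := (h.l2loc_flux i j).locallyIntegrable.integrable_mul_test hη
  simp only [PiLp.sub_apply, matVec_basisVec, sub_mul] at h1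
  rw [integral_sub i1 (hη.integrable.const_mul _), integral_const_mul, integral_finsetSum _ fun k _ =>
    (h.sigma i j k).locallyIntegrable.integrable_mul_test (hη.pderiv k)] at h1
  linarith

theorem inner_matVec_eq_sum (M : Matrix (Fin d) (Fin d) ℝ) (ξ : E d) :
    inner ℝ ξ (matVec M ξ) = ∑ i, ∑ j, ξ i * ξ j * M j i := by
  rw [inner_eq_sum, Finset.sum_comm]
  refine Finset.sum_congr rfl fun j _ => ?_
  rw [matVec_apply, Finset.mul_sum]
  exact Finset.sum_congr rfl fun i _ => by ring

/-- Since the centred flux is the divergence of σ, integration by parts moves the derivative to η².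
Young's inequality with weight δ separates a multiple of ∫η² from the boundary term σ²|∇η|². On
large scales the latter vanishes for each δ, and δ → 0 is taken afterwards. -/
theorem CorrectorData.flux_le (h : CorrectorData lam A M φ Φ σ) (ξ : E d) {η : E d → ℝ}
    (hη : IsTest η) {δ : ℝ} (hδ : 0 < δ) :
    (∫ x, ∑ j, matVec (A x) (∑ i, ξ i • (Φ i x + basisVec i)) j * ξ j * η x ^ 2) ≤
      inner ℝ ξ (matVec M ξ) * (∫ x, η x ^ 2) +
      (δ * (∑ i, ∑ j, ∑ _k : Fin d, (ξ i * ξ j) ^ 2) * (∫ x, η x ^ 2) +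
        δ⁻¹ * ∑ i, ∑ j, ∑ k, ∫ x, σ i j k x ^ 2 * ‖pgrad η x‖ ^ 2) := by
  have hηη := hη.mul hη
  have esq : ∫ x, η x ^ 2 = ∫ x, η x * η x := by simp only [sq]
  have iη : Integrable fun x => η x ^ 2 := by simpa only [sq] using hηη.integrable
  have e1 : (∫ x, ∑ j, matVec (A x) (∑ i, ξ i • (Φ i x + basisVec i)) j * ξ j * η x ^ 2) =
      ∑ i, ∑ j, ξ i * ξ j * ∫ x, matVec (A x) (Φ i x + basisVec i) j * (η x * η x) := by
    simp only [← integral_const_mul]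
    have ii : ∀ i j, Integrable fun x =>
        ξ i * ξ j * (matVec (A x) (Φ i x + basisVec i) j * (η x * η x)) := fun i j =>
      ((h.l2loc_flux i j).locallyIntegrable.integrable_mul_test hηη).const_mul _
    simp only [← integral_finsetSum _ fun j _ => ii _ j]
    rw [← integral_finsetSum _ fun i _ => integrable_finsetSum _ fun j _ => ii i j]
    refine integral_congr_ae (ae_of_all _ fun x => ?_)
    dsimp only
    rw [Finset.sum_comm]
    refine Finset.sum_congr rfl fun j _ => ?_
    simp only [matVec_sum, matVec_smul]
    rw [WithLp.ofLp_sum, Finset.sum_apply, Finset.sum_mul, Finset.sum_mul]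
    refine Finset.sum_congr rfl fun i _ => ?_
    rw [PiLp.smul_apply, smul_eq_mul]
    ring
  rw [e1, inner_matVec_eq_sum, Finset.mul_sum, Finset.mul_sum, Finset.sum_mul, Finset.sum_mul,
    ← Finset.sum_add_distrib, ← Finset.sum_add_distrib]
  refine Finset.sum_le_sum fun i _ => ?_
  rw [Finset.mul_sum, Finset.mul_sum, Finset.sum_mul, Finset.sum_mul,
    ← Finset.sum_add_distrib, ← Finset.sum_add_distrib]
  refine Finset.sum_le_sum fun j _ => ?_
  rw [h.integral_flux_mul i j hηη, mul_sub, ← esq, sub_eq_add_neg]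
  refine add_le_add (le_of_eq (by ring)) ?_
  rw [Finset.mul_sum, Finset.mul_sum, Finset.sum_mul, Finset.mul_sum, ← Finset.sum_neg_distrib,
    ← Finset.sum_add_distrib]
  refine Finset.sum_le_sum fun k _ => ?_
  have is := integrable_sq_mul (h.sigma i j k) (isTest_sum_pderiv_sq hη)
  rw [← integral_const_mul, ← integral_neg, ← integral_const_mul, ← integral_const_mul,
    ← integral_add (iη.const_mul _) (is.const_mul _)]
  refine integral_mono (((h.sigma i j k).locallyIntegrable.integrable_mul_test
    (hηη.pderiv k)).const_mul _).neg ((iη.const_mul _).add (is.const_mul _)) fun x => ?_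
  dsimp only
  rw [pderiv_mul hη.differentiable hη.differentiable]
  have hk : pderiv k η x ^ 2 ≤ ‖pgrad η x‖ ^ 2 := by
    rw [sq_le_sq, abs_of_nonneg (norm_nonneg (pgrad η x))]
    exact abs_apply_le_norm (pgrad η x) k
  have h1 : δ⁻¹ * (σ i j k x ^ 2 * pderiv k η x ^ 2) ≤ δ⁻¹ * (σ i j k x ^ 2 * ‖pgrad η x‖ ^ 2) := by
    gcongr
  have h2 : 0 ≤ δ⁻¹ * (δ * (ξ i * ξ j * η x) + σ i j k x * pderiv k η x) ^ 2 := by positivity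
  have h3 : δ⁻¹ * (δ * (ξ i * ξ j * η x) + σ i j k x * pderiv k η x) ^ 2 =
      δ * (ξ i * ξ j) ^ 2 * η x ^ 2 + 2 * (ξ i * ξ j * η x * (σ i j k x * pderiv k η x)) +
        δ⁻¹ * (σ i j k x ^ 2 * pderiv k η x ^ 2) := by
    field_simp
    ring
  linarith

open scoped Pointwise in
theorem cube_eq_smul {R : ℝ} (hR : 0 < R) : cube (0 : E d) R = R • cube (0 : E d) 1 := by
  ext y
  rw [Set.mem_smul_set_iff_inv_smul_mem₀ hR.ne']
  simp only [cube, Set.mem_ofPred_eq, PiLp.zero_apply, sub_zero, PiLp.smul_apply, smul_eq_mul,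
    abs_mul, abs_of_pos (inv_pos.2 hR)]
  refine forall_congr' fun i => ?_
  rw [inv_mul_lt_iff₀ hR, mul_one_div]

theorem isOpen_cube (x : E d) (R : ℝ) : IsOpen (cube x R) := by
  have : cube x R = ⋂ i, {y : E d | |y i - x i| < R / 2} := by
    ext y; simp [cube]
  rw [this]
  exact isOpen_iInter_of_finite fun i => isOpen_lt (by fun_prop) continuous_const

theorem cube_subset_closedBall (x : E d) (R : ℝ) :
    cube x R ⊆ Metric.closedBall x (d * (R / 2)) := by
  intro y hy
  rw [mem_closedBall_iff_norm]
  refine (norm_le_sum_abs _).trans ?_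
  calc ∑ i, |(y - x) i| ≤ ∑ _i : Fin d, R / 2 := Finset.sum_le_sum fun i _ => (hy i).le
    _ = d * (R / 2) := by simp

theorem volume_real_cube_pos (d : ℕ) : 0 < (volume : Measure (E d)).real (cube 0 1) := by
  refine ENNReal.toReal_pos ?_ ?_
  · refine ((isOpen_cube 0 1).measure_pos volume ⟨0, fun i => ?_⟩).ne'
    simp
  · exact ((isCompact_closedBall _ _).measure_lt_top.trans_le' (measure_mono
      (cube_subset_closedBall 0 1))).ne

open scoped Pointwise in
theorem volume_real_cube {R : ℝ} (hR : 0 < R) : (volume : Measure (E d)).real (cube 0 R) =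
    R ^ d * (volume : Measure (E d)).real (cube 0 1) := by
  rw [cube_eq_smul hR, Measure.real, Measure.addHaar_smul, ENNReal.toReal_mul,
    ENNReal.toReal_ofReal (abs_nonneg _), finrank_euclideanSpace_fin, abs_of_pos (by positivity)]
  rfl

theorem L2loc.integrableOn_sq_cube {f : E d → ℝ} (hf : L2loc f) (R : ℝ) :
    IntegrableOn (fun x => f x ^ 2) (cube 0 R) :=
  ((hf _ (isCompact_closedBall 0 (d * (R / 2)))).integrable_sq).mono_measure
    (Measure.restrict_mono (cube_subset_closedBall 0 R) le_rfl)

theorem pgrad_comp_smul {η : E d → ℝ} (hη : Differentiable ℝ η) (c : ℝ) (x : E d) :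
    pgrad (fun y => η (c • y)) x = c • pgrad η (c • x) := by
  ext i
  simp [pderiv_comp_smul hη]

open scoped Pointwise in
/-- Sublinear functions have small boundary terms on large scales. -/
theorem Sublinear.tendsto_integral {f η : E d → ℝ} (hs : Sublinear f) (hf : L2loc f)
    (hη : IsTest η) (hsupp : tsupport η ⊆ cube 0 1) :
    Tendsto (fun R : ℝ => (R ^ d)⁻¹ * ∫ x, f x ^ 2 * ‖pgrad (fun y => η (R⁻¹ • y)) x‖ ^ 2)
      atTop (𝓝 0) := by
  obtain ⟨C, hC0, hC⟩ := (isTest_sum_pderiv_sq hη).bounded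
  set m := (volume : Measure (E d)).real (cube 0 1) with hm
  have hm0 : 0 < m := volume_real_cube_pos d
  have hlim := (Tendsto.const_mul (C * m) hs)
  rw [mul_zero] at hlim
  refine squeeze_zero' ?_ ?_ hlim
  · filter_upwards [eventually_gt_atTop 0] with R hR
    have : 0 ≤ ∫ x, f x ^ 2 * ‖pgrad (fun y => η (R⁻¹ • y)) x‖ ^ 2 :=
      integral_nonneg fun x => by positivity
    positivity
  · filter_upwards [eventually_gt_atTop 0] with R hR
    rw [setAverage_eq, volume_real_cube hR, ← hm, smul_eq_mul]
    -- The gradient of η(·/R) is supported in the cube of side R and has squared size C/R². Together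
    -- with the volume R^d m this is exactly the normalization in `Sublinear`.
    have hle : ∫ x, f x ^ 2 * ‖pgrad (fun y => η (R⁻¹ • y)) x‖ ^ 2 ≤
        (R ^ 2)⁻¹ * C * ∫ x in cube 0 R, f x ^ 2 := by
      have e : ∫ x, f x ^ 2 * ‖pgrad (fun y => η (R⁻¹ • y)) x‖ ^ 2 =
          ∫ x in cube 0 R, f x ^ 2 * ‖pgrad (fun y => η (R⁻¹ • y)) x‖ ^ 2 := by
        symm
        refine setIntegral_eq_integral_of_forall_compl_eq_zero fun x hx => ?_
        have hx' : R⁻¹ • x ∉ tsupport η := fun hm => hx (by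
          rw [cube_eq_smul hR, Set.mem_smul_set_iff_inv_smul_mem₀ hR.ne']
          exact hsupp hm)
        have : pgrad η (R⁻¹ • x) = 0 := by
          ext i
          exact pderiv_eq_zero_of_notMem hx' i
        rw [pgrad_comp_smul hη.differentiable, this]
        simp
      rw [e, ← integral_const_mul]
      have hint := hf.integrableOn_sq_cube R
      refine integral_mono_of_nonneg (ae_of_all _ fun x => by positivity) (hint.const_mul _)
        (ae_of_all _ fun x => ?_)
      dsimp only
      rw [pgrad_comp_smul hη.differentiable, norm_smul, mul_pow, norm_inv, inv_pow,
        Real.norm_eq_abs, sq_abs]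
      have := (le_abs_self _).trans (hC (R⁻¹ • x))
      calc f x ^ 2 * ((R ^ 2)⁻¹ * ‖pgrad η (R⁻¹ • x)‖ ^ 2) ≤ f x ^ 2 * ((R ^ 2)⁻¹ * C) := by gcongr
        _ = _ := by ring
    calc (R ^ d)⁻¹ * ∫ x, f x ^ 2 * ‖pgrad (fun y => η (R⁻¹ • y)) x‖ ^ 2
        ≤ (R ^ d)⁻¹ * ((R ^ 2)⁻¹ * C * ∫ x in cube 0 R, f x ^ 2) := by gcongr
      _ = _ := by field_simp

theorem le_of_forall_pos_le_add_mul {a b c : ℝ} (hc : 0 ≤ c) (h : ∀ δ, 0 < δ → a ≤ b + δ * c) :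
    a ≤ b := by
  refine le_of_forall_pos_le_add fun ε hε => ?_
  refine (h (ε / (c + 1)) (by positivity)).trans ?_
  have : ε / (c + 1) * c ≤ ε := by
    rw [div_mul_eq_mul_div, div_le_iff₀ (by positivity)]
    nlinarith
  linarith

/-- The homogenized matrix of a sublinear extended corrector is elliptic. -/
theorem CorrectorData.hom_elliptic (h : CorrectorData lam A M φ Φ σ) (hlam : 0 < lam)
    (hφ : ∀ i, Sublinear (φ i)) (hσ : ∀ i j k, Sublinear (σ i j k)) (ξ : E d) :
    lam / 4 * ‖ξ‖ ^ 2 ≤ inner ℝ ξ (matVec M ξ) := by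
  -- Outer radius 1/4 keeps the support strictly inside the cube of half-width 1/2; the value 1 at
  -- the origin makes ∫η² positive.
  obtain ⟨η, hη, hsupp, hη1⟩ : ∃ η : E d → ℝ, IsTest η ∧ tsupport η ⊆ cube 0 1 ∧ η 0 = 1 := by
    let b : ContDiffBump (0 : E d) := ⟨1 / 8, 1 / 4, by norm_num, by norm_num⟩
    refine ⟨b, isTest_bump b, ?_, b.one_of_mem_closedBall (by simp [b.rIn_pos.le])⟩
    rw [b.tsupport_eq]
    intro x hx i
    have h1 := abs_apply_le_norm x i
    have h2 : ‖x‖ ≤ 1 / 4 := mem_closedBall_zero_iff.1 hx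
    simp only [PiLp.zero_apply, sub_zero]
    linarith
  set J := ∫ x, η x ^ 2 with hJ
  have hJ0 : 0 < J := by
    have hc : Continuous fun x => η x ^ 2 := hη.continuous.pow 2
    refine hc.integral_pos_of_hasCompactSupport_nonneg_nonzero ?_ (fun x => sq_nonneg _)
      (x := 0) (by simp [hη1])
    exact hη.2.comp_left (g := fun t : ℝ => t ^ 2) (by simp)
  set B := ∑ i, ∑ j, ∑ _k : Fin d, (ξ i * ξ j) ^ 2 with hB
  have hB0 : 0 ≤ B := Finset.sum_nonneg fun i _ => Finset.sum_nonneg fun j _ =>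
    Finset.sum_nonneg fun k _ => sq_nonneg _
  set q : ℝ → (E d → ℝ) → ℝ := fun R f =>
    (R ^ d)⁻¹ * ∫ x, f x ^ 2 * ‖pgrad (fun y => η (R⁻¹ • y)) x‖ ^ 2 with hq
  -- The energy bound and the flux bound are combined for η(·/R), divided by R^d, and R tends to
  -- infinity with δ fixed.
  have step : ∀ δ : ℝ, 0 < δ → lam / 4 * ‖ξ‖ ^ 2 * J ≤ inner ℝ ξ (matVec M ξ) * J + δ * B * J := by
    intro δ hδ
    have hlim : Tendsto (fun R : ℝ => inner ℝ ξ (matVec M ξ) * J + (δ * B * J +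
        δ⁻¹ * ∑ i, ∑ j, ∑ k, q R (σ i j k)) +
        (2 / lam + 4 * lam) * (‖ξ‖ ^ 2 * ∑ i, q R (φ i))) atTop
        (𝓝 (inner ℝ ξ (matVec M ξ) * J + (δ * B * J +
        δ⁻¹ * ∑ _i : Fin d, ∑ _j : Fin d, ∑ _k : Fin d, 0) +
        (2 / lam + 4 * lam) * (‖ξ‖ ^ 2 * ∑ _i : Fin d, 0))) := by
      refine (tendsto_const_nhds.add (tendsto_const_nhds.add (Tendsto.const_mul _ ?_))).add
        ((Tendsto.const_mul _ ?_).const_mul _)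
      · exact tendsto_finsetSum _ fun i _ => tendsto_finsetSum _ fun j _ =>
          tendsto_finsetSum _ fun k _ => (hσ i j k).tendsto_integral (h.sigma i j k) hη hsupp
      · exact tendsto_finsetSum _ fun i _ => (hφ i).tendsto_integral (h.phi i).l2 hη hsupp
    simp only [Finset.sum_const_zero, mul_zero, add_zero] at hlim
    refine ge_of_tendsto hlim ?_
    filter_upwards [eventually_gt_atTop 0] with R hR
    have ht := hη.comp_smul (inv_ne_zero hR.ne')
    have hJR : ∫ x, η (R⁻¹ • x) ^ 2 = R ^ d * J := by
      rw [Measure.integral_comp_inv_smul_of_nonneg volume (fun x => η x ^ 2) hR.le,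
        finrank_euclideanSpace_fin, smul_eq_mul]
    have h1 := h.energy_le hlam ξ ht
    have h2 := h.flux_le ξ ht hδ
    have h3 : ∫ x, (∑ i, ξ i * φ i x) ^ 2 * ‖pgrad (fun y => η (R⁻¹ • y)) x‖ ^ 2 ≤
        ‖ξ‖ ^ 2 * ∑ i, ∫ x, φ i x ^ 2 * ‖pgrad (fun y => η (R⁻¹ • y)) x‖ ^ 2 := by
      have hi := fun i => integrable_sq_mul (h.phi i).l2 (isTest_sum_pderiv_sq ht)
      rw [← integral_finsetSum _ fun i _ => hi i, ← integral_const_mul]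
      refine integral_mono_of_nonneg (ae_of_all _ fun x => by positivity)
        ((integrable_finsetSum _ fun i _ => hi i).const_mul _) (ae_of_all _ fun x => ?_)
      dsimp only
      rw [← Finset.sum_mul, ← mul_assoc]
      refine mul_le_mul_of_nonneg_right ?_ (by positivity)
      rw [norm_sq_eq_sum]
      exact Finset.sum_mul_sq_le_sq_mul_sq _ _ _
    rw [hJR] at h1 h2
    have hRd : 0 < R ^ d := by positivity
    have hc0 : 0 ≤ 2 / lam + 4 * lam := by positivity
    have h4 := mul_le_mul_of_nonneg_left h3 hc0
    have h5 := h1.trans (add_le_add h2 h4)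
    have h6 := mul_le_mul_of_nonneg_left h5 (inv_pos.2 hRd).le
    have e1 : (R ^ d)⁻¹ * (lam / 4 * ‖ξ‖ ^ 2 * (R ^ d * J)) = lam / 4 * ‖ξ‖ ^ 2 * J := by
      field_simp
    rw [e1] at h6
    refine h6.trans (le_of_eq ?_)
    simp only [hq, ← Finset.mul_sum, ← hB]
    generalize (∑ i, ∑ j, ∑ k, ∫ x, σ i j k x ^ 2 * ‖pgrad (fun y => η (R⁻¹ • y)) x‖ ^ 2) = S₁
    generalize (∑ i, ∫ x, φ i x ^ 2 * ‖pgrad (fun y => η (R⁻¹ • y)) x‖ ^ 2) = S₂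
    generalize 2 / lam + 4 * lam = c
    field_simp
  have hle : lam / 4 * ‖ξ‖ ^ 2 * J ≤ inner ℝ ξ (matVec M ξ) * J := by
    refine le_of_forall_pos_le_add_mul (c := B * J) (mul_nonneg hB0 hJ0.le) fun δ hδ => ?_
    rw [← mul_assoc]
    exact step δ hδ
  exact le_of_mul_le_mul_right hle hJ0

end

/-! ### Vector fields by components, global test functions and Riesz representation. -/

section

variable {d : ℕ}

theorem aestronglyMeasurable_vec {G : E d → E d} {μ : Measure (E d)}
    (h : ∀ i, AEStronglyMeasurable (fun x => G x i) μ) : AEStronglyMeasurable G μ := by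
  have h1 : AEStronglyMeasurable (fun x => (G x).ofLp) μ :=
    (aemeasurable_pi_lambda _ fun i => (h i).aemeasurable).aestronglyMeasurable
  exact (PiLp.continuous_toLp 2 (fun _ : Fin d => ℝ)).comp_aestronglyMeasurable h1

theorem memLp_vec {G : E d → E d} (h : ∀ i, MemLp (fun x => G x i) 2 volume) :
    MemLp G 2 volume := by
  have h1 : MemLp (fun x => ∑ i, |G x i|) 2 volume := memLp_finsetSum _ fun i _ => (h i).abs
  refine h1.mono (aestronglyMeasurable_vec fun i => (h i).1) (ae_of_all _ fun x => ?_)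
  exact (norm_le_sum_abs _).trans (le_abs_self _)

theorem locallyIntegrable_vec {G : E d → E d}
    (h : ∀ i, LocallyIntegrable (fun x => G x i) volume) : LocallyIntegrable G volume := by
  rw [locallyIntegrable_iff]
  intro K hK
  have h1 : IntegrableOn (fun x => ∑ i, |G x i|) K :=
    integrable_finsetSum _ fun i _ => ((h i).integrableOn_isCompact hK).abs
  refine Integrable.mono h1 (aestronglyMeasurable_vec fun i =>
    ((h i).integrableOn_isCompact hK).1) (ae_of_all _ fun x => ?_)
  exact (norm_le_sum_abs _).trans (le_abs_self _)

theorem _root_.MeasureTheory.MemLp.apply_vec {G : E d → E d} {μ : Measure (E d)}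
    (h : MemLp G 2 μ) (i : Fin d) : MemLp (fun x => G x i) 2 μ := by
  refine h.mono ?_ (ae_of_all _ fun x => abs_apply_le_norm _ _)
  exact (EuclideanSpace.proj (𝕜 := ℝ) i).continuous.comp_aestronglyMeasurable h.1

theorem HasWeakGradient.weakGrad {u : E d → ℝ} {G : E d → E d} (h : HasWeakGradient u G) :
    WeakGrad u fun i x => G x i := h.integral_eq

theorem IsH1.h1L {u : E d → ℝ} {G : E d → E d} (h : IsH1 u G) : H1L u fun i x => G x i :=
  ⟨h.memLp.l2loc, fun i => (h.memLp_grad.apply_vec i).l2loc, h.weakGradient.weakGrad⟩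

theorem IsH1loc.h1L {u : E d → ℝ} {G : E d → E d} (h : IsH1loc u G) : H1L u fun i x => G x i :=
  ⟨h.memLp, fun i K hK => (h.memLp_grad K hK).apply_vec i, h.weakGradient.weakGrad⟩

theorem isH1_of_components {u : E d → ℝ} {G : E d → E d} (hu : MemLp u 2 volume)
    (hG : ∀ i, MemLp (fun x => G x i) 2 volume) (hw : WeakGrad u fun i x => G x i) : IsH1 u G :=
  ⟨⟨hu.locallyIntegrable (by norm_num), (memLp_vec hG).locallyIntegrable (by norm_num), hw⟩,
    hu, memLp_vec hG⟩

/-- Global version of `test_extension`. -/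
theorem test_extension_global {h : E d → ℝ} {F : Fin d → E d → ℝ} (hh : MemLp h 2 volume)
    (hF : ∀ j, MemLp (F j) 2 volume)
    (H : ∀ η, IsTest η → ∫ x, h x * η x + ∑ j, F j x * pderiv j η x = 0)
    {v : E d → ℝ} {D : Fin d → E d → ℝ} (hv : MemLp v 2 volume) (hD : ∀ j, MemLp (D j) 2 volume)
    (hw : WeakGrad v D) : ∫ x, h x * v x + ∑ j, F j x * D j x = 0 := by
  obtain ⟨η, hη, h1, h2⟩ := exists_test_seq hv hD hw
  have split : ∀ (w : E d → ℝ) (W : Fin d → E d → ℝ), MemLp w 2 volume →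
      (∀ j, MemLp (W j) 2 volume) → ∫ x, h x * w x + ∑ j, F j x * W j x =
      (∫ x, w x * h x) + ∑ j, ∫ x, W j x * F j x := by
    intro w W hw hW
    have i1 : Integrable fun x => w x * h x := hw.integrable_mul hh
    have i2 : ∀ j, Integrable fun x => W j x * F j x := fun j => (hW j).integrable_mul (hF j)
    rw [← integral_finsetSum _ fun j _ => i2 j, ← integral_add i1
      (integrable_finsetSum _ fun j _ => i2 j)]
    simp only [mul_comm]
  have lim : Tendsto (fun n => (∫ x, η n x * h x) + ∑ j, ∫ x, pderiv j (η n) x * F j x) atTop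
      (𝓝 ((∫ x, v x * h x) + ∑ j, ∫ x, D j x * F j x)) :=
    (tendsto_integral_mul (fun n => (hη n).memLp 2) hv hh h1).add (tendsto_finsetSum _ fun j _ =>
      tendsto_integral_mul (fun n => ((hη n).pderiv j).memLp 2) (hD j) (hF j) (h2 j))
  rw [split v D hv hD]
  refine tendsto_nhds_unique lim (tendsto_const_nhds.congr fun n => ?_)
  rw [← split _ _ ((hη n).memLp 2) (fun j => ((hη n).pderiv j).memLp 2), ← H _ (hη n)]

theorem sq_integral_mul_le {f g : E d → ℝ} (hf : MemLp f 2 volume) (hg : MemLp g 2 volume) :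
    (∫ x, f x * g x) ^ 2 ≤ (∫ x, f x ^ 2) * ∫ x, g x ^ 2 := by
  have e : ∀ {f g : E d → ℝ} (hf : MemLp f 2 volume) (hg : MemLp g 2 volume),
      inner ℝ (hf.toLp f) (hg.toLp g) = ∫ x, f x * g x := by
    intro f g hf hg
    rw [L2.inner_def]
    refine integral_congr_ae ?_
    filter_upwards [hf.coeFn_toLp, hg.coeFn_toLp] with x h1 h2
    rw [h1, h2]
    simp [mul_comm]
  have h := abs_real_inner_le_norm (hf.toLp f) (hg.toLp g)
  have h2 := pow_le_pow_left₀ (abs_nonneg _) h 2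
  rw [sq_abs, mul_pow, ← real_inner_self_eq_norm_sq, ← real_inner_self_eq_norm_sq, e, e, e] at h2
  simpa only [sq] using h2

/-- The bound makes l vanish on the kernel of ι, so l descends to a continuous functional on the
range of ι. Hahn-Banach extends it to H, where Riesz represents it; ι need be neither injective nor
of dense range. -/
theorem exists_inner_eq_of_bound {V H : Type*} [AddCommGroup V] [Module ℝ V]
    [NormedAddCommGroup H] [InnerProductSpace ℝ H] [CompleteSpace H] (ι : V →ₗ[ℝ] H)
    (l : V →ₗ[ℝ] ℝ) (C : ℝ) (h : ∀ v, |l v| ≤ C * ‖ι v‖) : ∃ y : H, ∀ v, l v = inner ℝ y (ι v) := by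
  have hker : LinearMap.ker ι ≤ LinearMap.ker l := by
    intro v hv
    rw [LinearMap.mem_ker] at hv ⊢
    have := h v
    rw [hv, norm_zero, mul_zero] at this
    exact abs_eq_zero.1 (le_antisymm this (abs_nonneg _))
  let f : LinearMap.range ι →ₗ[ℝ] ℝ := (LinearMap.ker ι).liftQ l hker ∘ₗ
    ι.quotKerEquivRange.symm.toLinearMap
  have hf : ∀ v, f ⟨ι v, LinearMap.mem_range_self ι v⟩ = l v := by
    intro v
    have : ι.quotKerEquivRange.symm ⟨ι v, LinearMap.mem_range_self ι v⟩ =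
        (LinearMap.ker ι).mkQ v := by
      rw [LinearEquiv.symm_apply_eq]
      rfl
    simp [f, this]
  let F : StrongDual ℝ (LinearMap.range ι) := f.mkContinuous C (by
    rintro ⟨_, v, rfl⟩
    rw [hf]
    exact h v)
  obtain ⟨g, hg, -⟩ := exists_extension_norm_eq (LinearMap.range ι) F
  refine ⟨(InnerProductSpace.toDual ℝ H).symm g, fun v => ?_⟩
  rw [InnerProductSpace.toDual_symm_apply]
  have := hg ⟨ι v, LinearMap.mem_range_self ι v⟩
  simp only [F, LinearMap.mkContinuous_apply, hf] at this
  exact this.symm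

/-- A distributional derivative that is bounded on `L²` is a square integrable function. -/
theorem exists_weak_pderiv {g : E d → ℝ} (hg : LocallyIntegrable g volume) (j : Fin d) {C : ℝ}
    (h : ∀ η, IsTest η → (∫ x, g x * pderiv j η x) ^ 2 ≤ C ^ 2 * ∫ x, η x ^ 2) (hC : 0 ≤ C) :
    ∃ D : E d → ℝ, MemLp D 2 volume ∧
      ∀ η, IsTest η → ∫ x, g x * pderiv j η x = - ∫ x, D x * η x := by
  -- Test functions carry no topology here: they are only a vector space, mapped to L² by ι, on
  -- which the distributional derivative is the functional l.
  let V : Submodule ℝ (E d → ℝ) :=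
    { carrier := {η | IsTest η}
      add_mem' := fun ha hb => IsTest.add ha hb
      zero_mem' := ⟨contDiff_const, HasCompactSupport.zero⟩
      smul_mem' := fun c _ h => IsTest.const_mul h c }
  have hV : ∀ v : V, IsTest (v : E d → ℝ) := fun v => v.2
  let ι : V →ₗ[ℝ] Lp ℝ 2 (volume : Measure (E d)) :=
    { toFun := fun v => ((hV v).memLp 2).toLp v
      map_add' := fun v w => MemLp.toLp_add ((hV v).memLp 2) ((hV w).memLp 2)
      map_smul' := fun c v => MemLp.toLp_const_smul c ((hV v).memLp 2) }
  let l : V →ₗ[ℝ] ℝ :=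
    { toFun := fun v => ∫ x, g x * pderiv j v x
      map_add' := fun v w => by
        rw [← integral_add (hg.integrable_mul_test ((hV v).pderiv j))
          (hg.integrable_mul_test ((hV w).pderiv j))]
        refine integral_congr_ae (ae_of_all _ fun x => ?_)
        simp only [pderiv, Submodule.coe_add]
        rw [fderiv_add ((hV v).differentiable x) ((hV w).differentiable x)]
        simp only [add_apply]
        ring
      map_smul' := fun c v => by
        rw [RingHom.id_apply, smul_eq_mul, ← integral_const_mul]
        refine integral_congr_ae (ae_of_all _ fun x => ?_)
        simp only [pderiv, Submodule.coe_smul]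
        rw [fderiv_const_smul ((hV v).differentiable x)]
        simp only [smul_apply, smul_eq_mul]
        ring }
  have e : ∀ {f g : E d → ℝ} (hf : MemLp f 2 volume) (hg : MemLp g 2 volume),
      inner ℝ (hf.toLp f) (hg.toLp g) = ∫ x, f x * g x := by
    intro f g hf hg
    rw [L2.inner_def]
    refine integral_congr_ae ?_
    filter_upwards [hf.coeFn_toLp, hg.coeFn_toLp] with x h1 h2
    rw [h1, h2]
    simp [mul_comm]
  obtain ⟨y, hy⟩ := exists_inner_eq_of_bound ι l C fun v => by
    refine abs_le_of_sq_le_sq ?_ (by positivity)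
    rw [mul_pow, ← real_inner_self_eq_norm_sq]
    refine (h v (hV v)).trans (le_of_eq ?_)
    congr 1
    exact (integral_congr_ae (ae_of_all _ fun x => sq _)).trans (e ((hV v).memLp 2)
      ((hV v).memLp 2)).symm
  refine ⟨fun x => - y x, (Lp.memLp y).neg, fun η hη => ?_⟩
  have h1 := hy ⟨η, hη⟩
  have h2 := e (Lp.memLp y) (hη.memLp 2)
  rw [Lp.toLp_coeFn] at h2
  simp only [neg_mul, integral_neg, neg_neg]
  exact h1.trans h2

end

/-! ### Difference quotients and second derivatives of the homogenized solution. -/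

section

variable {d : ℕ}

theorem _root_.MeasureTheory.MemLp.translate {f : E d → ℝ} (hf : MemLp f 2 volume) (z : E d) :
    MemLp (fun x => f (x + z)) 2 volume :=
  hf.comp_measurePreserving (measurePreserving_add_right volume z)

theorem pderiv_comp_add {η : E d → ℝ} (z : E d) (i : Fin d) (x : E d) :
    pderiv i (fun y => η (y + z)) x = pderiv i η (x + z) := by
  simp only [pderiv, fderiv_comp_add_right]

theorem IsTest.comp_add {η : E d → ℝ} (hη : IsTest η) (z : E d) : IsTest fun x => η (x + z) :=
  ⟨hη.1.comp (contDiff_id.add contDiff_const), hη.2.comp_homeomorph (Homeomorph.addRight z)⟩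

theorem integral_translate_mul (f g : E d → ℝ) (z : E d) :
    ∫ x, f (x + z) * g x = ∫ x, f x * g (x + -z) := by
  rw [← integral_add_right_eq_self (fun x => f x * g (x + -z)) z]
  simp

theorem WeakGrad.translate {u : E d → ℝ} {D : Fin d → E d → ℝ} (h : WeakGrad u D) (z : E d) :
    WeakGrad (fun x => u (x + z)) (fun i x => D i (x + z)) := by
  intro η hη i
  rw [integral_translate_mul, integral_translate_mul, ← h _ (hη.comp_add (-z)) i]
  simp only [pderiv_comp_add]

theorem WeakGrad.sub {u v : E d → ℝ} {D D' : Fin d → E d → ℝ} (h : WeakGrad u D)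
    (h' : WeakGrad v D') (hu : LocallyIntegrable u volume) (hv : LocallyIntegrable v volume)
    (hD : ∀ i, LocallyIntegrable (D i) volume) (hD' : ∀ i, LocallyIntegrable (D' i) volume) :
    WeakGrad (fun x => u x - v x) (fun i x => D i x - D' i x) := by
  intro η hη i
  simp only [sub_mul]
  rw [integral_sub (hu.integrable_mul_test (hη.pderiv i)) (hv.integrable_mul_test (hη.pderiv i)),
    integral_sub ((hD i).integrable_mul_test hη) ((hD' i).integrable_mul_test hη), h η hη i,
    h' η hη i]
  ring

/-- The increment is t times the average over s ∈ (0, 1) of the derivative at x + s t e_j. Jensen's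
inequality in s, Tonelli's theorem and translation invariance conclude. -/
theorem eLpNorm_translate_sub_le_of_isTest {η : E d → ℝ} (hη : IsTest η) (j : Fin d) (t : ℝ) :
    eLpNorm (fun x => η (x + t • basisVec j) - η x) 2 volume ≤
      ENNReal.ofReal |t| * eLpNorm (pderiv j η) 2 volume := by
  have hcj := (hη.pderiv j).continuous
  have hptw : ∀ x, ‖η (x + t • basisVec j) - η x‖ₑ ^ 2 ≤ ENNReal.ofReal |t| ^ 2 *
      ∫⁻ s in Set.Ioc (0 : ℝ) 1, ‖pderiv j η (x + (s * t) • basisVec j)‖ₑ ^ 2 := by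
    intro x
    have hline : ∀ s : ℝ, HasDerivAt (fun s : ℝ => η (x + (s * t) • basisVec j))
        (t * pderiv j η (x + (s * t) • basisVec j)) s := by
      intro s
      have h1 : HasDerivAt (fun s : ℝ => x + (s * t) • basisVec j) (t • (basisVec j : E d)) s := by
        have := (((hasDerivAt_id s).mul_const t).smul_const (basisVec j : E d)).const_add x
        simpa using this
      have h2 := (hη.differentiable (x + (s * t) • basisVec j)).hasFDerivAt.comp_hasDerivAt s h1
      rw [map_smul] at h2
      exact h2
    have hcs : Continuous fun s : ℝ => t * pderiv j η (x + (s * t) • basisVec j) :=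
      continuous_const.mul (hcj.comp (by fun_prop))
    have hftc := intervalIntegral.integral_eq_sub_of_hasDerivAt (a := 0) (b := 1)
      (fun s _ => hline s) (hcs.intervalIntegrable 0 1)
    simp only [one_mul, zero_mul, zero_smul, add_zero] at hftc
    rw [← hftc, intervalIntegral.integral_of_le zero_le_one, integral_const_mul, enorm_mul, mul_pow,
      ← ofReal_norm, Real.norm_eq_abs]
    gcongr
    set ν := (volume : Measure ℝ).restrict (Set.Ioc 0 1)
    have : IsProbabilityMeasure ν := ⟨by simp [ν]⟩
    have hF : AEStronglyMeasurable (fun s : ℝ => pderiv j η (x + (s * t) • basisVec j)) ν :=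
      (hcj.comp (by fun_prop)).aestronglyMeasurable
    have h1 := enorm_integral_le_lintegral_enorm (μ := ν)
      (fun s : ℝ => pderiv j η (x + (s * t) • basisVec j))
    rw [← eLpNorm_one_eq_lintegral_enorm] at h1
    have h2 := eLpNorm_le_eLpNorm_of_exponent_le (p := 1) (q := 2) (by norm_num) hF
    have h3 := eLpNorm_nnreal_pow_eq_lintegral
      (f := fun s : ℝ => pderiv j η (x + (s * t) • basisVec j)) (μ := ν) (p := 2) (by norm_num)
    simp only [NNReal.coe_ofNat, ENNReal.coe_ofNat, ENNReal.rpow_ofNat] at h3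
    rw [← h3]
    gcongr
    exact h1.trans h2
  refine (ENNReal.pow_right_strictMono two_ne_zero).le_iff_le.1 ?_
  rw [mul_pow, eLpNorm_two_sq]
  refine (lintegral_mono hptw).trans ?_
  rw [lintegral_const_mul' _ _ (by simp)]
  gcongr
  rw [lintegral_lintegral_swap]
  · calc ∫⁻ s in Set.Ioc (0 : ℝ) 1, ∫⁻ x, ‖pderiv j η (x + (s * t) • basisVec j)‖ₑ ^ 2
        = ∫⁻ s in Set.Ioc (0 : ℝ) 1, eLpNorm (pderiv j η) 2 volume ^ 2 := by
          refine lintegral_congr fun s => ?_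
          rw [lintegral_add_right_eq_self (fun x => ‖pderiv j η x‖ₑ ^ 2), eLpNorm_two_sq]
      _ ≤ _ := by simp
  · have : Continuous fun p : E d × ℝ => pderiv j η (p.1 + (p.2 * t) • basisVec j) :=
      hcj.comp (by fun_prop)
    exact (this.measurable.enorm.pow_const 2).aemeasurable

/-- Density of test functions in H¹ transfers the smooth case, translation being an isometry of L².
-/
theorem eLpNorm_translate_sub_le {w : E d → ℝ} {D : Fin d → E d → ℝ} (hw : MemLp w 2 volume)
    (hD : ∀ i, MemLp (D i) 2 volume) (hW : WeakGrad w D) (j : Fin d) (t : ℝ) :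
    eLpNorm (fun x => w (x + t • basisVec j) - w x) 2 volume ≤
      ENNReal.ofReal |t| * eLpNorm (D j) 2 volume := by
  obtain ⟨η, hη, h1, h2⟩ := exists_test_seq hw hD hW
  have lim : Tendsto (fun n => eLpNorm (fun x => η n x - w x) 2 volume + (ENNReal.ofReal |t| *
      (eLpNorm (fun x => pderiv j (η n) x - D j x) 2 volume + eLpNorm (D j) 2 volume) +
        eLpNorm (fun x => η n x - w x) 2 volume)) atTop
      (𝓝 (0 + (ENNReal.ofReal |t| * (0 + eLpNorm (D j) 2 volume) + 0))) :=
    h1.add ((ENNReal.Tendsto.const_mul ((h2 j).add tendsto_const_nhds)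
      (Or.inr ENNReal.ofReal_ne_top)).add h1)
  simp only [zero_add, add_zero] at lim
  refine ge_of_tendsto' lim fun n => ?_
  set z : E d := t • basisVec j
  have m1 : MemLp (fun x => η n x - w x) 2 volume := ((hη n).memLp 2).sub hw
  have m2 : MemLp (fun x => η n (x + z) - η n x) 2 volume :=
    (((hη n).memLp 2).translate z).sub ((hη n).memLp 2)
  have e : (fun x => w (x + z) - w x) = (-fun x => (η n (x + z) - w (x + z))) +
      ((fun x => η n (x + z) - η n x) + fun x => η n x - w x) := by
    ext x
    simp only [Pi.add_apply, Pi.neg_apply]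
    ring
  have e1 : eLpNorm (-fun x => (η n (x + z) - w (x + z))) 2 volume =
      eLpNorm (fun x => η n x - w x) 2 volume := by
    have h3 := eLpNorm_neg (fun x => η n (x + z) - w (x + z)) 2 (volume : Measure (E d))
    have h4 := eLpNorm_comp_measurePreserving (p := 2) m1.1
      (measurePreserving_add_right (volume : Measure (E d)) z)
    exact h3.trans h4
  have e2 : eLpNorm (pderiv j (η n)) 2 volume ≤
      eLpNorm (fun x => pderiv j (η n) x - D j x) 2 volume + eLpNorm (D j) 2 volume := by
    have h3 := eLpNorm_add_le (((hη n).pderiv j).memLp 2 |>.sub (hD j)).1 (hD j).1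
      (p := 2) (by norm_num)
    have h5 : (pderiv j (η n)) = (pderiv j (η n) - D j) + D j := by
      ext x; simp
    calc eLpNorm (pderiv j (η n)) 2 volume = eLpNorm ((pderiv j (η n) - D j) + D j) 2 volume := by
          rw [← h5]
      _ ≤ _ := h3
  rw [e]
  refine (eLpNorm_add_le (m1.translate z).neg.1 (m2.add m1).1 (by norm_num)).trans ?_
  rw [e1]
  gcongr
  refine (eLpNorm_add_le m2.1 m1.1 (by norm_num)).trans ?_
  gcongr
  refine (eLpNorm_translate_sub_le_of_isTest (hη n) j t).trans ?_
  gcongr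

theorem integral_sq_eq_toReal {f : E d → ℝ} (hf : MemLp f 2 volume) :
    ∫ x, f x ^ 2 = (eLpNorm f 2 volume ^ 2).toReal := by
  rw [eLpNorm_two_sq, integral_eq_lintegral_of_nonneg_ae (ae_of_all _ fun x => sq_nonneg _)
    (hf.1.pow 2)]
  simp only [enorm_sq_eq_ofReal]

theorem integral_translate_sub_sq_le {w : E d → ℝ} {D : Fin d → E d → ℝ} (hw : MemLp w 2 volume)
    (hD : ∀ i, MemLp (D i) 2 volume) (hW : WeakGrad w D) (j : Fin d) (t : ℝ) :
    ∫ x, (w (x + t • basisVec j) - w x) ^ 2 ≤ t ^ 2 * ∫ x, D j x ^ 2 := by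
  have h := pow_le_pow_left₀ zero_le (eLpNorm_translate_sub_le hw hD hW j t) 2
  rw [integral_sq_eq_toReal (f := fun x => w (x + t • basisVec j) - w x)
    ((hw.translate _).sub hw), integral_sq_eq_toReal (hD j)]
  have h2 := ENNReal.toReal_mono (by
    rw [mul_pow]
    exact ENNReal.mul_ne_top (by simp) (ENNReal.pow_ne_top (hD j).2.ne)) h
  have e : (ENNReal.ofReal |t| ^ 2).toReal = t ^ 2 := by
    rw [ENNReal.toReal_pow, ENNReal.toReal_ofReal (abs_nonneg _), sq_abs]
  rwa [mul_pow, ENNReal.toReal_mul, e] at h2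

theorem memLp_matVec_const (M : Matrix (Fin d) (Fin d) ℝ) {G : E d → E d}
    (hG : ∀ i, MemLp (fun x => G x i) 2 volume) (j : Fin d) :
    MemLp (fun x => matVec M (G x) j) 2 volume := by
  simp only [matVec_apply]
  exact memLp_finsetSum _ fun k _ => (hG k).const_mul _

/-- Energy estimate for difference quotients of a constant coefficient equation. -/
theorem diffQuotient_energy {M : Matrix (Fin d) (Fin d) ℝ} {c : ℝ} (hc : 0 < c)
    (hM : ∀ ξ : E d, c * ‖ξ‖ ^ 2 ≤ inner ℝ ξ (matVec M ξ)) {α : ℝ} (hα : 0 < α) {f u : E d → ℝ}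
    (hf : MemLp f 2 volume) {Du : E d → E d} (h : IsWeakSolution (fun _ => M) α f u Du)
    (i j : Fin d) {t : ℝ} (ht : t ≠ 0) :
    ∫ x, (Du (x + t • basisVec j) i - Du x i) ^ 2 ≤ t ^ 2 * (c⁻¹ ^ 2 * ∫ x, f x ^ 2) := by
  set z : E d := t • basisVec j with hz
  have hu := h.isH1.memLp
  have hDu := fun i => h.isH1.memLp_grad.apply_vec i
  set v : E d → ℝ := fun x => u (x + z) - u x with hv
  set V : E d → E d := fun x => Du (x + z) - Du x with hV
  have mv : MemLp v 2 volume := (hu.translate z).sub hu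
  have mV : ∀ i, MemLp (fun x => V x i) 2 volume := fun i => ((hDu i).translate z).sub (hDu i)
  have loc : ∀ {g : E d → ℝ}, MemLp g 2 volume → LocallyIntegrable g volume :=
    fun hg => hg.locallyIntegrable (by norm_num)
  have wV : WeakGrad v fun i x => V x i :=
    (h.isH1.weakGradient.weakGrad.translate z).sub h.isH1.weakGradient.weakGrad
      (loc (hu.translate z)) (loc hu) (fun i => loc ((hDu i).translate z)) fun i => loc (hDu i)
  have mMV := memLp_matVec_const M mV
  have mg : MemLp (fun x => f (x + z) - f x) 2 volume := (hf.translate z).sub hf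
  have heq : ∀ η, IsTest η → ∫ x, (α * v x - (f (x + z) - f x)) * η x +
      ∑ k, matVec M (V x) k * pderiv k η x = 0 := by
    intro η hη
    have ii : ∀ {g ζ : E d → ℝ}, MemLp g 2 volume → IsTest ζ → Integrable fun x => g x * ζ x :=
      fun hg hζ => (loc hg).integrable_mul_test hζ
    have e1 := h.integral_eq η hη
    have e2 := h.integral_eq _ (hη.comp_add (-z))
    simp only [pderiv_comp_add] at e2
    rw [← integral_translate_mul, ← integral_translate_mul,
      ← integral_add_right_eq_self (fun x => ∑ j, matVec M (Du x) j * pderiv j η (x + -z)) z] at e2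
    simp only [add_neg_cancel_right] at e2
    have mM := memLp_matVec_const M hDu
    have i1 : Integrable fun x => ∑ k, matVec M (Du x) k * pderiv k η x :=
      integrable_finsetSum _ fun k _ => ii (mM k) (hη.pderiv k)
    have i2 : Integrable fun x => ∑ k, matVec M (Du (x + z)) k * pderiv k η x :=
      integrable_finsetSum _ fun k _ => ii ((mM k).translate z) (hη.pderiv k)
    have i3 := ii hu hη
    have i4 := ii (hu.translate z) hη
    have i5 := ii hf hη
    have i6 := ii (hf.translate z) hη
    have e3 : (fun x => (α * v x - (f (x + z) - f x)) * η x +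
        ∑ k, matVec M (V x) k * pderiv k η x) = fun x =>
        (α * (u (x + z) * η x) + (∑ k, matVec M (Du (x + z)) k * pderiv k η x) - f (x + z) * η x) -
        (α * (u x * η x) + (∑ k, matVec M (Du x) k * pderiv k η x) - f x * η x) := by
      ext x
      have : ∑ k, matVec M (V x) k * pderiv k η x =
          (∑ k, matVec M (Du (x + z)) k * pderiv k η x) -
            ∑ k, matVec M (Du x) k * pderiv k η x := by
        rw [← Finset.sum_sub_distrib]
        refine Finset.sum_congr rfl fun k _ => ?_
        simp only [hV, matVec_sub, PiLp.sub_apply, sub_mul]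
      rw [this]
      simp only [hv]
      ring
    rw [e3]
    have i7 : Integrable fun x => α * (u (x + z) * η x) +
      ∑ k, matVec M (Du (x + z)) k * pderiv k η x := (i4.const_mul α).add i2
    have i8 : Integrable fun x => α * (u x * η x) +
      ∑ k, matVec M (Du x) k * pderiv k η x := (i3.const_mul α).add i1
    have i9 : Integrable fun x => α * (u (x + z) * η x) +
      (∑ k, matVec M (Du (x + z)) k * pderiv k η x) - f (x + z) * η x := i7.sub i6
    have i10 : Integrable fun x => α * (u x * η x) +
      (∑ k, matVec M (Du x) k * pderiv k η x) - f x * η x := i8.sub i5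
    rw [integral_sub i9 i10, integral_sub i7 i6, integral_sub i8 i5,
      integral_add (i4.const_mul α) i2, integral_add (i3.const_mul α) i1,
      integral_const_mul, integral_const_mul]
    linarith
  -- The translation difference v of u solves the same equation with datum f(· + z) - f, and is used
  -- as its own test function.
  have key := test_extension_global (h := fun x => α * v x - (f (x + z) - f x))
    ((mv.const_mul α).sub mg) mMV heq mv mV wV
  have ivv : Integrable fun x => v x ^ 2 := mv.integrable_sq
  have igv : Integrable fun x => (f (x + z) - f x) * v x := mg.integrable_mul mv
  have iMV : Integrable fun x => ∑ k, matVec M (V x) k * V x k :=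
    integrable_finsetSum _ fun k _ => (mMV k).integrable_mul (mV k)
  have iV : ∀ k, Integrable fun x => V x k ^ 2 := fun k => (mV k).integrable_sq
  have iVV : Integrable fun x => ‖V x‖ ^ 2 := by
    simp only [norm_sq_eq_sum]
    exact integrable_finsetSum _ fun k _ => iV k
  have key2 : α * (∫ x, v x ^ 2) + (∫ x, ∑ k, matVec M (V x) k * V x k) =
      ∫ x, (f (x + z) - f x) * v x := by
    have e : (fun x => (α * v x - (f (x + z) - f x)) * v x + ∑ k, matVec M (V x) k * V x k) =
        fun x => (α * v x ^ 2 + ∑ k, matVec M (V x) k * V x k) - (f (x + z) - f x) * v x := by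
      ext x; ring
    have i1 : Integrable fun x => α * v x ^ 2 + ∑ k, matVec M (V x) k * V x k :=
      (ivv.const_mul α).add iMV
    rw [e, integral_sub i1 igv, integral_add (ivv.const_mul α) iMV, integral_const_mul] at key
    linarith
  have hell : c * (∫ x, ‖V x‖ ^ 2) ≤ ∫ x, ∑ k, matVec M (V x) k * V x k := by
    rw [← integral_const_mul]
    refine integral_mono (iVV.const_mul c) iMV fun x => ?_
    have := hM (V x)
    rw [inner_eq_sum] at this
    simpa only [mul_comm] using this
  have hright : ∫ x, (f (x + z) - f x) * v x = ∫ x, f x * (v (x + -z) - v x) := by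
    simp only [sub_mul, mul_sub]
    have i1 : Integrable fun x => f (x + z) * v x := (hf.translate z).integrable_mul mv
    have i2 : Integrable fun x => f x * v x := hf.integrable_mul mv
    have i3 : Integrable fun x => f x * v (x + -z) := hf.integrable_mul (mv.translate (-z))
    rw [integral_sub i1 i2, integral_sub i3 i2, integral_translate_mul]
  -- In `hright` the difference has been moved from f, which has no regularity, to v. The weight
  -- c/(2t²) is chosen so that the L² bound t‖∂_j v‖ on the increment of v turns the second term
  -- into half of the elliptic energy.
  have hyoung : ∫ x, f x * (v (x + -z) - v x) ≤
      t ^ 2 / (2 * c) * (∫ x, f x ^ 2) + c / (2 * t ^ 2) * ∫ x, (v (x + -z) - v x) ^ 2 := by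
    have mw : MemLp (fun x => v (x + -z) - v x) 2 volume := (mv.translate (-z)).sub mv
    have i0 : Integrable fun x => f x * (v (x + -z) - v x) := hf.integrable_mul mw
    have i1 : Integrable fun x => f x ^ 2 := hf.integrable_sq
    have i2 : Integrable fun x => (v (x + -z) - v x) ^ 2 := mw.integrable_sq
    rw [← integral_const_mul, ← integral_const_mul,
      ← integral_add (i1.const_mul _) (i2.const_mul _)]
    refine integral_mono i0 ((i1.const_mul _).add (i2.const_mul _)) fun x => ?_
    dsimp only
    have : t ^ 2 / (2 * c) * f x ^ 2 + c / (2 * t ^ 2) * (v (x + -z) - v x) ^ 2 -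
        f x * (v (x + -z) - v x) = (t ^ 2 * f x - c * (v (x + -z) - v x)) ^ 2 / (2 * c * t ^ 2) := by
      field_simp
      ring
    have h2 : 0 ≤ (t ^ 2 * f x - c * (v (x + -z) - v x)) ^ 2 / (2 * c * t ^ 2) := by positivity
    linarith
  have htr : ∫ x, (v (x + -z) - v x) ^ 2 ≤ t ^ 2 * ∫ x, V x j ^ 2 := by
    have := integral_translate_sub_sq_le mv mV wV j (-t)
    rw [neg_smul, neg_sq] at this
    exact this
  have hcomp : ∀ k, ∫ x, V x k ^ 2 ≤ ∫ x, ‖V x‖ ^ 2 := fun k => by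
    refine integral_mono (iV k) iVV fun x => ?_
    dsimp only
    rw [sq_le_sq, abs_of_nonneg (norm_nonneg (V x))]
    exact abs_apply_le_norm _ _
  have hv0 : 0 ≤ α * ∫ x, v x ^ 2 :=
    mul_nonneg hα.le (integral_nonneg fun x => sq_nonneg _)
  have h1 : c / (2 * t ^ 2) * ∫ x, (v (x + -z) - v x) ^ 2 ≤ c / 2 * ∫ x, ‖V x‖ ^ 2 := by
    calc _ ≤ c / (2 * t ^ 2) * (t ^ 2 * ∫ x, ‖V x‖ ^ 2) := by
          gcongr
          exact htr.trans (mul_le_mul_of_nonneg_left (hcomp j) (sq_nonneg t))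
      _ = _ := by field_simp
  have h2 : c / 2 * (∫ x, ‖V x‖ ^ 2) ≤ t ^ 2 / (2 * c) * ∫ x, f x ^ 2 := by
    linarith
  have h3 : (∫ x, ‖V x‖ ^ 2) ≤ t ^ 2 * (c⁻¹ ^ 2 * ∫ x, f x ^ 2) := by
    have := mul_le_mul_of_nonneg_left h2 (by positivity : 0 ≤ 2 / c)
    have e1 : 2 / c * (c / 2 * (∫ x, ‖V x‖ ^ 2)) = ∫ x, ‖V x‖ ^ 2 := by field_simp
    have e2 : 2 / c * (t ^ 2 / (2 * c) * ∫ x, f x ^ 2) = t ^ 2 * (c⁻¹ ^ 2 * ∫ x, f x ^ 2) := by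
      field_simp
    rwa [e1, e2] at this
  exact (hcomp i).trans h3

/-- The integral is the value at t e_j of the convolution of g with the reflected η, which is smooth
even though g is not. -/
theorem hasDerivAt_integral_mul_translate {g η : E d → ℝ} (hg : LocallyIntegrable g volume)
    (hη : IsTest η) (j : Fin d) :
    HasDerivAt (fun t : ℝ => ∫ x, g x * η (x + -(t • basisVec j)))
      (- ∫ x, g x * pderiv j η x) 0 := by
  set ρ : E d → ℝ := fun y => η (0 - y) with hρd
  have hρ : IsTest ρ := hη.comp_sub 0
  have h1 := hasFDerivAt_mollify hρ hg (0 : E d)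
  have h2 : HasDerivAt (fun t : ℝ => t • (basisVec j : E d)) (basisVec j) 0 := by
    simpa using (hasDerivAt_id (0 : ℝ)).smul_const (basisVec j : E d)
  have h0 : (0 : ℝ) • (basisVec j : E d) = 0 := zero_smul _ _
  rw [← h0] at h1
  have h3 := h1.comp_hasDerivAt (0 : ℝ) h2
  rw [← h1.fderiv] at h3
  have h4 : fderiv ℝ (mollify ρ g) ((0 : ℝ) • (basisVec j : E d)) (basisVec j) =
      - ∫ x, g x * pderiv j η x := by
    rw [h0]
    have := pderiv_mollify_eq hρ hg j 0
    rw [pderiv] at this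
    rw [this, mollify_eq_swap, ← integral_neg]
    refine integral_congr_ae (ae_of_all _ fun y => ?_)
    simp only [hρd, pderiv_comp_sub hη.differentiable]
    simp [mul_comm]
  rw [h4] at h3
  refine h3.congr_of_eventuallyEq (Eventually.of_forall fun t => ?_)
  simp only [Function.comp]
  rw [mollify_eq_swap]
  refine integral_congr_ae (ae_of_all _ fun y => ?_)
  simp only [hρd]
  rw [mul_comm]
  congr 2
  abel

/-- Interior `H²` regularity on the whole space for a constant coefficient equation. -/
theorem exists_second_derivatives {M : Matrix (Fin d) (Fin d) ℝ} {c : ℝ} (hc : 0 < c)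
    (hM : ∀ ξ : E d, c * ‖ξ‖ ^ 2 ≤ inner ℝ ξ (matVec M ξ)) {α : ℝ} (hα : 0 < α) {f u : E d → ℝ}
    (hf : MemLp f 2 volume) {Du : E d → E d} (h : IsWeakSolution (fun _ => M) α f u Du) :
    ∃ D2u : Fin d → E d → E d, ∀ i, IsH1 (fun x => Du x i) (D2u i) := by
  have hDu := fun i => h.isH1.memLp_grad.apply_vec i
  have loc : ∀ {g : E d → ℝ}, MemLp g 2 volume → LocallyIntegrable g volume :=
    fun hg => hg.locallyIntegrable (by norm_num)
  set C : ℝ := Real.sqrt (c⁻¹ ^ 2 * ∫ x, f x ^ 2) with hC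
  have hC2 : C ^ 2 = c⁻¹ ^ 2 * ∫ x, f x ^ 2 :=
    Real.sq_sqrt (mul_nonneg (sq_nonneg _) (integral_nonneg fun x => sq_nonneg _))
  -- The pairing with ∂_j η is minus the limit of pairings of difference quotients of ∂_i u with η.
  -- Their uniform L² bound and Cauchy-Schwarz survive the limit.
  have bound : ∀ i j η, IsTest η →
      (∫ x, Du x i * pderiv j η x) ^ 2 ≤ C ^ 2 * ∫ x, η x ^ 2 := by
    intro i j η hη
    have hder := (hasDerivAt_integral_mul_translate (loc (hDu i)) hη j).tendsto_slope_zero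
    have hsq := hder.pow 2
    rw [neg_sq] at hsq
    refine le_of_tendsto hsq ?_
    filter_upwards [self_mem_nhdsWithin] with t ht
    have ht0 : t ≠ 0 := ht
    simp only [zero_add, zero_smul, neg_zero, add_zero, smul_eq_mul]
    have i1 : Integrable fun x => Du x i * η (x + -(t • basisVec j)) :=
      (loc (hDu i)).integrable_mul_test (hη.comp_add _)
    have i2 : Integrable fun x => Du x i * η x := (loc (hDu i)).integrable_mul_test hη
    have i3 : Integrable fun x => Du (x + t • basisVec j) i * η x :=
      (loc ((hDu i).translate _)).integrable_mul_test hη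
    have e : (∫ x, Du x i * η (x + -(t • basisVec j))) - ∫ x, Du x i * η x =
        ∫ x, (Du (x + t • basisVec j) i - Du x i) * η x := by
      rw [← integral_translate_mul (fun x => Du x i) η]
      simp only [sub_mul]
      rw [integral_sub i3 i2]
    rw [e, mul_pow, inv_pow, inv_mul_le_iff₀ (by positivity)]
    refine (sq_integral_mul_le (((hDu i).translate _).sub (hDu i)) (hη.memLp 2)).trans ?_
    rw [hC2, ← mul_assoc]
    exact mul_le_mul_of_nonneg_right (diffQuotient_energy hc hM hα hf h i j ht0)
      (integral_nonneg fun x => sq_nonneg _)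
  choose D hD1 hD2 using fun i j =>
    exists_weak_pderiv (loc (hDu i)) j (bound i j) (Real.sqrt_nonneg _)
  exact ⟨fun i x => WithLp.toLp 2 fun j => D i j x, fun i =>
    isH1_of_components (hDu i) (fun j => hD1 i j) fun η hη j => hD2 i j η hη⟩

end

/-! ### The equation of the remainder. -/

section

variable {d : ℕ} {lam : ℝ} {A : E d → Matrix (Fin d) (Fin d) ℝ} {M : Matrix (Fin d) (Fin d) ℝ}
  {φ : Fin d → E d → ℝ} {Φ : Fin d → E d → E d} {σ : Fin d → Fin d → Fin d → E d → ℝ}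

theorem pderiv_comm {η : E d → ℝ} (hη : IsTest η) (j k : Fin d) (x : E d) :
    pderiv k (pderiv j η) x = pderiv j (pderiv k η) x := by
  have hd : DifferentiableAt ℝ (fderiv ℝ η) x :=
    ((show ContDiff ℝ (⊤ : ℕ∞) (fderiv ℝ η) from hη.1.fderiv_right (by simp)).differentiable
      (by simp)) x
  have e : ∀ j k : Fin d, pderiv k (pderiv j η) x =
      fderiv ℝ (fderiv ℝ η) x (basisVec k) (basisVec j) := by
    intro j k
    change fderiv ℝ (fun x => fderiv ℝ η x (basisVec j)) x (basisVec k) = _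
    rw [fderiv_clm_apply hd (differentiableAt_const _)]
    simp
  have hs : IsSymmSndFDerivAt ℝ η x := hη.1.contDiffAt.isSymmSndFDerivAt (by
    rw [minSmoothness_of_isRCLikeNormedField]
    exact WithTop.coe_le_coe.2 le_top)
  rw [e, e]
  exact hs _ _

/-- Exchanging the two indices changes the sign of the sum. -/
theorem sum_skew_mul_eq_zero {s : Fin d → Fin d → ℝ} {t : Fin d → Fin d → ℝ}
    (hs : ∀ j k, s k j = - s j k) (ht : ∀ j k, t k j = t j k) :
    ∑ j, ∑ k, s j k * t j k = 0 := by
  have h : ∑ j, ∑ k, s j k * t j k = - ∑ j, ∑ k, s j k * t j k := by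
    calc ∑ j, ∑ k, s j k * t j k = ∑ k, ∑ j, s j k * t j k := Finset.sum_comm
      _ = ∑ k, ∑ j, - (s k j * t k j) := by
        refine Finset.sum_congr rfl fun k _ => Finset.sum_congr rfl fun j _ => ?_
        rw [hs k j, ht k j, neg_mul]
      _ = _ := by simp only [Finset.sum_neg_distrib]
  linarith

/-- The flux corrector turns `g_i q_i` into a term without the gradient of the corrector. -/
theorem CorrectorData.integral_flux_corrector (h : CorrectorData lam A M φ Φ σ) (i : Fin d)
    {g : E d → ℝ} {G : E d → E d} (hg : H1L g fun k x => G x k) {η : E d → ℝ} (hη : IsTest η) :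
    ∑ j, ∫ x, ((matVec (A x) (Φ i x + basisVec i) j - M j i) * g x +
      ∑ k, σ i j k x * G x k) * pderiv j η x = 0 := by
  have l2q : ∀ j, L2loc fun x => matVec (A x) (Φ i x + basisVec i) j - M j i := fun j =>
    (h.l2loc_flux i j).sub continuous_const.l2loc
  have hdiv : ∀ j ζ, IsTest ζ → ∫ x, (matVec (A x) (Φ i x + basisVec i) j - M j i) * ζ x +
      ∑ k, σ i j k x * pderiv k ζ x = 0 := by
    intro j ζ hζ
    have h1 := h.div_sigma i j ζ hζ
    simp only [PiLp.sub_apply, matVec_basisVec] at h1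
    rw [integral_add ((l2q j).locallyIntegrable.integrable_mul_test hζ)
      (integrable_finsetSum _ fun k _ =>
        (h.sigma i j k).locallyIntegrable.integrable_mul_test (hζ.pderiv k)), ← h1]
    ring
  -- For each j the identity q_{ij} = Σ_k ∂_k σ_{ijk} is tested with g ∂_j η. After summation over j
  -- the only second-order terms are σ_{ijk} g ∂_k∂_j η, which cancel by skew symmetry of σ_i.
  have key := fun j => test_extension (l2q j) (h.sigma i j) (hdiv j) (hη.pderiv j) hg
  have keyi := fun j => integrable_test_extension (l2q j) (h.sigma i j) (hη.pderiv j) hg.l2 hg.grad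
  have i1 : ∀ j, Integrable fun x => ((matVec (A x) (Φ i x + basisVec i) j - M j i) * g x +
      ∑ k, σ i j k x * G x k) * pderiv j η x := by
    intro j
    have i2 := (l2q j).integrable_mul_mul hg.l2 (hη.pderiv j)
    have i3 := fun k => (h.sigma i j k).integrable_mul_mul (hg.grad k) (hη.pderiv j)
    refine (i2.add (integrable_finsetSum Finset.univ fun k _ => i3 k)).congr (ae_of_all _ fun x => ?_)
    simp only [Pi.add_apply, add_mul, Finset.sum_mul]
  have hsum : ∑ j, ∫ x, ((matVec (A x) (Φ i x + basisVec i) j - M j i) * (pderiv j η x * g x) +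
      ∑ k, σ i j k x * (pderiv j η x * G x k + g x * pderiv k (pderiv j η) x)) = 0 :=
    Finset.sum_eq_zero fun j _ => key j
  rw [← hsum, ← integral_finsetSum _ fun j _ => i1 j, ← integral_finsetSum _ fun j _ => keyi j]
  refine integral_congr_ae ?_
  have hskew : ∀ᵐ x, ∀ j k, σ i k j x = - σ i j k x :=
    ae_all_iff.2 fun j => ae_all_iff.2 fun k => h.skew i j k
  filter_upwards [hskew] with x hx
  have hz := sum_skew_mul_eq_zero (s := fun j k => σ i j k x)
    (t := fun j k => g x * pderiv k (pderiv j η) x) hx fun j k => by rw [pderiv_comm hη]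
  have e : ∀ j, (matVec (A x) (Φ i x + basisVec i) j - M j i) * (pderiv j η x * g x) +
      ∑ k, σ i j k x * (pderiv j η x * G x k + g x * pderiv k (pderiv j η) x) =
      ((matVec (A x) (Φ i x + basisVec i) j - M j i) * g x +
      ∑ k, σ i j k x * G x k) * pderiv j η x + ∑ k, σ i j k x * (g x * pderiv k (pderiv j η) x) := by
    intro j
    simp only [mul_add, Finset.sum_add_distrib, add_mul, Finset.sum_mul]
    rw [add_assoc]
    congr 1
    · ring
    · congr 1
      exact Finset.sum_congr rfl fun k _ => by ring
  simp only [e]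
  rw [Finset.sum_add_distrib, hz, add_zero]

theorem locallyIntegrable_sum {ι : Type*} (s : Finset ι) {f : ι → E d → ℝ}
    (hf : ∀ i, LocallyIntegrable (f i) volume) :
    LocallyIntegrable (fun x => ∑ i ∈ s, f i x) volume := by
  rw [locallyIntegrable_iff]
  exact fun K hK => integrable_finsetSum _ fun i _ => (hf i).integrableOn_isCompact hK

/-- Weak formulation for the remainder of the two-scale expansion, before integration by parts
of the terms of zeroth order. -/
theorem CorrectorData.remainder_eq (h : CorrectorData lam A M φ Φ σ) {α : ℝ} {f u u0 : E d → ℝ}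
    {Du Du0 : E d → E d} {D2 : Fin d → E d → E d}
    (h0 : IsWeakSolution (fun _ => M) α f u0 Du0) (hD2 : ∀ i, IsH1 (fun x => Du0 x i) (D2 i))
    (hu : IsWeakSolution A α f u Du) {η : E d → ℝ} (hη : IsTest η) :
    ∫ x, α * (u x - u0 x) * η x + ∑ j, (matVec (A x) (Du x) j -
      (∑ i, Du0 x i * matVec (A x) (Φ i x + basisVec i) j) -
        ∑ i, ∑ k, σ i j k x * D2 i x k) * pderiv j η x = 0 := by
  have hg := fun i => (hD2 i).h1L
  have uL := hu.isH1.h1L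
  have u0L := h0.isH1.h1L
  have i1 := uL.l2.locallyIntegrable.integrable_mul_test hη
  have i2 := u0L.l2.locallyIntegrable.integrable_mul_test hη
  have i3 : Integrable fun x => ∑ j, matVec (A x) (Du x) j * pderiv j η x :=
    integrable_finsetSum _ fun j _ =>
      (h.elliptic.l2loc_flux uL.grad j).locallyIntegrable.integrable_mul_test (hη.pderiv j)
  have l2M : ∀ j, L2loc fun x => matVec M (Du0 x) j := fun j => by
    simp only [matVec_apply]
    exact L2loc.sum _ fun k => (u0L.grad k).const_mul _
  have i4 : Integrable fun x => ∑ j, matVec M (Du0 x) j * pderiv j η x :=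
    integrable_finsetSum _ fun j _ => (l2M j).locallyIntegrable.integrable_mul_test (hη.pderiv j)
  have l2q : ∀ i j, L2loc fun x => matVec (A x) (Φ i x + basisVec i) j - M j i := fun i j =>
    (h.l2loc_flux i j).sub continuous_const.l2loc
  have i5 : ∀ i j, Integrable fun x => ((matVec (A x) (Φ i x + basisVec i) j - M j i) * Du0 x i +
      ∑ k, σ i j k x * D2 i x k) * pderiv j η x := fun i j =>
    (((l2q i j).locallyIntegrable_mul (hg i).l2).add (locallyIntegrable_sum _ fun k =>
      (h.sigma i j k).locallyIntegrable_mul ((hg i).grad k))).integrable_mul_test (hη.pderiv j)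
  have e1 := hu.integral_eq η hη
  have e2 := h0.integral_eq η hη
  have e3 : ∫ x, ∑ i, ∑ j, ((matVec (A x) (Φ i x + basisVec i) j - M j i) * Du0 x i +
      ∑ k, σ i j k x * D2 i x k) * pderiv j η x = 0 := by
    rw [integral_finsetSum _ fun i _ => integrable_finsetSum _ fun j _ => i5 i j]
    refine Finset.sum_eq_zero fun i _ => ?_
    rw [integral_finsetSum _ fun j _ => i5 i j]
    exact h.integral_flux_corrector i (hg i) hη
  have i6 : Integrable fun x => ∑ i, ∑ j,
      ((matVec (A x) (Φ i x + basisVec i) j - M j i) * Du0 x i +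
      ∑ k, σ i j k x * D2 i x k) * pderiv j η x :=
    integrable_finsetSum _ fun i _ => integrable_finsetSum _ fun j _ => i5 i j
  have i7 : Integrable fun x => α * (u x * η x) + ∑ j, matVec (A x) (Du x) j * pderiv j η x :=
    (i1.const_mul α).add i3
  have i8 : Integrable fun x => α * (u0 x * η x) + ∑ j, matVec M (Du0 x) j * pderiv j η x :=
    (i2.const_mul α).add i4
  have i9 : Integrable fun x => (α * (u x * η x) + ∑ j, matVec (A x) (Du x) j * pderiv j η x) -
      (α * (u0 x * η x) + ∑ j, matVec M (Du0 x) j * pderiv j η x) := i7.sub i8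
  -- The equation of u minus that of u0 leaves a∇u - a_hom∇u0. Subtracting the flux identities with
  -- g = ∂_i u0 replaces a_hom∇u0 by Σ ∂_i u0 a(∇φ_i + e_i) plus terms in σ.
  have e4 : (fun x => α * (u x - u0 x) * η x + ∑ j, (matVec (A x) (Du x) j -
      (∑ i, Du0 x i * matVec (A x) (Φ i x + basisVec i) j) -
        ∑ i, ∑ k, σ i j k x * D2 i x k) * pderiv j η x) =
      fun x => (α * (u x * η x) + ∑ j, matVec (A x) (Du x) j * pderiv j η x) -
      (α * (u0 x * η x) + ∑ j, matVec M (Du0 x) j * pderiv j η x) -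
      ∑ i, ∑ j, ((matVec (A x) (Φ i x + basisVec i) j - M j i) * Du0 x i +
      ∑ k, σ i j k x * D2 i x k) * pderiv j η x := by
    ext x
    have : ∑ j, (matVec (A x) (Du x) j -
      (∑ i, Du0 x i * matVec (A x) (Φ i x + basisVec i) j) -
        ∑ i, ∑ k, σ i j k x * D2 i x k) * pderiv j η x =
        (∑ j, matVec (A x) (Du x) j * pderiv j η x) - (∑ j, matVec M (Du0 x) j * pderiv j η x) -
        ∑ i, ∑ j, ((matVec (A x) (Φ i x + basisVec i) j - M j i) * Du0 x i +
      ∑ k, σ i j k x * D2 i x k) * pderiv j η x := by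
      rw [Finset.sum_comm (f := fun i j => ((matVec (A x) (Φ i x + basisVec i) j - M j i) * Du0 x i +
        ∑ k, σ i j k x * D2 i x k) * pderiv j η x), ← Finset.sum_sub_distrib,
        ← Finset.sum_sub_distrib]
      refine Finset.sum_congr rfl fun j _ => ?_
      rw [matVec_apply M, ← Finset.sum_mul, ← sub_mul, ← sub_mul, Finset.sum_add_distrib]
      congr 1
      have : ∑ i, (matVec (A x) (Φ i x + basisVec i) j - M j i) * Du0 x i =
          (∑ i, Du0 x i * matVec (A x) (Φ i x + basisVec i) j) - ∑ i, M j i * Du0 x i := by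
        rw [← Finset.sum_sub_distrib]
        exact Finset.sum_congr rfl fun i _ => by ring
      rw [this]
      ring
    rw [this]
    ring
  rw [e4, integral_sub i9 i6, integral_sub i7 i8, integral_add (i1.const_mul α) i3,
    integral_add (i2.const_mul α) i4, integral_const_mul, integral_const_mul, e1, e2, e3]
  simp

theorem matVec_norm_sq_le (B : Matrix (Fin d) (Fin d) ℝ) (ξ : E d) :
    ‖matVec B ξ‖ ^ 2 ≤ (∑ j, ∑ k, B j k ^ 2) * ‖ξ‖ ^ 2 := by
  rw [norm_sq_eq_sum, norm_sq_eq_sum, Finset.sum_mul]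
  refine Finset.sum_le_sum fun j _ => ?_
  rw [matVec_apply]
  exact Finset.sum_mul_sq_le_sq_mul_sq _ _ _

theorem norm_sum_smul_sq_le (c : Fin d → ℝ) (v : Fin d → E d) :
    ‖∑ i, c i • v i‖ ^ 2 ≤ (∑ i, c i ^ 2) * ∑ i, ‖v i‖ ^ 2 := by
  calc ‖∑ i, c i • v i‖ ^ 2 ≤ (∑ i, |c i| * ‖v i‖) ^ 2 := by
        gcongr
        refine (norm_sum_le _ _).trans (le_of_eq ?_)
        simp [norm_smul]
    _ ≤ (∑ i, |c i| ^ 2) * ∑ i, ‖v i‖ ^ 2 := Finset.sum_mul_sq_le_sq_mul_sq _ _ _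
    _ = _ := by simp only [sq_abs]

/-- The right-hand side of the equation for the remainder. -/
def remainderFlux (A : E d → Matrix (Fin d) (Fin d) ℝ) (φ : Fin d → E d → ℝ)
    (σ : Fin d → Fin d → Fin d → E d → ℝ) (D2 : Fin d → E d → E d) (x : E d) : E d :=
  WithLp.toLp 2 (fun j => ∑ i, ∑ k, σ i j k x * D2 i x k) -
    ∑ i, φ i x • matVec (A x) (D2 i x)

/-- Cauchy-Schwarz in the summation indices for each of the two parts; the factor 2 comes from ‖v -
w‖² ≤ 2‖v‖² + 2‖w‖². -/
theorem remainderFlux_norm_sq_le (A : E d → Matrix (Fin d) (Fin d) ℝ) (φ : Fin d → E d → ℝ)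
    (σ : Fin d → Fin d → Fin d → E d → ℝ) (D2 : Fin d → E d → E d) (x : E d) :
    ‖remainderFlux A φ σ D2 x‖ ^ 2 ≤ 2 * (((∑ i, ∑ j, ∑ k, σ i j k x ^ 2) +
      (∑ j, ∑ k, A x j k ^ 2) * ∑ i, φ i x ^ 2) * ∑ i, ‖D2 i x‖ ^ 2) := by
  set v : E d := WithLp.toLp 2 (fun j => ∑ i, ∑ k, σ i j k x * D2 i x k) with hv
  set w : E d := ∑ i, φ i x • matVec (A x) (D2 i x) with hw
  have h1 : ‖v‖ ^ 2 ≤ (∑ i, ∑ j, ∑ k, σ i j k x ^ 2) * ∑ i, ‖D2 i x‖ ^ 2 := by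
    rw [norm_sq_eq_sum, Finset.sum_comm, Finset.sum_mul]
    refine Finset.sum_le_sum fun j _ => ?_
    have := Finset.sum_mul_sq_le_sq_mul_sq (Finset.univ : Finset (Fin d × Fin d))
      (fun p => σ p.1 j p.2 x) (fun p => D2 p.1 x p.2)
    simpa only [Fintype.sum_prod_type, ← norm_sq_eq_sum] using this
  have h2 : ‖w‖ ^ 2 ≤ (∑ j, ∑ k, A x j k ^ 2) * (∑ i, φ i x ^ 2) * ∑ i, ‖D2 i x‖ ^ 2 := by
    refine (norm_sum_smul_sq_le _ _).trans ?_
    have h3 : ∑ i, ‖matVec (A x) (D2 i x)‖ ^ 2 ≤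
        (∑ j, ∑ k, A x j k ^ 2) * ∑ i, ‖D2 i x‖ ^ 2 := by
      rw [Finset.mul_sum]
      exact Finset.sum_le_sum fun i _ => matVec_norm_sq_le _ _
    calc _ ≤ (∑ i, φ i x ^ 2) * ((∑ j, ∑ k, A x j k ^ 2) * ∑ i, ‖D2 i x‖ ^ 2) := by
          refine mul_le_mul_of_nonneg_left h3 (Finset.sum_nonneg fun i _ => sq_nonneg _)
      _ = _ := by ring
  have h4 : ‖v - w‖ ^ 2 ≤ 2 * ‖v‖ ^ 2 + 2 * ‖w‖ ^ 2 := by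
    have := parallelogram_law_with_norm ℝ v w
    nlinarith [norm_nonneg (v + w)]
  have h5 : ‖remainderFlux A φ σ D2 x‖ ^ 2 = ‖v - w‖ ^ 2 := rfl
  rw [h5]
  nlinarith

end

/-! ### Gradient of the remainder and the energy estimate on the whole space. -/

section

variable {d : ℕ} {lam : ℝ} {A : E d → Matrix (Fin d) (Fin d) ℝ} {M : Matrix (Fin d) (Fin d) ℝ}
  {φ : Fin d → E d → ℝ} {Φ : Fin d → E d → E d} {σ : Fin d → Fin d → Fin d → E d → ℝ}

theorem WeakGrad.sum {ι : Type*} (s : Finset ι) {u : ι → E d → ℝ} {D : ι → Fin d → E d → ℝ}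
    (h : ∀ i, WeakGrad (u i) (D i)) (hu : ∀ i, LocallyIntegrable (u i) volume)
    (hD : ∀ i j, LocallyIntegrable (D i j) volume) :
    WeakGrad (fun x => ∑ i ∈ s, u i x) (fun j x => ∑ i ∈ s, D i j x) := by
  intro η hη j
  simp only [Finset.sum_mul]
  rw [integral_finsetSum _ fun i _ => (hu i).integrable_mul_test (hη.pderiv j),
    integral_finsetSum _ fun i _ => (hD i j).integrable_mul_test hη, ← Finset.sum_neg_distrib]
  exact Finset.sum_congr rfl fun i _ => h i η hη j

/-- The gradient of the remainder. -/
def remainderGrad (φ : Fin d → E d → ℝ) (Φ : Fin d → E d → E d) (Du Du0 : E d → E d)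
    (D2 : Fin d → E d → E d) (x : E d) : E d :=
  Du x - Du0 x - ∑ i, (φ i x • D2 i x + Du0 x i • Φ i x)

theorem remainderGrad_apply (φ : Fin d → E d → ℝ) (Φ : Fin d → E d → E d) (Du Du0 : E d → E d)
    (D2 : Fin d → E d → E d) (x : E d) (j : Fin d) : remainderGrad φ Φ Du Du0 D2 x j =
      Du x j - Du0 x j - ∑ i, (φ i x * D2 i x j + Du0 x i * Φ i x j) := by
  simp [remainderGrad]

/-- The product rule in H¹_loc already gives weak differentiability, whether or not the right-hand
side of the estimate is finite; the gradient is then only locally integrable. -/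
theorem CorrectorData.hasWeakGradient_remainder (h : CorrectorData lam A M φ Φ σ)
    {u u0 : E d → ℝ} {Du Du0 : E d → E d} {D2 : Fin d → E d → E d} (h0 : IsH1 u0 Du0)
    (hD2 : ∀ i, IsH1 (fun x => Du0 x i) (D2 i)) (hu : IsH1 u Du) :
    HasWeakGradient (fun x => u x - (u0 x + ∑ i, φ i x * Du0 x i))
      (remainderGrad φ Φ Du Du0 D2) := by
  have hg := fun i => (hD2 i).h1L
  have uL := hu.h1L
  have u0L := h0.h1L
  have l1 : ∀ i, LocallyIntegrable (fun x => φ i x * Du0 x i) volume := fun i =>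
    (h.phi i).l2.locallyIntegrable_mul (hg i).l2
  have l2 : ∀ i j, LocallyIntegrable (fun x => φ i x * D2 i x j + Du0 x i * Φ i x j) volume :=
    fun i j => ((h.phi i).l2.locallyIntegrable_mul ((hg i).grad j)).add
      ((hg i).l2.locallyIntegrable_mul ((h.phi i).grad j))
  have l3 := locallyIntegrable_sum Finset.univ l1
  have l4 := fun j => locallyIntegrable_sum Finset.univ fun i => l2 i j
  have w1 := WeakGrad.sum Finset.univ (fun i => (h.phi i).weakGrad_mul (hg i)) l1 l2
  have l5 : LocallyIntegrable (fun x => u x - u0 x) volume :=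
    uL.l2.locallyIntegrable.sub u0L.l2.locallyIntegrable
  have l6 : ∀ j, LocallyIntegrable (fun x => Du x j - Du0 x j) volume := fun j =>
    (uL.grad j).locallyIntegrable.sub (u0L.grad j).locallyIntegrable
  have w2 := (uL.weak.sub u0L.weak uL.l2.locallyIntegrable u0L.l2.locallyIntegrable
    (fun j => (uL.grad j).locallyIntegrable) fun j => (u0L.grad j).locallyIntegrable).sub w1
    l5 l3 l6 l4
  simp only [sub_sub] at w2
  refine ⟨?_, locallyIntegrable_vec fun j => ?_, ?_⟩
  · simp only [← sub_sub]
    exact l5.sub l3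
  · simp only [remainderGrad_apply]
    exact (l6 j).sub (l4 j)
  · intro η hη j
    have h1 := w2 η hη j
    simp only [← sub_sub, ← remainderGrad_apply] at h1 ⊢
    exact h1

/-- The integrand for the test function χ²Z, with v, h, ξ the sizes of ∇Z, H and ∇χ. The H·∇Z term
and the flux-cut-off term each absorb lam/4 of the energy, leaving lam/2; H·∇χ adds the summands 1
to the constants. The p-term is absorbed by completing the square (z + p)². -/
theorem remainder_energy_arith {α z p χ a b c e v h ξ : ℝ} (hlam : 0 < lam) (hα : 0 < α)
    (ha : lam * v ^ 2 ≤ a) (hb : |b| ≤ h * v) (hc : |c| ≤ v * ξ) (he : |e| ≤ h * ξ) :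
    χ ^ 2 * (α / 2 * z ^ 2 + lam / 2 * v ^ 2) -
        χ ^ 2 * (α / 2 * p ^ 2 + (1 / lam + 1) * h ^ 2) - (4 / lam + 1) * (z ^ 2 * ξ ^ 2) ≤
      α * (z + p) * (χ ^ 2 * z) + χ ^ 2 * (a - b) + 2 * (χ * z * (c - e)) := by
  have t0 : χ ^ 2 * (α / 2 * z ^ 2) - χ ^ 2 * (α / 2 * p ^ 2) ≤ α * (z + p) * (χ ^ 2 * z) := by
    have : α * (z + p) * (χ ^ 2 * z) - (χ ^ 2 * (α / 2 * z ^ 2) - χ ^ 2 * (α / 2 * p ^ 2)) =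
        α / 2 * (χ * (z + p)) ^ 2 := by ring
    have h2 : 0 ≤ α / 2 * (χ * (z + p)) ^ 2 := by positivity
    linarith
  have t1 : χ ^ 2 * b ≤ χ ^ 2 * (lam / 4 * v ^ 2 + 1 / lam * h ^ 2) := by
    refine mul_le_mul_of_nonneg_left ?_ (sq_nonneg χ)
    have : lam / 4 * v ^ 2 + 1 / lam * h ^ 2 - h * v = (lam * v - 2 * h) ^ 2 / (4 * lam) := by
      field_simp; ring
    have h2 : 0 ≤ (lam * v - 2 * h) ^ 2 / (4 * lam) := by positivity
    linarith [le_abs_self b]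
  have t2 : -(2 * (χ * z * c)) ≤ χ ^ 2 * (lam / 4 * v ^ 2) + 4 / lam * (z ^ 2 * ξ ^ 2) := by
    have h1 : |χ * z * c| ≤ |χ * z| * (v * ξ) := by
      rw [abs_mul]; gcongr
    have h3 : χ ^ 2 * (lam / 4 * v ^ 2) + 4 / lam * (z ^ 2 * ξ ^ 2) - 2 * (|χ * z| * (v * ξ)) =
        (lam * (|χ| * v) - 4 * (|z| * ξ)) ^ 2 / (4 * lam) := by
      rw [abs_mul, ← sq_abs χ, ← sq_abs z]
      field_simp; ring
    have h2 : 0 ≤ (lam * (|χ| * v) - 4 * (|z| * ξ)) ^ 2 / (4 * lam) := by positivity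
    linarith [neg_abs_le (χ * z * c)]
  have t3 : 2 * (χ * z * e) ≤ χ ^ 2 * h ^ 2 + z ^ 2 * ξ ^ 2 := by
    have h1 : |χ * z * e| ≤ |χ * z| * (h * ξ) := by
      rw [abs_mul]; gcongr
    have h3 : χ ^ 2 * h ^ 2 + z ^ 2 * ξ ^ 2 - 2 * (|χ * z| * (h * ξ)) =
        (|χ| * h - |z| * ξ) ^ 2 := by
      rw [abs_mul, ← sq_abs χ, ← sq_abs z]
      ring
    have h2 := sq_nonneg (|χ| * h - |z| * ξ)
    linarith [le_abs_self (χ * z * e)]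
  have t4 : χ ^ 2 * (lam * v ^ 2) ≤ χ ^ 2 * a := mul_le_mul_of_nonneg_left ha (sq_nonneg χ)
  have e1 : (1 / lam + 1) * h ^ 2 = 1 / lam * h ^ 2 + h ^ 2 := by ring
  have e2 : (4 / lam + 1) * (z ^ 2 * ξ ^ 2) = 4 / lam * (z ^ 2 * ξ ^ 2) + z ^ 2 * ξ ^ 2 := by ring
  rw [e1, e2]
  linarith

/-- Energy estimate on the whole space for a locally finite energy solution. -/
theorem lintegral_energy_le (hlam : 0 < lam) (hA : Elliptic lam A) {α : ℝ} (hα : 0 < α)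
    {Z p : E d → ℝ} {DZ H : E d → E d} (hZ : MemLp Z 2 volume) (hp : MemLp p 2 volume)
    (hZL : H1L Z fun j x => DZ x j) (hH : ∀ j, MemLp (fun x => H x j) 2 volume)
    (heq : ∀ η, IsTest η → ∫ x, α * (Z x + p x) * η x +
      ∑ j, (matVec (A x) (DZ x) j - H x j) * pderiv j η x = 0) :
    ∫⁻ x, ENNReal.ofReal (α * Z x ^ 2 + lam * ‖DZ x‖ ^ 2) ≤
      ENNReal.ofReal (∫ x, α * p x ^ 2 + (2 / lam + 2) * ‖H x‖ ^ 2) := by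
  have l2h : L2loc fun x => α * (Z x + p x) := (hZL.l2.add hp.l2loc).const_mul α
  have l2F : ∀ j, L2loc fun x => matVec (A x) (DZ x) j - H x j := fun j =>
    (hA.l2loc_flux hZL.grad j).sub (hH j).l2loc
  have iH : Integrable fun x => ‖H x‖ ^ 2 := by
    simp only [norm_sq_eq_sum]
    exact integrable_finsetSum _ fun j _ => (hH j).integrable_sq
  have iR : Integrable fun x => α * p x ^ 2 + (2 / lam + 2) * ‖H x‖ ^ 2 :=
    (hp.integrable_sq.const_mul α).add (iH.const_mul _)
  obtain ⟨C, hC0, hC⟩ := exists_pderiv_cutoff_le d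
  -- Bound for the cut-off error: twice (4/lam + 1) from the pointwise inequality, with |∇χ|² ≤ d
  -- C²/(n+1)². The rate 1/(n+1) kept below is weaker but sufficient.
  set B := (8 / lam + 2) * (d * C ^ 2 * ∫ x, Z x ^ 2) with hB
  have main : ∀ n : ℕ, Integrable (fun x => cutoff ((n : ℝ) + 1) x ^ 2 *
      (α * Z x ^ 2 + lam * ‖DZ x‖ ^ 2)) ∧ ∫ x, cutoff ((n : ℝ) + 1) x ^ 2 *
      (α * Z x ^ 2 + lam * ‖DZ x‖ ^ 2) ≤ (∫ x, α * p x ^ 2 + (2 / lam + 2) * ‖H x‖ ^ 2) +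
        B * (1 / ((n : ℝ) + 1)) := by
    intro n
    have hR : (0 : ℝ) < n + 1 := by positivity
    set χ : E d → ℝ := cutoff ((n : ℝ) + 1) with hχd
    have hχ : IsTest χ := isTest_cutoff hR
    have nDZ := L2loc.norm_vec hZL.grad
    have i1 : Integrable fun x => χ x ^ 2 * (α * Z x ^ 2 + lam * ‖DZ x‖ ^ 2) := by
      have j1 := integrable_sq_mul hZL.l2 (hχ.mul hχ)
      have j2 := integrable_sq_mul nDZ (hχ.mul hχ)
      refine ((j1.const_mul α).add (j2.const_mul lam)).congr (ae_of_all _ fun x => ?_)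
      simp only [Pi.add_apply]
      ring
    refine ⟨i1, ?_⟩
    have key := test_extension l2h l2F heq (hχ.mul hχ) hZL
    have keyi := integrable_test_extension l2h l2F (hχ.mul hχ) hZL.l2 hZL.grad
    have i2 : Integrable fun x => (2⁻¹ * (α * p x ^ 2 + (2 / lam + 2) * ‖H x‖ ^ 2)) :=
      iR.const_mul _
    have i3 : Integrable fun x => (4 / lam + 1) * (Z x ^ 2 * (d * (C / ((n : ℝ) + 1)) ^ 2)) :=
      (hZ.integrable_sq.mul_const _).const_mul _
    have i4 : Integrable fun x => 2⁻¹ * (χ x ^ 2 * (α * Z x ^ 2 + lam * ‖DZ x‖ ^ 2)) -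
        2⁻¹ * (α * p x ^ 2 + (2 / lam + 2) * ‖H x‖ ^ 2) := (i1.const_mul _).sub i2
    have i5 : Integrable fun x => 2⁻¹ * (χ x ^ 2 * (α * Z x ^ 2 + lam * ‖DZ x‖ ^ 2)) -
        2⁻¹ * (α * p x ^ 2 + (2 / lam + 2) * ‖H x‖ ^ 2) -
        (4 / lam + 1) * (Z x ^ 2 * (d * (C / ((n : ℝ) + 1)) ^ 2)) := i4.sub i3
    have hle := integral_mono_ae i5 keyi ?_
    · rw [key, integral_sub i4 i3, integral_sub (i1.const_mul _) i2, integral_const_mul,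
        integral_const_mul, integral_const_mul, integral_mul_const] at hle
      have hZ0 : 0 ≤ ∫ x, Z x ^ 2 := integral_nonneg fun x => sq_nonneg _
      have hn1 : (C / ((n : ℝ) + 1)) ^ 2 ≤ C ^ 2 * (1 / ((n : ℝ) + 1)) := by
        rw [div_pow, mul_one_div]
        have : (n : ℝ) + 1 ≤ ((n : ℝ) + 1) ^ 2 := by nlinarith [n.cast_nonneg (α := ℝ)]
        gcongr
      have hn2 : (8 / lam + 2) * ((∫ x, Z x ^ 2) * (d * (C / ((n : ℝ) + 1)) ^ 2)) ≤
          B * (1 / ((n : ℝ) + 1)) := by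
        calc _ ≤ (8 / lam + 2) * ((∫ x, Z x ^ 2) * (d * (C ^ 2 * (1 / ((n : ℝ) + 1))))) := by
              gcongr
          _ = _ := by rw [hB]; ring
      have e1 : (8 / lam + 2) * ((∫ x, Z x ^ 2) * (d * (C / ((n : ℝ) + 1)) ^ 2)) =
          2 * ((4 / lam + 1) * ((∫ x, Z x ^ 2) * (d * (C / ((n : ℝ) + 1)) ^ 2))) := by ring
      rw [e1] at hn2
      linarith
    · filter_upwards [hA.bounds] with x hx
      have hX : ‖pgrad χ x‖ ^ 2 ≤ d * (C / ((n : ℝ) + 1)) ^ 2 := by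
        rw [norm_sq_eq_sum]
        calc ∑ i, pgrad χ x i ^ 2 ≤ ∑ _i : Fin d, (C / ((n : ℝ) + 1)) ^ 2 := by
              refine Finset.sum_le_sum fun i _ => ?_
              rw [pgrad_apply, ← sq_abs]
              exact pow_le_pow_left₀ (abs_nonneg _) (hC _ hR i x) 2
          _ = _ := by simp
      have ar := remainder_energy_arith (lam := lam) (α := α) (z := Z x) (p := p x) (χ := χ x)
        (a := ∑ j, DZ x j * matVec (A x) (DZ x) j) (b := ∑ j, H x j * DZ x j)
        (c := ∑ j, matVec (A x) (DZ x) j * pgrad χ x j) (e := ∑ j, H x j * pgrad χ x j)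
        (v := ‖DZ x‖) (h := ‖H x‖) (ξ := ‖pgrad χ x‖) hlam hα
        (by rw [← inner_eq_sum]; exact (hx (DZ x)).1) (abs_sum_mul_le_norm _ _)
        ((abs_sum_mul_le_norm _ _).trans (by gcongr; exact (hx (DZ x)).2))
        (abs_sum_mul_le_norm _ _)
      have e1 : α * (Z x + p x) * (χ x * χ x * Z x) +
          ∑ j, (matVec (A x) (DZ x) j - H x j) *
            (χ x * χ x * DZ x j + Z x * pderiv j (fun x => χ x * χ x) x) =
          α * (Z x + p x) * (χ x ^ 2 * Z x) + χ x ^ 2 * ((∑ j, DZ x j * matVec (A x) (DZ x) j) -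
            ∑ j, H x j * DZ x j) + 2 * (χ x * Z x * ((∑ j, matVec (A x) (DZ x) j * pgrad χ x j) -
              ∑ j, H x j * pgrad χ x j)) := by
        rw [← Finset.sum_sub_distrib, ← Finset.sum_sub_distrib, Finset.mul_sum, Finset.mul_sum,
          Finset.mul_sum, add_assoc, ← Finset.sum_add_distrib]
        congr 1
        · ring
        · refine Finset.sum_congr rfl fun j _ => ?_
          rw [pderiv_mul hχ.differentiable hχ.differentiable, pgrad_apply]
          ring
      rw [e1]
      refine le_trans ?_ ar
      have hχ1 : χ x ^ 2 ≤ 1 := pow_le_one₀ (cutoff_nonneg _ _) (cutoff_le_one _ _)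
      have q1 : χ x ^ 2 * (α / 2 * p x ^ 2 + (1 / lam + 1) * ‖H x‖ ^ 2) ≤
          1 * (α / 2 * p x ^ 2 + (1 / lam + 1) * ‖H x‖ ^ 2) := by gcongr
      have q2 : (4 / lam + 1) * (Z x ^ 2 * ‖pgrad χ x‖ ^ 2) ≤
          (4 / lam + 1) * (Z x ^ 2 * (d * (C / ((n : ℝ) + 1)) ^ 2)) := by gcongr
      have q3 : 2⁻¹ * (α * p x ^ 2 + (2 / lam + 2) * ‖H x‖ ^ 2) =
          1 * (α / 2 * p x ^ 2 + (1 / lam + 1) * ‖H x‖ ^ 2) := by ring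
      have q4 : 2⁻¹ * (χ x ^ 2 * (α * Z x ^ 2 + lam * ‖DZ x‖ ^ 2)) =
          χ x ^ 2 * (α / 2 * Z x ^ 2 + lam / 2 * ‖DZ x‖ ^ 2) := by ring
      rw [q3, q4]
      linarith
  have hnn : ∀ x, 0 ≤ α * Z x ^ 2 + lam * ‖DZ x‖ ^ 2 := fun x => by positivity
  have hlim : ∀ x, Tendsto (fun n : ℕ => ENNReal.ofReal (cutoff ((n : ℝ) + 1) x ^ 2 *
      (α * Z x ^ 2 + lam * ‖DZ x‖ ^ 2))) atTop
      (𝓝 (ENNReal.ofReal (α * Z x ^ 2 + lam * ‖DZ x‖ ^ 2))) := by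
    intro x
    obtain ⟨N, hN⟩ := exists_nat_ge ‖x‖
    refine tendsto_const_nhds.congr' ?_
    filter_upwards [eventually_ge_atTop N] with n hn
    have : (N : ℝ) ≤ n := by exact_mod_cast hn
    rw [cutoff_eq_one (by positivity) (by linarith), one_pow, one_mul]
  have hlimR : Tendsto (fun n : ℕ => ENNReal.ofReal
      ((∫ x, α * p x ^ 2 + (2 / lam + 2) * ‖H x‖ ^ 2) + B * (1 / ((n : ℝ) + 1)))) atTop
      (𝓝 (ENNReal.ofReal (∫ x, α * p x ^ 2 + (2 / lam + 2) * ‖H x‖ ^ 2))) := by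
    refine ENNReal.tendsto_ofReal ?_
    simpa using (tendsto_one_div_add_atTop_nhds_zero_nat.const_mul B).const_add
      (∫ x, α * p x ^ 2 + (2 / lam + 2) * ‖H x‖ ^ 2)
  -- Fatou's lemma: finiteness of the energy on the whole space is a conclusion, not an assumption.
  calc ∫⁻ x, ENNReal.ofReal (α * Z x ^ 2 + lam * ‖DZ x‖ ^ 2)
      = ∫⁻ x, liminf (fun n : ℕ => ENNReal.ofReal (cutoff ((n : ℝ) + 1) x ^ 2 *
        (α * Z x ^ 2 + lam * ‖DZ x‖ ^ 2))) atTop :=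
        lintegral_congr fun x => (hlim x).liminf_eq.symm
    _ ≤ liminf (fun n : ℕ => ∫⁻ x, ENNReal.ofReal (cutoff ((n : ℝ) + 1) x ^ 2 *
        (α * Z x ^ 2 + lam * ‖DZ x‖ ^ 2))) atTop :=
        lintegral_liminf_le' fun n => (main n).1.aestronglyMeasurable.aemeasurable.ennreal_ofReal
    _ ≤ liminf (fun n : ℕ => ENNReal.ofReal
      ((∫ x, α * p x ^ 2 + (2 / lam + 2) * ‖H x‖ ^ 2) + B * (1 / ((n : ℝ) + 1)))) atTop := by
        refine liminf_le_liminf (Eventually.of_forall fun n => ?_)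
        rw [← ofReal_integral_eq_lintegral_ofReal (main n).1
          (ae_of_all _ fun x => mul_nonneg (sq_nonneg _) (hnn x))]
        exact ENNReal.ofReal_le_ofReal (main n).2
    _ = _ := hlimR.liminf_eq

end

/-! ### The estimate at unit scale. -/

section

variable {d : ℕ} {lam : ℝ} {A : E d → Matrix (Fin d) (Fin d) ℝ} {M : Matrix (Fin d) (Fin d) ℝ}
  {φ : Fin d → E d → ℝ} {Φ : Fin d → E d → E d} {σ : Fin d → Fin d → Fin d → E d → ℝ}

/-- The sum of the squared entries of an elliptic matrix is bounded from below. -/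
theorem sq_le_sum_sq_entries {B : Matrix (Fin d) (Fin d) ℝ} (hlam : 0 < lam)
    (h : ∀ ξ : E d, lam * ‖ξ‖ ^ 2 ≤ inner ℝ ξ (matVec B ξ)) (i : Fin d) :
    lam ^ 2 ≤ ∑ j, ∑ k, B j k ^ 2 := by
  have h1 := h (basisVec i)
  have e1 : ‖(basisVec i : E d)‖ = 1 := by simp [basisVec]
  have e2 : inner ℝ (basisVec i) (matVec B (basisVec i)) = B i i := by
    rw [← matVec_basisVec B i i, basisVec, EuclideanSpace.inner_single_left]
    simp
  rw [e1, e2, one_pow, mul_one] at h1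
  calc lam ^ 2 ≤ B i i ^ 2 := pow_le_pow_left₀ hlam.le h1 2
    _ ≤ ∑ k, B i k ^ 2 :=
      Finset.single_le_sum (f := fun k => B i k ^ 2) (fun k _ => sq_nonneg _) (Finset.mem_univ i)
    _ ≤ _ := Finset.single_le_sum (f := fun j => ∑ k, B j k ^ 2)
      (fun j _ => Finset.sum_nonneg fun k _ => sq_nonneg _) (Finset.mem_univ i)

/-- The coordinates, as locally square integrable functions with constant gradient. -/
theorem h1L_coord (i : Fin d) : H1L (fun x : E d => x i) fun j _ => basisVec i j := by
  have hp : ∀ j (x : E d), pderiv j (fun x : E d => x i) x = basisVec i j := fun j x => by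
    have : HasFDerivAt (fun x : E d => x i) (EuclideanSpace.proj i : E d →L[ℝ] ℝ) x :=
      (EuclideanSpace.proj i : E d →L[ℝ] ℝ).hasFDerivAt
    rw [pderiv, this.fderiv]
    simp [basisVec, eq_comm]
  have hc : Continuous fun x : E d => x i := by fun_prop
  refine ⟨hc.l2loc, fun j => continuous_const.l2loc, ?_⟩
  have := weakGrad_of_differentiable (u := fun x : E d => x i)
    (EuclideanSpace.proj i : E d →L[ℝ] ℝ).differentiable hc (fun j => by
      rw [funext (hp j)]; exact continuous_const)
  intro η hη j
  have h1 := this η hη j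
  simp only [hp] at h1
  exact h1

/-- The gradient of the remainder is locally square integrable as soon as the products of the
corrector with the first and second derivatives of the limit are. -/
theorem CorrectorData.l2loc_remainderGrad (h : CorrectorData lam A M φ Φ σ) (hlam : 0 < lam)
    {u u0 : E d → ℝ} {Du Du0 : E d → E d} {D2 : Fin d → E d → E d} (h0 : IsH1 u0 Du0)
    (hD2 : ∀ i, IsH1 (fun x => Du0 x i) (D2 i)) (hu : IsH1 u Du)
    (h1 : ∀ i, L2loc fun x => φ i x * Du0 x i) (h2 : ∀ i j, L2loc fun x => φ i x * D2 i x j)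
    (j : Fin d) : L2loc fun x => remainderGrad φ Φ Du Du0 D2 x j := by
  have hg := fun i => (hD2 i).h1L
  have h3 : ∀ i j, L2loc fun x => Du0 x i * Φ i x j := by
    intro i j
    -- The corrector equation says that φ_i + x_i is A-harmonic, so it plays the role of ψ with
    -- weight ∂_i u0. The linear part x_i is locally bounded and its contribution is subtracted
    -- again in `h4`.
    have hψ : H1L (fun x => φ i x + x i) fun j x => (Φ i x + basisVec i) j :=
      (h.phi i).add (h1L_coord i)
    have hxc : Continuous fun x : E d => x i := by fun_prop
    have hψ1 : L2loc fun x => (φ i x + x i) * Du0 x i := by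
      simp only [add_mul]
      exact (h1 i).add ((hg i).l2.continuous_mul hxc)
    have hψ2 : ∀ j, L2loc fun x => (φ i x + x i) * D2 i x j := fun j => by
      simp only [add_mul]
      exact (h2 i j).add (((hg i).grad j).continuous_mul hxc)
    have h4 := (l2loc_mul_grad hlam h.elliptic hψ (h.corrector_eq i) (hg i) hψ1 hψ2 j).sub
      ((hg i).l2.const_mul (basisVec i j))
    refine (congrArg L2loc (funext fun x => ?_)).mp h4
    simp only [PiLp.add_apply]
    ring
  simp only [remainderGrad_apply]
  exact ((hu.h1L.grad j).sub (h0.h1L.grad j)).sub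
    (L2loc.sum _ fun i => (h2 i j).add (h3 i j))

/-- The terms φ_i A∇∂_i u0 in A∇Z and in the right-hand side flux cancel, leaving the expression of
`CorrectorData.remainder_eq`. -/
theorem matVec_remainderGrad_sub (A : E d → Matrix (Fin d) (Fin d) ℝ) (φ : Fin d → E d → ℝ)
    (Φ : Fin d → E d → E d) (σ : Fin d → Fin d → Fin d → E d → ℝ) (Du Du0 : E d → E d)
    (D2 : Fin d → E d → E d) (x : E d) (j : Fin d) :
    matVec (A x) (remainderGrad φ Φ Du Du0 D2 x) j - remainderFlux A φ σ D2 x j =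
      matVec (A x) (Du x) j - (∑ i, Du0 x i * matVec (A x) (Φ i x + basisVec i) j) -
        ∑ i, ∑ k, σ i j k x * D2 i x k := by
  have e0 : remainderGrad φ Φ Du Du0 D2 x = Du x - (∑ i, Du0 x i • (Φ i x + basisVec i)) -
      ∑ i, φ i x • D2 i x := by
    simp only [remainderGrad, smul_add, Finset.sum_add_distrib, sum_smul_basisVec]
    abel
  have e1 : matVec (A x) (remainderGrad φ Φ Du Du0 D2 x) = matVec (A x) (Du x) -
      (∑ i, Du0 x i • matVec (A x) (Φ i x + basisVec i)) -
      ∑ i, φ i x • matVec (A x) (D2 i x) := by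
    simp only [e0, matVec_sub, matVec_sum, matVec_smul]
  rw [e1]
  simp [remainderFlux]

theorem lintegral_mul_enorm_sq_add {Z : E d → ℝ} {D : E d → E d} {α β : ℝ} (hα : 0 ≤ α)
    (hβ : 0 ≤ β) (hZ : AEStronglyMeasurable Z volume) :
    ENNReal.ofReal α * (∫⁻ x, ‖Z x‖ₑ ^ 2) + ENNReal.ofReal β * (∫⁻ x, ‖D x‖ₑ ^ 2) =
      ∫⁻ x, ENNReal.ofReal (α * Z x ^ 2 + β * ‖D x‖ ^ 2) := by
  rw [← lintegral_const_mul' _ _ ENNReal.ofReal_ne_top,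
    ← lintegral_const_mul' _ _ ENNReal.ofReal_ne_top,
    ← lintegral_add_left' ((hZ.enorm.pow_const 2).const_mul _)]
  refine lintegral_congr fun x => ?_
  rw [enorm_sq_eq_ofReal, ENNReal.ofReal_add (by positivity) (by positivity),
    ENNReal.ofReal_mul hα, ENNReal.ofReal_mul hβ, ← enorm_norm (D x), enorm_sq_eq_ofReal]

/-- The two-scale expansion error at unit scale, for one realization. -/
theorem CorrectorData.remainder_le (h : CorrectorData lam A M φ Φ σ) (hlam : 0 < lam) {α : ℝ}
    (hα : 0 < α) {f u u0 : E d → ℝ} {Du Du0 : E d → E d} {D2 : Fin d → E d → E d}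
    (h0 : IsWeakSolution (fun _ => M) α f u0 Du0) (hD2 : ∀ i, IsH1 (fun x => Du0 x i) (D2 i))
    (hu : IsWeakSolution A α f u Du) :
    ENNReal.ofReal α * (∫⁻ x, ‖u x - (u0 x + ∑ i, φ i x * Du0 x i)‖ₑ ^ 2) +
        ENNReal.ofReal lam * (∫⁻ x, ‖remainderGrad φ Φ Du Du0 D2 x‖ₑ ^ 2) ≤
      ENNReal.ofReal (4 / lam + 4) *
        (ENNReal.ofReal α * (∫⁻ x, ENNReal.ofReal ((∑ i, φ i x ^ 2) * ‖Du0 x‖ ^ 2)) +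
          ∫⁻ x, ENNReal.ofReal (((∑ i, ∑ j, ∑ k, σ i j k x ^ 2) +
            (∑ j, ∑ k, A x j k ^ 2) * (∑ i, φ i x ^ 2)) * (∑ i, ‖D2 i x‖ ^ 2))) := by
  set Q : E d → ℝ := fun x => (∑ i, φ i x ^ 2) * ‖Du0 x‖ ^ 2 with hQ
  set S : E d → ℝ := fun x => ((∑ i, ∑ j, ∑ k, σ i j k x ^ 2) +
    (∑ j, ∑ k, A x j k ^ 2) * (∑ i, φ i x ^ 2)) * (∑ i, ‖D2 i x‖ ^ 2) with hS
  have hα' : ENNReal.ofReal α ≠ 0 := by simpa using hα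
  have hc' : ENNReal.ofReal (4 / lam + 4) ≠ 0 := by
    have : 0 < 4 / lam + 4 := by positivity
    simpa using this
  have Q0 : ∀ x, 0 ≤ Q x := fun x =>
    mul_nonneg (Finset.sum_nonneg fun i _ => sq_nonneg _) (sq_nonneg _)
  have s1 : ∀ x, 0 ≤ ∑ i, ∑ j, ∑ k, σ i j k x ^ 2 := fun x => by positivity
  have s2 : ∀ x, 0 ≤ ∑ j, ∑ k, A x j k ^ 2 := fun x => by positivity
  have s3 : ∀ x, 0 ≤ ∑ i, φ i x ^ 2 := fun x => by positivity
  have s4 : ∀ x, 0 ≤ ∑ i, ‖D2 i x‖ ^ 2 := fun x => by positivity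
  have S0 : ∀ x, 0 ≤ S x := fun x => by positivity
  have mφ := fun i => (h.phi i).l2.aestronglyMeasurable
  have mσ := fun i j k => (h.sigma i j k).aestronglyMeasurable
  have mA : ∀ j k, AEStronglyMeasurable (fun x => A x j k) volume := fun j k =>
    (h.elliptic.measurable j k).aestronglyMeasurable
  have mD0 := h0.isH1.memLp_grad.1
  have mD2 := fun i => (hD2 i).memLp_grad.1
  have mφs : AEStronglyMeasurable (fun x => ∑ i, φ i x ^ 2) volume :=
    Finset.aestronglyMeasurable_fun_sum _ fun i _ => (mφ i).pow 2
  have mQ : AEStronglyMeasurable Q volume := mφs.mul (mD0.norm.pow 2)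
  have mS : AEStronglyMeasurable S volume :=
    ((Finset.aestronglyMeasurable_fun_sum _ fun i _ => Finset.aestronglyMeasurable_fun_sum _
      fun j _ => Finset.aestronglyMeasurable_fun_sum _ fun k _ => (mσ i j k).pow 2).add
      ((Finset.aestronglyMeasurable_fun_sum _ fun j _ => Finset.aestronglyMeasurable_fun_sum _
        fun k _ => (mA j k).pow 2).mul mφs)).mul
      (Finset.aestronglyMeasurable_fun_sum _ fun i _ => (mD2 i).norm.pow 2)
  -- An infinite right-hand side makes the claim trivial, because its prefactors are nonzero. From
  -- here on finiteness supplies every integrability needed.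
  by_cases hQt : ∫⁻ x, ENNReal.ofReal (Q x) = ⊤
  · rw [hQt, ENNReal.mul_top hα', top_add, ENNReal.mul_top hc']
    exact le_top
  by_cases hSt : ∫⁻ x, ENNReal.ofReal (S x) = ⊤
  · rw [hSt, add_top, ENNReal.mul_top hc']
    exact le_top
  have iQ : Integrable Q := (lintegral_ofReal_ne_top_iff_integrable mQ (ae_of_all _ Q0)).1 hQt
  have iS : Integrable S := (lintegral_ofReal_ne_top_iff_integrable mS (ae_of_all _ S0)).1 hSt
  have hL2 : ∀ {g B : E d → ℝ}, AEStronglyMeasurable g volume → Integrable B →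
      (∀ᵐ x, g x ^ 2 ≤ B x) → MemLp g 2 volume := fun hg hB hle =>
    (memLp_two_iff_integrable_sq hg).2 (hB.mono' (hg.pow 2) (by
      filter_upwards [hle] with x hx
      rwa [Real.norm_of_nonneg (sq_nonneg _)]))
  set p : E d → ℝ := fun x => ∑ i, φ i x * Du0 x i with hp
  have mD0i : ∀ i, AEStronglyMeasurable (fun x => Du0 x i) volume := fun i =>
    (h0.isH1.h1L.grad i).aestronglyMeasurable
  have hpQ : ∀ x, p x ^ 2 ≤ Q x := fun x => by
    simp only [hp, hQ, norm_sq_eq_sum]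
    exact Finset.sum_mul_sq_le_sq_mul_sq _ _ _
  have hp2 : MemLp p 2 volume := hL2 (Finset.aestronglyMeasurable_fun_sum _ fun i _ =>
    (mφ i).mul (mD0i i)) iQ (ae_of_all _ hpQ)
  have h1 : ∀ i, L2loc fun x => φ i x * Du0 x i := fun i =>
    (hL2 (g := fun x => φ i x * Du0 x i) ((mφ i).mul (mD0i i)) iQ (ae_of_all _ fun x => by
      simp only [hQ, mul_pow]
      have t1 : φ i x ^ 2 ≤ ∑ i, φ i x ^ 2 :=
        Finset.single_le_sum (f := fun i => φ i x ^ 2) (fun i _ => sq_nonneg _) (Finset.mem_univ i)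
      have t2 : Du0 x i ^ 2 ≤ ‖Du0 x‖ ^ 2 := by
        rw [← sq_abs]
        exact pow_le_pow_left₀ (abs_nonneg _) (abs_apply_le_norm _ _) 2
      gcongr)).l2loc
  -- The integrand S contains φ only with the factor |A|². Ellipticity gives |A|² ≥ lam², so this
  -- factor can be divided out.
  have h2 : ∀ i j, L2loc fun x => φ i x * D2 i x j := fun i j =>
    (hL2 (g := fun x => φ i x * D2 i x j) ((mφ i).mul ((hD2 i).h1L.grad j).aestronglyMeasurable) (iS.const_mul (lam ^ 2)⁻¹) (by
      filter_upwards [h.elliptic.bounds] with x hx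
      have t0 := sq_le_sum_sq_entries hlam (fun ξ => (hx ξ).1) i
      have t1 : φ i x ^ 2 ≤ ∑ i, φ i x ^ 2 :=
        Finset.single_le_sum (f := fun i => φ i x ^ 2) (fun i _ => sq_nonneg _) (Finset.mem_univ i)
      have t2 : D2 i x j ^ 2 ≤ ‖D2 i x‖ ^ 2 := by
        rw [← sq_abs]
        exact pow_le_pow_left₀ (abs_nonneg _) (abs_apply_le_norm _ _) 2
      have t3 : ‖D2 i x‖ ^ 2 ≤ ∑ i, ‖D2 i x‖ ^ 2 :=
        Finset.single_le_sum (f := fun i => ‖D2 i x‖ ^ 2) (fun i _ => sq_nonneg _)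
          (Finset.mem_univ i)
      rw [le_inv_mul_iff₀ (by positivity), mul_pow, ← mul_assoc]
      calc lam ^ 2 * φ i x ^ 2 * D2 i x j ^ 2
          ≤ (∑ j, ∑ k, A x j k ^ 2) * (∑ i, φ i x ^ 2) * ∑ i, ‖D2 i x‖ ^ 2 := by
            have := t2.trans t3
            have := s2 x
            gcongr
        _ ≤ S x := by
            simp only [hS]
            exact mul_le_mul_of_nonneg_right (le_add_of_nonneg_left (s1 x)) (s4 x))).l2loc
  have hw := h.hasWeakGradient_remainder h0.isH1 hD2 hu.isH1
  set Z : E d → ℝ := fun x => u x - (u0 x + p x) with hZ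
  set DZ := remainderGrad φ Φ Du Du0 D2 with hDZ
  have hZ2 : MemLp Z 2 volume := hu.isH1.memLp.sub (h0.isH1.memLp.add hp2)
  have hZL : H1L Z fun j x => DZ x j :=
    ⟨hZ2.l2loc, h.l2loc_remainderGrad hlam h0.isH1 hD2 hu.isH1 h1 h2, hw.weakGrad⟩
  have hHj : ∀ j, MemLp (fun x => remainderFlux A φ σ D2 x j) 2 volume := fun j => by
    refine hL2 ?_ (iS.const_mul 2) (ae_of_all _ fun x => ?_)
    · have : (fun x => remainderFlux A φ σ D2 x j) = fun x => (∑ i, ∑ k, σ i j k x * D2 i x k) -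
          ∑ i, φ i x * matVec (A x) (D2 i x) j := by
        funext x
        simp [remainderFlux]
      rw [this]
      exact (Finset.aestronglyMeasurable_fun_sum _ fun i _ =>
        Finset.aestronglyMeasurable_fun_sum _ fun k _ =>
          (mσ i j k).mul ((hD2 i).h1L.grad k).aestronglyMeasurable).sub
        (Finset.aestronglyMeasurable_fun_sum _ fun i _ => (mφ i).mul
          (h.elliptic.l2loc_flux (hD2 i).h1L.grad j).aestronglyMeasurable)
    · refine le_trans ?_ (remainderFlux_norm_sq_le A φ σ D2 x)
      rw [← sq_abs]
      exact pow_le_pow_left₀ (abs_nonneg _) (abs_apply_le_norm _ _) 2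
  -- The zeroth-order term α(u - u0) of the remainder equation is α(Z + p).
  have key := lintegral_energy_le hlam h.elliptic hα hZ2 hp2 hZL hHj (fun η hη => by
    rw [← h.remainder_eq h0 hD2 hu hη]
    refine integral_congr_ae (ae_of_all _ fun x => ?_)
    simp only [hDZ, matVec_remainderGrad_sub, hZ]
    ring)
  change ENNReal.ofReal α * (∫⁻ x, ‖Z x‖ₑ ^ 2) + ENNReal.ofReal lam * (∫⁻ x, ‖DZ x‖ₑ ^ 2) ≤ _
  rw [lintegral_mul_enorm_sq_add hα.le hlam.le hZ2.1]
  refine key.trans ?_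
  rw [← ofReal_integral_eq_lintegral_ofReal iQ (ae_of_all _ Q0),
    ← ofReal_integral_eq_lintegral_ofReal iS (ae_of_all _ S0), ← ENNReal.ofReal_mul hα.le,
    ← ENNReal.ofReal_add (mul_nonneg hα.le (integral_nonneg Q0)) (integral_nonneg S0),
    ← ENNReal.ofReal_mul (by positivity)]
  refine ENNReal.ofReal_le_ofReal ?_
  rw [← integral_const_mul, ← integral_add (iQ.const_mul α) iS, ← integral_const_mul]
  have iH : Integrable fun x => ‖remainderFlux A φ σ D2 x‖ ^ 2 := by
    simp only [norm_sq_eq_sum]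
    exact integrable_finsetSum _ fun j _ => (hHj j).integrable_sq
  refine integral_mono ((hp2.integrable_sq.const_mul α).add (iH.const_mul _))
    (((iQ.const_mul α).add iS).const_mul _) fun x => ?_
  have b1 := remainderFlux_norm_sq_le A φ σ D2 x
  have b2 := hpQ x
  have b3 : 0 < 4 / lam := by positivity
  have b4 : α * p x ^ 2 ≤ (4 / lam + 4) * (α * Q x) := by
    calc α * p x ^ 2 ≤ 1 * (α * Q x) := by rw [one_mul]; gcongr
      _ ≤ _ := mul_le_mul_of_nonneg_right (by linarith) (mul_nonneg hα.le (Q0 x))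
  have b5 : (2 / lam + 2) * ‖remainderFlux A φ σ D2 x‖ ^ 2 ≤ (4 / lam + 4) * S x := by
    calc _ ≤ (2 / lam + 2) * (2 * S x) := mul_le_mul_of_nonneg_left b1 (by positivity)
      _ = _ := by ring
  simp only [mul_add] at b4 b5 ⊢
  linarith

end

/-! ### Rescaling, and passage from the random field to one realization. -/

section

variable {d : ℕ} {lam : ℝ} {A : E d → Matrix (Fin d) (Fin d) ℝ} {M : Matrix (Fin d) (Fin d) ℝ}
  {φ : Fin d → E d → ℝ} {Φ : Fin d → E d → E d} {σ : Fin d → Fin d → Fin d → E d → ℝ}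

theorem quasiMeasurePreserving_const_smul {c : ℝ} (hc : c ≠ 0) :
    Measure.QuasiMeasurePreserving (fun x : E d => c • x) volume volume := by
  refine ⟨measurable_const_smul c, ?_⟩
  rw [Measure.map_addHaar_smul _ hc]
  exact Measure.smul_absolutelyContinuous

open scoped Pointwise in
theorem L2loc.comp_smul {f : E d → ℝ} (hf : L2loc f) {c : ℝ} (hc : c ≠ 0) :
    L2loc fun x => f (c • x) := by
  intro K hK
  have hm : AEStronglyMeasurable (fun x => f (c • x)) volume :=
    hf.aestronglyMeasurable.comp_quasiMeasurePreserving (quasiMeasurePreserving_const_smul hc)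
  have hcK : IsCompact (c • K) := hK.smul c
  have h1 := (integrable_indicator_iff hcK.measurableSet).2 (hf _ hcK).integrable_sq
  have h2 := h1.comp_smul hc
  rw [memLp_two_iff_integrable_sq hm.restrict]
  refine (integrable_indicator_iff hK.measurableSet).1 (h2.congr (ae_of_all _ fun x => ?_))
  by_cases hx : x ∈ K
  · simp [hx, Set.smul_mem_smul_set hx]
  · have : c • x ∉ c • K := fun h => hx ((Set.smul_mem_smul_set_iff₀ hc K x).1 h)
    simp [hx, this]

/-- Every test function is a rescaled one, so weak identities are transported by a change of
variables. -/
theorem exists_isTest_comp_smul {η : E d → ℝ} (hη : IsTest η) {c : ℝ} (hc : c ≠ 0) :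
    ∃ ζ, IsTest ζ ∧ (∀ x, η x = ζ (c • x)) ∧ ∀ i x, pderiv i η x = c * pderiv i ζ (c • x) := by
  have hζ := hη.comp_smul (inv_ne_zero hc)
  have h : ∀ x, η x = η (c⁻¹ • c • x) := fun x => by rw [inv_smul_smul₀ hc]
  refine ⟨_, hζ, h, fun i x => ?_⟩
  have := pderiv_comp_smul hζ.differentiable c i x
  rw [← this]
  congr 1
  exact funext h

theorem Elliptic.comp_smul (h : Elliptic lam A) {c : ℝ} (hc : c ≠ 0) :
    Elliptic lam fun x => A (c • x) :=
  ⟨fun i j => (h.measurable i j).comp (measurable_const_smul c),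
    (quasiMeasurePreserving_const_smul hc).ae h.bounds⟩

theorem H1L.comp_smul {u : E d → ℝ} {D : Fin d → E d → ℝ} (h : H1L u D) {c : ℝ} (hc : c ≠ 0) :
    H1L (fun x => c⁻¹ * u (c • x)) fun j x => D j (c • x) := by
  refine ⟨(h.l2.comp_smul hc).const_mul _, fun j => (h.grad j).comp_smul hc, fun η hη j => ?_⟩
  obtain ⟨ζ, hζ, e1, e2⟩ := exists_isTest_comp_smul hη hc
  have e : ∀ x, c⁻¹ * u (c • x) * pderiv j η x = (fun y => u y * pderiv j ζ y) (c • x) := by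
    intro x
    rw [e2]
    field_simp
  rw [integral_congr_ae (ae_of_all _ e)]
  simp only [e1]
  rw [Measure.integral_comp_smul volume (fun y => u y * pderiv j ζ y),
    Measure.integral_comp_smul volume (fun y => D j y * ζ y),
    h.weak ζ hζ j, smul_neg]

/-- The rescaled extended corrector belongs to the rescaled coefficient field. -/
theorem CorrectorData.comp_smul (h : CorrectorData lam A M φ Φ σ) {c : ℝ} (hc : c ≠ 0) :
    CorrectorData lam (fun x => A (c • x)) M (fun i x => c⁻¹ * φ i (c • x))
      (fun i x => Φ i (c • x)) (fun i j k x => c⁻¹ * σ i j k (c • x)) where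
  elliptic := h.elliptic.comp_smul hc
  phi i := (h.phi i).comp_smul hc
  sigma i j k := ((h.sigma i j k).comp_smul hc).const_mul _
  corrector_eq i η hη := by
    obtain ⟨ζ, hζ, e1, e2⟩ := exists_isTest_comp_smul hη hc
    have e : ∀ x, ∑ j, matVec (A (c • x)) (Φ i (c • x) + basisVec i) j * pderiv j η x =
        (fun y => c * ∑ j, matVec (A y) (Φ i y + basisVec i) j * pderiv j ζ y) (c • x) := by
      intro x
      simp only [e2, Finset.mul_sum]
      exact Finset.sum_congr rfl fun j _ => by ring
    rw [integral_congr_ae (ae_of_all _ e), Measure.integral_comp_smul volume (fun y =>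
      c * ∑ j, matVec (A y) (Φ i y + basisVec i) j * pderiv j ζ y), integral_const_mul, h.corrector_eq i ζ hζ]
    simp
  skew i j k := by
    filter_upwards [(quasiMeasurePreserving_const_smul hc).ae (h.skew i j k)] with x hx
    rw [hx, mul_neg]
  div_sigma i j η hη := by
    obtain ⟨ζ, hζ, e1, e2⟩ := exists_isTest_comp_smul hη hc
    have e : ∀ x, ∑ k, c⁻¹ * σ i j k (c • x) * pderiv k η x =
        (fun y => ∑ k, σ i j k y * pderiv k ζ y) (c • x) := by
      intro x
      refine Finset.sum_congr rfl fun k _ => ?_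
      rw [e2]
      field_simp
    rw [integral_congr_ae (ae_of_all _ e)]
    simp only [e1]
    rw [Measure.integral_comp_smul volume (fun y => ∑ k, σ i j k y * pderiv k ζ y),
      Measure.integral_comp_smul volume (fun y =>
      (matVec (A y) (Φ i y + basisVec i) - matVec M (basisVec i)) j * ζ y),
      ← h.div_sigma i j ζ hζ, smul_neg]

/-- There are finitely many indices, and the test functions are quantified inside each almost sure
statement, so a single null set is discarded. -/
theorem IsExtendedCorrector.ae_correctorData [MeasurableSpace (CoeffField d lam)]
    {P : Measure (CoeffField d lam)} {φ : Fin d → CoeffField d lam → E d → ℝ}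
    {Dφ : Fin d → CoeffField d lam → E d → E d}
    {σ : Fin d → Fin d → Fin d → CoeffField d lam → E d → ℝ}
    {Dσ : Fin d → Fin d → Fin d → CoeffField d lam → E d → E d}
    (h : IsExtendedCorrector P φ Dφ σ Dσ) : ∀ᵐ a ∂P, CorrectorData lam a.toFun (ahom P Dφ)
      (fun i => φ i a) (fun i => Dφ i a) (fun i j k => σ i j k a) := by
  have h1 := ae_all_iff.2 fun i => (h.inH_phi i).isH1loc
  have h2 := ae_all_iff.2 fun i => ae_all_iff.2 fun j => ae_all_iff.2 fun k =>
    (h.inH_sigma i j k).isH1loc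
  have h3 := ae_all_iff.2 h.corrector_eq
  have h4 := ae_all_iff.2 fun i => ae_all_iff.2 fun j => ae_all_iff.2 fun k => h.skew i j k
  have h5 := ae_all_iff.2 fun i => ae_all_iff.2 fun j => h.div_sigma i j
  filter_upwards [h1, h2, h3, h4, h5] with a g1 g2 g3 g4 g5
  exact ⟨⟨a.measurable, a.elliptic⟩, fun i => (g1 i).h1L, fun i j k => (g2 i j k).memLp, g3, g4, g5⟩

/-- The two-scale expansion error at scale `ε`, for one realization. -/
theorem CorrectorData.remainder_scale_le (h : CorrectorData lam A M φ Φ σ) (hlam : 0 < lam) {α : ℝ}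
    (hα : 0 < α) {f u u0 : E d → ℝ} {Du Du0 : E d → E d} {D2 : Fin d → E d → E d}
    (h0 : IsWeakSolution (fun _ => M) α f u0 Du0) (hD2 : ∀ i, IsH1 (fun x => Du0 x i) (D2 i))
    {ε : ℝ} (hε : 0 < ε) (hu : IsWeakSolution (fun x => A (ε⁻¹ • x)) α f u Du) :
    ∃ DZ, HasWeakGradient (remainder φ ε u u0 Du0) DZ ∧
      ENNReal.ofReal α * (∫⁻ x, ‖remainder φ ε u u0 Du0 x‖ₑ ^ 2) +
        ENNReal.ofReal lam * (∫⁻ x, ‖DZ x‖ₑ ^ 2) ≤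
      ENNReal.ofReal ((4 / lam + 4) * ε ^ 2) *
        (ENNReal.ofReal α *
            (∫⁻ x, ENNReal.ofReal ((∑ i, φ i (ε⁻¹ • x) ^ 2) * ‖Du0 x‖ ^ 2)) +
          ∫⁻ x, ENNReal.ofReal (((∑ i, ∑ j, ∑ k, σ i j k (ε⁻¹ • x) ^ 2) +
            (∑ j, ∑ k, A (ε⁻¹ • x) j k ^ 2) * (∑ i, φ i (ε⁻¹ • x) ^ 2)) *
              (∑ i, ‖D2 i x‖ ^ 2))) := by
  -- With c = ε⁻¹ the rescaled correctors are εφ(·/ε) and εσ(·/ε). Squaring them produces the factor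
  -- ε² that is extracted from both integrals below.
  have hs := h.comp_smul (inv_ne_zero hε.ne')
  simp only [inv_inv] at hs
  have eZ : remainder φ ε u u0 Du0 =
      fun x => u x - (u0 x + ∑ i, ε * φ i (ε⁻¹ • x) * Du0 x i) := by
    funext x
    simp only [remainder, Finset.mul_sum, mul_assoc]
  have hle := hs.remainder_le hlam hα h0 hD2 hu
  rw [eZ]
  refine ⟨_, hs.hasWeakGradient_remainder h0.isH1 hD2 hu.isH1, hle.trans (le_of_eq ?_)⟩
  rw [ENNReal.ofReal_mul (by positivity), mul_assoc]
  congr 1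
  rw [mul_add, mul_left_comm, ← lintegral_const_mul' (ENNReal.ofReal (ε ^ 2)) _
    ENNReal.ofReal_ne_top, ← lintegral_const_mul' (ENNReal.ofReal (ε ^ 2)) _ ENNReal.ofReal_ne_top]
  simp only [← ENNReal.ofReal_mul (sq_nonneg ε), mul_pow, ← Finset.mul_sum]
  congr 2
  · refine lintegral_congr fun x => congrArg ENNReal.ofReal ?_
    ring
  · refine funext fun x => congrArg ENNReal.ofReal ?_
    ring

end

end TwoScale

end

theorem theorem3 (d : ℕ) (lam : ℝ) (hlam : 0 < lam) :
    ∃ C : ℝ, 0 < C ∧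
      ∀ [MeasurableSpace (TwoScale.CoeffField d lam)]
        (P : Measure (TwoScale.CoeffField d lam)) [IsProbabilityMeasure P],
        TwoScale.StationaryErgodic P →
      ∀ (φ : Fin d → TwoScale.CoeffField d lam → TwoScale.E d → ℝ)
        (Dφ : Fin d → TwoScale.CoeffField d lam → TwoScale.E d → TwoScale.E d)
        (σ : Fin d → Fin d → Fin d → TwoScale.CoeffField d lam → TwoScale.E d → ℝ)
        (Dσ : Fin d → Fin d → Fin d → TwoScale.CoeffField d lam → TwoScale.E d → TwoScale.E d),
        TwoScale.IsExtendedCorrector P φ Dφ σ Dσ →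
      ∀ (α : ℝ), 0 < α →
      ∀ (f : TwoScale.E d → ℝ), MemLp f 2 volume →
      ∀ (u0 : TwoScale.E d → ℝ) (Du0 : TwoScale.E d → TwoScale.E d),
        TwoScale.IsWeakSolution (fun _ => TwoScale.ahom P Dφ) α f u0 Du0 →
      ∃ D2u0 : Fin d → TwoScale.E d → TwoScale.E d,
        (∀ i, TwoScale.IsH1 (fun x => Du0 x i) (D2u0 i)) ∧
        ∀ᵐ a ∂P, ∀ (ε : ℝ), 0 < ε →
          ∀ (uε : TwoScale.E d → ℝ) (Duε : TwoScale.E d → TwoScale.E d),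
          TwoScale.IsWeakSolution (fun x => a.toFun (ε⁻¹ • x)) α f uε Duε →
          ∃ DZ : TwoScale.E d → TwoScale.E d,
            TwoScale.HasWeakGradient
              (TwoScale.remainder (fun i => φ i a) ε uε u0 Du0) DZ ∧
            ENNReal.ofReal α *
                (∫⁻ x, ‖TwoScale.remainder (fun i => φ i a) ε uε u0 Du0 x‖ₑ ^ 2) +
              ENNReal.ofReal lam * (∫⁻ x, ‖DZ x‖ₑ ^ 2)
            ≤ ENNReal.ofReal (C * ε ^ 2) *
                (ENNReal.ofReal α *
                    (∫⁻ x, ENNReal.ofReal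
                      ((∑ i, φ i a (ε⁻¹ • x) ^ 2) * ‖Du0 x‖ ^ 2)) +
                  ∫⁻ x, ENNReal.ofReal
                    (((∑ i, ∑ j, ∑ k, σ i j k a (ε⁻¹ • x) ^ 2) +
                        (∑ j, ∑ k, a.toFun (ε⁻¹ • x) j k ^ 2) *
                          (∑ i, φ i a (ε⁻¹ • x) ^ 2)) *
                      (∑ i, ‖D2u0 i x‖ ^ 2))) := by
  -- Twice the constant 2/lam + 2 of `lintegral_energy_le`, the doubling coming from the two parts
  -- of the right-hand side flux.
  refine ⟨4 / lam + 4, by positivity, ?_⟩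
  intro _ P _ _ φ Dφ σ Dσ hc α hα f hf u0 Du0 h0
  have hdata := hc.ae_correctorData
  have hφ := ae_all_iff.2 hc.sublinear_phi
  have hσ := ae_all_iff.2 fun i => ae_all_iff.2 fun j => ae_all_iff.2 fun k =>
    hc.sublinear_sigma i j k
  -- The homogenized matrix and u0 are deterministic, so one good realization suffices for the
  -- regularity of u0; it exists because P is a probability measure. The second derivatives are thus
  -- fixed before the almost sure statement.
  obtain ⟨a, ha, haφ, haσ⟩ := (hdata.and (hφ.and hσ)).exists
  obtain ⟨D2u0, hD2⟩ := TwoScale.exists_second_derivatives (by positivity)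
    (ha.hom_elliptic hlam haφ haσ) hα hf h0
  refine ⟨D2u0, hD2, ?_⟩
  filter_upwards [hdata] with a ha ε hε uε Duε hu
  exact ha.remainder_scale_le hlam hα h0 hD2 hε hu
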